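/- **Setting.** Let $d\ge 0$ be an integer, $\varepsilon>0$, and let $\omega:\mathbb R^d\to(0,\infty)$ be continuously differentiable with minimum $\kappa:=\omega(0)$ and $|\partial\omega(q)|/\omega(q)\to0$ as $q\to\infty$. Let $\lambda:\mathbb R^d\to\mathbb C$ be continuously differentiable with $|\lambda|\le h$ and $|\partial\lambda|\le Ch$ for some $C>0$ and some square-integrable $h:\mathbb R^d\to(0,1]$. Let $\mathcal C=\bigcup_l\mathcal C_l$ be the set of finite configurations of points of $\mathbb R^d$ (functions on $\mathcal C_l$ are the symmetric functions of $l$ variables in $\mathbb R^d$), with the Lebesgue–Poisson measure $d\mu(Q)=\frac1{|Q|!}\prod_{q\in Q}dq$, and put $\omega(Q)=\sum_{q\in Q}\omega(q)$. On $\mathcal H=L^2(\mathcal C,\mathbb C^2;d\mu)$ consider, for $\alpha\ge0$, $$(HF)(Q)=(\varepsilon\sigma_3+\omega(Q))F(Q)+\alpha\sigma_1\Big[\sum_{q\in Q}\lambda(q)F(Q\setminus q)+\int\overline{\lambda(k)}F(Q\cup k)\,dk\Big].$$ Let $\mathcal H_n$ and $\mathcal H_{>n}$ be the subspaces of vectors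 with exactly $n$, respectively more than $n$, bosons. Let $B_n$ be the compression of $H$ to $\mathcal H_{>n}$, with domain $\{F\in\mathcal H_{>n}:\omega F\in L^2\}$, and $C_n^*:\mathcal H_n\to\mathcal H_{>n}$, $(C_n^*f)(Q)=\delta_{|Q|,n+1}\,\alpha\sigma_1\sum_{k\in Q}\lambda(k)f(Q\setminus k)$. For $\eta>0$ put $D_{n,\eta}=\{z\in\mathbb C:\operatorname{Re}z<-\varepsilon+(n+1)\kappa-\eta\}$. Let $\mathcal M_2$ be the space of complex $2\times2$ matrices with the operator norm. Let $\mathcal B_n$ be the space of families $\mu=(\mu^{(m)})_{0\le m\le n}$ of continuously differentiable functions $\mu^{(m)}(Q_1;Q_2;k_1,\dots,k_m)\in\mathcal M_2$ of $Q_1\in\mathcal C$, $Q_2\in\mathcal C_{n-m}$, $k_i\in\mathbb R^d$ (each is, for every value of $|Q_1|$, continuously differentiable in the tuple of all its variables, symmetric in the points of $Q_1$ and in those of $Q_2$), vanishing for $|Q_1|\le m$, such that for some $M$ the values and all first-order partial derivatives of $\mu^{(m)}$ (with respect to every coordinate of every variable) are bounded in norm by $M\prod_{q\in Q_1}h(q)\prod_{i=1}^mh(k_i)$;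 $\|\mu\|$ is the infimum of such $M$. For $|Q_2|=n-m$ and $|Q_1|>m$ put $$\begin{aligned}[][\Gamma(z)\mu]^{(m)}(Q_1;Q_2;k_1,\dots,k_m)=\alpha\,&(\varepsilon\sigma_3+\omega(Q_1\cup Q_2)-z)^{-1}\sigma_1\Big\{\sum_{q\in Q_1}\lambda(q)\,\mu^{(m)}(Q_1\setminus q;Q_2;k_1,\dots,k_m)\\&+\int\overline{\lambda(q')}\,\mu^{(m)}(Q_1\cup q';Q_2;k_1,\dots,k_m)\,dq'+\overline{\lambda(k_m)}\,\mu^{(m-1)}(Q_1;Q_2\cup k_m;k_1,\dots,k_{m-1})\Big\}\end{aligned}$$ (the last term is absent for $m=0$), and $[\Gamma(z)\mu]^{(m)}(Q_1;\cdot)=0$ for $|Q_1|\le m$. Let $\hat\mu_n(z)$ be the family whose only nonzero values are $[\hat\mu_n(z)]^{(0)}(\{q_1\};Q_2)=\alpha(\varepsilon\sigma_3+\omega(Q_2\cup q_1)-z)^{-1}\sigma_1\lambda(q_1)$, $|Q_2|=n$. **Proposition.** $\mathcal B_n$ is a Banach space. For every $\eta_0>0$ there is a constant $K>0$ such that for all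 $\eta\ge\eta_0$ and $n\ge0$ there is $\alpha_0=\alpha_0(\eta,n)>0$ such that for all $0\le\alpha<\alpha_0$ the following hold. 1. For every $m\le n$ and $z\in D_{m,\eta}$ (in particular for $m=n$), the equation $\mu+\Gamma(z)\mu=\hat\mu_m(z)$ in $\mathcal B_m$ has a unique solution $\mu_m(z)\in\mathcal B_m$. 2. $z\mapsto\mu_n(z)$ is a $\mathcal B_n$-valued analytic function on $D_{n,\eta}$, and $\|\mu_n(z)\|\le K\alpha/\eta$ there. 3. For $z\in D_{n,\eta}$, $0\le m\le n$ and $|Q_2|=n-m$ one has $z-\omega(Q_2)\in D_{m,\eta}$ and $$\mu_n^{(m)}(z;Q_1;Q_2;k_1,\dots,k_m)=\mu_m^{(m)}(z-\omega(Q_2);Q_1;\emptyset;k_1,\dots,k_m).$$ 4. $C_n^*$ is a bounded operator, and for $z\in D_{n,\eta}$ the operator $B_n-z$ has a bounded two-sided inverse, and $M_n(z)=(B_n-z)^{-1}C_n^*$ has the $h$-regular representation with coefficient functions $\mu_n(z)$: for $f\in\mathcal H_n$ and almost every $Q$ with $|Q|>n$, $$[M_n(z)f](Q)=\sum_{m=0}^n\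 \sum_{\hat Q\subset Q,\ |\hat Q|=n-m}\int\mu_n^{(m)}(z;Q\setminus\hat Q;\hat Q;k_1,\dots,k_m)\,f(\hat Q\cup\{k_1,\dots,k_m\})\,dk_1\cdots dk_m.$$ -/

import Mathlib

open MeasureTheory Filter Topology
open scoped ENNReal ComplexConjugate

namespace SpinBoson

/-- The one-boson momentum space `ℝ^d`. -/
abbrev E (d : ℕ) : Type := EuclideanSpace ℝ (Fin d)

/-- The spin space `ℂ²`. -/
abbrev Spin : Type := EuclideanSpace ℂ (Fin 2)

/-- The `2 × 2` complex matrices, as linear operators on `ℂ²`, with the operator norm (all norms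
on this four-dimensional space are equivalent). -/
abbrev M2 : Type := Spin →L[ℂ] Spin

/-- The operator with a given matrix in the standard basis of `ℂ²`. -/
noncomputable def ofMatrix (A : Matrix (Fin 2) (Fin 2) ℂ) : M2 :=
  Matrix.toEuclideanCLM (n := Fin 2) (𝕜 := ℂ) A

/-- The data `ε`, `ω`, `λ`, `h` of a spin-boson model and the conditions imposed on them.
The minimum of `ω` over `ℝ^d` is `κ = ω 0`. -/
structure Model (d : ℕ) where
  /-- half of the distance between the two spin levels -/
  ε : ℝ
  /-- the boson dispersion law -/
  ω : E d → ℝ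
  /-- the form factor -/
  lam : E d → ℂ
  /-- the weight that dominates the form factor and its gradient -/
  h : E d → ℝ
  ε_pos : 0 < ε
  ω_contDiff : ContDiff ℝ 1 ω
  ω_pos : ∀ q, 0 < ω q
  ω_min : ∀ q, ω 0 ≤ ω q
  ω_growth : Tendsto (fun q => ‖fderiv ℝ ω q‖ / ω q) (cocompact (E d)) (𝓝 0)
  lam_contDiff : ContDiff ℝ 1 lam
  h_pos : ∀ q, 0 < h q
  h_le_one : ∀ q, h q ≤ 1
  h_memLp : MemLp h 2 volume
  lam_le : ∀ q, ‖lam q‖ ≤ h q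
  fderiv_lam_le : ∃ C : ℝ, 0 < C ∧ ∀ q, ‖fderiv ℝ lam q‖ ≤ C * h q

/-! ### Configurations and the Hilbert space -/

/-- Finite configurations of bosons.  A function on `Conf d` is the same thing as a sequence of
permutation-symmetric functions on the spaces `(ℝ^d)^l`. -/
abbrev Conf (d : ℕ) : Type := Multiset (E d)

/-- The configuration of the points of a tuple. -/
def conf {d : ℕ} {ι : Type} [Fintype ι] (q : ι → E d) : Conf d :=
  (Finset.univ : Finset ι).val.map q

/-- A set of configurations is measurable if for every `l` the set of `l`-tuples whose
configuration belongs to it is a Borel set. -/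
instance instMeasurableSpaceConf (d : ℕ) : MeasurableSpace (Conf d) :=
  ⨅ l : ℕ, MeasurableSpace.map (fun q : Fin l → E d => conf q) inferInstance

theorem measurable_conf (d l : ℕ) : Measurable (fun q : Fin l → E d => conf q) := by
  intro s hs
  exact (MeasurableSpace.measurableSet_iInf.1 hs) l

/-- The Lebesgue-Poisson measure: `(1 / l!) dq_1 ... dq_l` on the `l`-point configurations. -/
noncomputable def lebesguePoisson (d : ℕ) : Measure (Conf d) :=
  Measure.sum fun l : ℕ =>
    ((l.factorial : ℝ≥0∞)⁻¹) • (volume : Measure (Fin l → E d)).map (fun q => conf q)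

/-- The Hilbert space `ℂ² ⊗ (symmetric Fock space over L²(ℝ^d)) = L²(Conf; ℂ²)`. -/
abbrev Hilb (d : ℕ) : Type := Lp Spin 2 (lebesguePoisson d)

/-- The vectors all of whose components outside the particle numbers in `S` vanish. -/
noncomputable def sector (d : ℕ) (S : Set ℕ) : Submodule ℂ (Hilb d) where
  carrier := {F | ∀ᵐ Q ∂lebesguePoisson d, Q.card ∉ S → F Q = 0}
  add_mem' := by
    intro F G hF hG
    simp only [Set.mem_ofPred_eq] at hF hG ⊢
    filter_upwards [hF, hG, Lp.coeFn_add F G] with Q h1 h2 h3 hQ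
    rw [h3, Pi.add_apply, h1 hQ, h2 hQ, add_zero]
  zero_mem' := by
    simp only [Set.mem_ofPred_eq]
    filter_upwards [Lp.coeFn_zero Spin 2 (lebesguePoisson d)] with Q h1 _
    rw [h1, Pi.zero_apply]
  smul_mem' := by
    intro c F hF
    simp only [Set.mem_ofPred_eq] at hF ⊢
    filter_upwards [hF, Lp.coeFn_smul c F] with Q h1 h2 hQ
    rw [h2, Pi.smul_apply, h1 hQ, smul_zero]

/-- The subspace of states with exactly `n` bosons. -/
noncomputable abbrev HilbEq (d n : ℕ) : Submodule ℂ (Hilb d) := sector d {n}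

/-- The subspace of states with more than `n` bosons. -/
noncomputable abbrev HilbGt (d n : ℕ) : Submodule ℂ (Hilb d) := sector d (Set.Ioi n)

/-! ### The Hamiltonian -/

/-- The Pauli matrix `σ₃`. -/
noncomputable def σ₃ : M2 := ofMatrix !![1, 0; 0, -1]

/-- The Pauli matrix `σ₁`. -/
noncomputable def σ₁ : M2 := ofMatrix !![0, 1; 1, 0]

namespace Model

variable {d : ℕ} (S : Model d)

/-- `ω(Q) = ∑_{q ∈ Q} ω(q)`. -/
noncomputable def omegaConf (Q : Conf d) : ℝ := (Q.map S.ω).sum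

/-- `κ = ω(0) = min ω`. -/
noncomputable def kappa : ℝ := S.ω 0

open Classical in
/-- `∑_{q ∈ Q} λ(q) F(Q \ q)`. -/
noncomputable def create (F : Conf d → Spin) (Q : Conf d) : Spin :=
  (Q.map fun q => S.lam q • F (Q.erase q)).sum

/-- `∫ conj λ(k) F(Q ∪ k) dk`. -/
noncomputable def annihilate (F : Conf d → Spin) (Q : Conf d) : Spin :=
  ∫ k : E d, conj (S.lam k) • F (k ::ₘ Q)

/-- `(H F)(Q) = (ε σ₃ + ω(Q)) F(Q)
  + α σ₁ (∑_{q ∈ Q} λ(q) F(Q \ q) + ∫ conj λ(k) F(Q ∪ k) dk)`. -/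
noncomputable def hamiltonian (α : ℝ) (F : Conf d → Spin) (Q : Conf d) : Spin :=
  ((S.ε : ℂ) • σ₃ + (S.omegaConf Q : ℂ) • (1 : M2)) (F Q)
    + (α : ℂ) • σ₁ (S.create F Q + S.annihilate F Q)

/-- The graph of `B_n`, the compression of `H` to the states with more than `n` bosons: `F` lies
in the domain of the free Hamiltonian, that is `ω(Q) F(Q)` is square integrable, and
`G = B_n F`. -/
def BGraph (α : ℝ) (n : ℕ) (F G : HilbGt d n) : Prop :=
  MemLp (fun Q => (S.omegaConf Q : ℂ) • (F : Hilb d) Q) 2 (lebesguePoisson d) ∧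
    ∀ᵐ Q ∂lebesguePoisson d, n < Q.card →
      (G : Hilb d) Q = S.hamiltonian α ((F : Hilb d) : Conf d → Spin) Q

/-- The bounded operator `R` is `(B_n - z)⁻¹`, a two-sided inverse of `B_n - z`. -/
def IsResolvent (α : ℝ) (n : ℕ) (z : ℂ) (R : HilbGt d n →L[ℂ] HilbGt d n) : Prop :=
  (∀ G : HilbGt d n, S.BGraph α n (R G) (G + z • R G)) ∧
    ∀ F G : HilbGt d n, S.BGraph α n F G → R (G - z • F) = F

/-- `T` is the off-diagonal block `C_n^*` of the Hamiltonian, as an operator from the `n`-boson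
states to the states with more than `n` bosons:
`(C_n^* f)(Q) = δ_{|Q|, n+1} α σ₁ ∑_{k ∈ Q} λ(k) f(Q \ k)`. -/
def IsCStar (α : ℝ) (n : ℕ) (T : HilbEq d n →L[ℂ] HilbGt d n) : Prop :=
  ∀ f : HilbEq d n, ∀ᵐ Q ∂lebesguePoisson d,
    (T f : Hilb d) Q =
      if Q.card = n + 1 then (α : ℂ) • σ₁ (S.create ((f : Hilb d) : Conf d → Spin) Q) else 0

end Model

/-! ### Coefficient functions and the Banach space they form -/

/-- Families `μ^{(m)}(Q₁; Q₂; k₁, ..., k_m)` of matrix-valued functions. -/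
abbrev Coeff (d : ℕ) : Type := (m : ℕ) → Conf d → Conf d → (Fin m → E d) → M2

/-- `μ^{(m)}`, on configurations `Q₁` of `l` points and `Q₂` of `r` points, as a function of the
tuple of all its variables. -/
noncomputable def joint {d : ℕ} (μ : Coeff d) (m l r : ℕ) (x : Fin l ⊕ (Fin r ⊕ Fin m) → E d) :
    M2 :=
  μ m (conf fun i => x (Sum.inl i)) (conf fun i => x (Sum.inr (Sum.inl i)))
    (fun i => x (Sum.inr (Sum.inr i)))

/-- `∏_{q ∈ Q₁} h(q) ∏_{i = 1}^m h(k_i)`. -/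
noncomputable def weight {d : ℕ} (h : E d → ℝ) {m l r : ℕ} (x : Fin l ⊕ (Fin r ⊕ Fin m) → E d) :
    ℝ :=
  (∏ i, h (x (Sum.inl i))) * ∏ i, h (x (Sum.inr (Sum.inr i)))

/-- `M` bounds `μ` and all its first-order partial derivatives (with respect to each coordinate
of each of the points in `Q₁`, in `Q₂`, and of each `k_i`) relative to the weight. -/
def HasBound {d : ℕ} (h : E d → ℝ) (μ : Coeff d) (M : ℝ) : Prop :=
  ∀ (m l r : ℕ) (x : Fin l ⊕ (Fin r ⊕ Fin m) → E d),
    ‖joint μ m l r x‖ ≤ M * weight h x ∧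
      ∀ (i : Fin l ⊕ (Fin r ⊕ Fin m)) (c : Fin d),
        ‖fderiv ℝ (joint μ m l r) x (Pi.single i (EuclideanSpace.single c 1))‖
          ≤ M * weight h x

theorem HasBound.add {d : ℕ} {h : E d → ℝ} {μ ν : Coeff d}
    (hμ : ∀ m l r, ContDiff ℝ 1 (joint μ m l r)) (hν : ∀ m l r, ContDiff ℝ 1 (joint ν m l r))
    {M N : ℝ} (hM : HasBound h μ M) (hN : HasBound h ν N) : HasBound h (μ + ν) (M + N) := by
  intro m l r x
  have e : joint (μ + ν) m l r = joint μ m l r + joint ν m l r := rfl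
  refine ⟨?_, fun i c => ?_⟩
  · rw [e, add_mul]
    exact (norm_add_le _ _).trans (add_le_add (hM m l r x).1 (hN m l r x).1)
  · rw [e, fderiv_add ((hμ m l r).differentiable one_ne_zero x)
      ((hν m l r).differentiable one_ne_zero x), add_mul]
    exact (norm_add_le _ _).trans (add_le_add ((hM m l r x).2 i c) ((hN m l r x).2 i c))

theorem HasBound.smul {d : ℕ} {h : E d → ℝ} {μ : Coeff d}
    (hμ : ∀ m l r, ContDiff ℝ 1 (joint μ m l r)) {M : ℝ} (hM : HasBound h μ M) (a : ℂ) :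
    HasBound h (a • μ) (‖a‖ * M) := by
  intro m l r x
  have e : joint (a • μ) m l r = a • joint μ m l r := rfl
  refine ⟨?_, fun i c => ?_⟩
  · rw [e, Pi.smul_apply, norm_smul, mul_assoc]
    exact mul_le_mul_of_nonneg_left (hM m l r x).1 (norm_nonneg _)
  · rw [e, fderiv_const_smul ((hμ m l r).differentiable one_ne_zero x),
      smul_apply, norm_smul, mul_assoc]
    exact mul_le_mul_of_nonneg_left ((hM m l r x).2 i c) (norm_nonneg _)

theorem HasBound.zero {d : ℕ} (h : E d → ℝ) : HasBound h (0 : Coeff d) 0 := by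
  intro m l r x
  have e : joint (0 : Coeff d) m l r = fun _ => 0 := rfl
  simp [e]

/-- The `h`-regular coefficient functions for the operators on `n`-boson states:
`μ^{(m)}(Q₁; Q₂; k)` is nonzero only for `|Q₂| = n - m` with `0 ≤ m ≤ n` and `|Q₁| > m`, is
continuously differentiable, and has a bound relative to the weight. -/
def coeffSubmodule {d : ℕ} (h : E d → ℝ) (n : ℕ) : Submodule ℂ (Coeff d) where
  carrier := {μ | (∀ m Q₁ Q₂ k, ¬ (m < Q₁.card ∧ Q₂.card + m = n) → μ m Q₁ Q₂ k = 0) ∧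
    (∀ m l r, ContDiff ℝ 1 (joint μ m l r)) ∧ ∃ M, 0 ≤ M ∧ HasBound h μ M}
  add_mem' := by
    rintro μ ν ⟨h1, h2, M, hM, h3⟩ ⟨k1, k2, N, hN, k3⟩
    refine ⟨fun m Q₁ Q₂ k hn => ?_, fun m l r => (h2 m l r).add (k2 m l r), M + N,
      add_nonneg hM hN, h3.add h2 k2 k3⟩
    change μ m Q₁ Q₂ k + ν m Q₁ Q₂ k = 0
    rw [h1 _ _ _ _ hn, k1 _ _ _ _ hn, add_zero]
  zero_mem' := ⟨fun _ _ _ _ _ => rfl, fun _ _ _ => contDiff_const, 0, le_rfl, HasBound.zero h⟩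
  smul_mem' := by
    rintro a μ ⟨h1, h2, M, hM, h3⟩
    refine ⟨fun m Q₁ Q₂ k hn => ?_, fun m l r => (h2 m l r).const_smul a, ‖a‖ * M,
      mul_nonneg (norm_nonneg _) hM, h3.smul h2 a⟩
    change a • μ m Q₁ Q₂ k = 0
    rw [h1 _ _ _ _ hn]
    ext v
    simp

/-- The space `𝓑_n` of `h`-regular coefficient functions. -/
def CoeffSpace {d : ℕ} (h : E d → ℝ) (n : ℕ) : Type := ↥(coeffSubmodule h n)

namespace CoeffSpace

variable {d : ℕ} {h : E d → ℝ} {n : ℕ}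

/-- The family of functions underlying an element of `𝓑_n`. -/
def fn (μ : CoeffSpace h n) : Coeff d := Subtype.val μ

noncomputable instance : AddCommGroup (CoeffSpace h n) := inferInstanceAs (AddCommGroup ↥(coeffSubmodule h n))

noncomputable instance : Module ℂ (CoeffSpace h n) := inferInstanceAs (Module ℂ ↥(coeffSubmodule h n))

/-- The norm of `𝓑_n`: the infimum of all bounds. -/
noncomputable instance : Norm (CoeffSpace h n) := ⟨fun μ => sInf {M | 0 ≤ M ∧ HasBound h μ.fn M}⟩

theorem norm_mem (μ : CoeffSpace h n) : 0 ≤ ‖μ‖ ∧ HasBound h μ.fn ‖μ‖ := by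
  have hc : IsClosed {M | 0 ≤ M ∧ HasBound h μ.fn M} := by
    simp only [HasBound, Set.ofPred_and, Set.ofPred_forall]
    refine (isClosed_le continuous_const continuous_id).inter ?_
    refine isClosed_iInter fun m => isClosed_iInter fun l => isClosed_iInter fun r =>
      isClosed_iInter fun x => ?_
    refine (isClosed_le continuous_const (by fun_prop)).inter ?_
    exact isClosed_iInter fun i => isClosed_iInter fun c =>
      isClosed_le continuous_const (by fun_prop)
  exact hc.csInf_mem μ.2.2.2 ⟨0, fun M hM => hM.1⟩

theorem norm_le {μ : CoeffSpace h n} {M : ℝ} (h0 : 0 ≤ M) (hM : HasBound h μ.fn M) : ‖μ‖ ≤ M :=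
  csInf_le ⟨0, fun _ hN => hN.1⟩ ⟨h0, hM⟩

theorem norm_smul_le' (a : ℂ) (μ : CoeffSpace h n) : ‖a • μ‖ ≤ ‖a‖ * ‖μ‖ :=
  norm_le (mul_nonneg (norm_nonneg _) μ.norm_mem.1) (μ.norm_mem.2.smul μ.2.2.1 a)

theorem core : NormedSpace.Core ℂ (CoeffSpace h n) where
  norm_nonneg μ := μ.norm_mem.1
  norm_smul a μ := by
    refine le_antisymm (norm_smul_le' a μ) ?_
    rcases eq_or_ne a 0 with rfl | ha
    · simpa using (norm_mem ((0 : ℂ) • μ)).1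
    · have h1 := norm_smul_le' a⁻¹ (a • μ)
      rw [smul_smul, inv_mul_cancel₀ ha, one_smul, norm_inv] at h1
      rwa [le_inv_mul_iff₀ (norm_pos_iff.2 ha)] at h1
  norm_triangle μ ν :=
    norm_le (add_nonneg μ.norm_mem.1 ν.norm_mem.1) (μ.norm_mem.2.add μ.2.2.1 ν.2.2.1 ν.norm_mem.2)
  norm_eq_zero_iff μ := by
    constructor
    · intro h0
      have hb := μ.norm_mem.2
      rw [h0] at hb
      refine Subtype.ext ?_
      funext m Q₁ Q₂ k
      obtain ⟨a, rfl⟩ : ∃ a : List (E d), (a : Multiset (E d)) = Q₁ := Quot.exists_rep Q₁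
      obtain ⟨b, rfl⟩ : ∃ b : List (E d), (b : Multiset (E d)) = Q₂ := Quot.exists_rep Q₂
      have h1 := (hb m a.length b.length (Sum.elim a.get (Sum.elim b.get k))).1
      rw [zero_mul] at h1
      have h2 := norm_le_zero_iff.1 h1
      have hl : ∀ t : List (E d), conf (fun i => t.get i) = (t : Multiset (E d)) := by
        intro t
        simp [conf]
      have e : joint μ.fn m a.length b.length (Sum.elim a.get (Sum.elim b.get k))
          = μ.fn m (conf fun i => a.get i) (conf fun i => b.get i) k := rfl
      rw [e, hl, hl] at h2
      exact h2
    · rintro rfl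
      exact le_antisymm (norm_le le_rfl (HasBound.zero h)) (norm_mem 0).1

noncomputable instance : NormedAddCommGroup (CoeffSpace h n) := NormedAddCommGroup.ofCore core

noncomputable instance : NormedSpace ℂ (CoeffSpace h n) := NormedSpace.ofCore core

end CoeffSpace

open Classical in
/-- The operator `M`, from the `n`-boson states to the states with more than `n` bosons, is
represented by the coefficient functions `μ`: for `|Q| > n`, `(M f)(Q)` is the sum over
`0 ≤ m ≤ n` and over the parts `Q'` of `Q` with `n - m` points of
`∫ μ^{(m)}(Q \ Q'; Q'; k₁, ..., k_m) f(Q' ∪ {k₁, ..., k_m}) dk₁ ... dk_m`. -/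
def IsRepresentedBy {d n : ℕ} {h : E d → ℝ} (M : HilbEq d n →L[ℂ] HilbGt d n)
    (μ : CoeffSpace h n) : Prop :=
  ∀ f : HilbEq d n, ∀ᵐ Q ∂lebesguePoisson d, n < Q.card →
    (M f : Hilb d) Q =
      ∑ m ∈ Finset.range (n + 1),
        ((Q.powersetCard (n - m)).map fun Q' =>
          ∫ k : Fin m → E d, (μ.fn m (Q - Q') Q' k) ((f : Hilb d) (Q' + conf k))).sum

namespace Model

variable {d : ℕ} (S : Model d)

/-- `(ε σ₃ + ω(Q) - z)⁻¹`, the inverse of an invertible matrix when `Re z < ω(Q) - ε`. -/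
noncomputable def freeRes (z : ℂ) (Q : Conf d) : M2 :=
  Ring.inverse ((S.ε : ℂ) • σ₃ + ((S.omegaConf Q : ℂ) - z) • (1 : M2))

/-- The term `conj λ(k_m) μ^{(m-1)}(Q₁; Q₂ ∪ k_m; k₁, ..., k_{m-1})`, absent for `m = 0`. -/
noncomputable def lowerTerm (μ : Coeff d) (Q₁ Q₂ : Conf d) : (m : ℕ) → (Fin m → E d) → M2
  | 0, _ => 0
  | m + 1, k => conj (S.lam (k (Fin.last m))) • μ m Q₁ (k (Fin.last m) ::ₘ Q₂) (Fin.init k)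

open Classical in
/-- The operator `Γ(z)` on coefficient functions.  It takes values in families supported on
`|Q₂| = n - m`, `|Q₁| > m`, since `B_n` acts on states with more than `n` bosons. -/
noncomputable def Gam (α : ℝ) (n : ℕ) (z : ℂ) (μ : Coeff d) : Coeff d := fun m Q₁ Q₂ k =>
  if m < Q₁.card ∧ Q₂.card + m = n then
    (α : ℂ) • (S.freeRes z (Q₁ + Q₂) * σ₁ *
      ((Q₁.map fun q => S.lam q • μ m (Q₁.erase q) Q₂ k).sum
        + (∫ q' : E d, conj (S.lam q') • μ m (q' ::ₘ Q₁) Q₂ k)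
        + S.lowerTerm μ Q₁ Q₂ m k))
  else 0

/-- The coefficient functions `μ̂_n(z)`: for `m = 0`, `Q₁ = {q₁}` and `|Q₂| = n` the value is
`α (ε σ₃ + ω(Q₂ ∪ q₁) - z)⁻¹ σ₁ λ(q₁)`, and all other values are `0`.  The factor
`λ(q₁)` is written as the sum of `λ` over the one-point configuration `Q₁`. -/
noncomputable def muHat (α : ℝ) (n : ℕ) (z : ℂ) : Coeff d := fun m Q₁ Q₂ _ =>
  if m = 0 ∧ Q₁.card = 1 ∧ Q₂.card = n then
    (α : ℂ) • ((Q₁.map S.lam).sum • (S.freeRes z (Q₂ + Q₁) * σ₁))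
  else 0

/-- `μ` solves the fixed-point equation `μ + Γ(z) μ = μ̂_n(z)`. -/
def IsSolution (α : ℝ) (n : ℕ) (z : ℂ) (μ : CoeffSpace S.h n) : Prop :=
  μ.fn + S.Gam α n z μ.fn = S.muHat α n z

/-- The half-plane `Re z < -ε + (n + 1) κ - η`. -/
def halfPlane (n : ℕ) (η : ℝ) : Set ℂ := {z | z.re < -S.ε + (n + 1) * S.kappa - η}

end Model

end SpinBoson

/-!
The equation `μ + Γ(z) μ = μ̂_n(z)` is solved by a contraction argument in `𝓑_n`, and its solution
is identified with `(B_n - z)⁻¹ C_n^*` by running the same contraction in the Hilbert space.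

*Coefficient functions.*  The sum over `q ∈ Q₁` in `Γ(z)` has `|Q₁|` terms, so it is bounded only
after division by `|Q₁|` (`Model.exists_core_clm`).  The free resolvent makes up for this: on
configurations with more than `n` points the gap between the free energy and
`Re z < -ε + (n + 1) κ - η` grows linearly in the number of points (`Model.gap_lt`), and since
`|∂ω| ≤ C ω` the derivative of `(ε σ₃ + ω(Q) - z)⁻¹` in one momentum is of the same size as this
matrix (`Model.freeRes_conf_contDiff`, `Model.exists_resMul_clm`).  Hence `Γ(z)` is bounded on
`𝓑_n` by a multiple of `α`, and `‖μ̂_n(z)‖` by a multiple of `α / η` that depends neither on `n` nor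
on `η ≥ η₀`.  Completeness of `𝓑_n` (`CoeffSpace.completeSpace`) and the Neumann series give
existence, uniqueness and the bound.  Analyticity comes from the first resolvent identity, which the
multiplication operators on `𝓑_n` inherit from the matrices `(ε σ₃ + ω(Q) - z)⁻¹`
(`differentiableOn_of_resolvent_identity`); all this is `Model.exists_solution`.

*Freezing.*  In the equation for `μ_n^{(m)}(z)` the points of `Q₂` enter `Γ(z)` only through
`ω(Q₁ ∪ Q₂)` and are otherwise spectators, to which the last term adds `k_m`.  Adding a fixed
configuration to `Q₂` therefore turns a solution at `z` into a solution at `z - ω(Q₂)` for fewer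
bosons (`Model.exists_isSolution_freeze`), and the third assertion follows from uniqueness.

*The resolvent.*  On the states with more than `n` bosons the creation and annihilation operators
grow like the square root of the particle number, by the Mecke formula `mecke`, while the free
resolvent decays like the inverse of the particle number.  So `Φ R₀` and `R₀ Φ` are bounded, where `R₀` is the free
resolvent and `Φ` the field operator, and for small `α` the resolvent of `B_n` is
`R = R₀ (1 + α Φ R₀)⁻¹` (`Model.exists_isResolvent`).  The vector `F = R C_n^* f` is the fixed point
of `F ↦ R₀ C_n^* f - α R₀ Φ F`.

*The representation.*  If `F` is given by coefficient functions `μ`, then `R₀ C_n^* f - α R₀ Φ F`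
is given by `μ̂_n(z) - Γ(z) μ`.  This is a pointwise identity (`Model.rep_Gam`, `Model.rep_muHat`):
in the creation part the choice of the created point is exchanged with the choice of `Q̂ ⊂ Q`
(`sum_powersetCard_erase`), and the annihilated point belongs either to the complement of `Q̂`,
which gives the integral term, or to `Q̂`, which gives the term that raises `m`.  Starting both
iterations at zero, their iterates correspond to each other, and so do their limits
(`Model.ae_eq_rep_of_tendsto`, `Model.isRepresentedBy_solution`).
-/

namespace SpinBoson

/-! ### Configurations and tuples -/

section Configurations

variable {d : ℕ}

theorem card_conf {ι : Type} [Fintype ι] (x : ι → E d) : (conf x).card = Fintype.card ι := by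
  simp [conf]

theorem exists_conf_eq (Q : Conf d) : ∃ x : Fin Q.card → E d, conf x = Q := by
  induction Q using Quot.inductionOn with
  | h t =>
    refine ⟨fun i => t.get i, ?_⟩
    change conf (fun i => t.get i) = (t : Multiset (E d))
    simp [conf]

theorem conf_comp_equiv {ι κ : Type} [Fintype ι] [Fintype κ] (e : ι ≃ κ) (x : κ → E d) :
    conf (fun i => x (e i)) = conf x := by
  unfold conf
  rw [show (fun i => x (e i)) = x ∘ e from rfl, ← Multiset.map_map]
  congr 1
  simp

theorem conf_sumElim {ι κ : Type} [Fintype ι] [Fintype κ] (x : ι ⊕ κ → E d) :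
    conf x = conf (fun i => x (Sum.inl i)) + conf (fun i => x (Sum.inr i)) := by
  unfold conf
  rw [← Finset.univ_disjSum_univ, Finset.val_disjSum, Multiset.disjSum, Multiset.map_add,
    Multiset.map_map, Multiset.map_map]
  rfl

theorem conf_eq_cons_succAbove {l : ℕ} (x : Fin (l + 1) → E d) (i : Fin (l + 1)) :
    conf x = x i ::ₘ conf (fun j => x (i.succAbove j)) := by
  unfold conf
  rw [Fin.univ_succAbove l i, Finset.cons_val, Multiset.map_cons, Finset.map_val, Multiset.map_map]
  rfl

theorem conf_cons {l : ℕ} (q : E d) (x : Fin l → E d) :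
    conf (Fin.cons q x : Fin (l + 1) → E d) = q ::ₘ conf x := by
  rw [conf_eq_cons_succAbove _ 0]
  simp

theorem conf_erase {l : ℕ} (x : Fin (l + 1) → E d) (i : Fin (l + 1)) :
    (conf x).erase (x i) = conf (fun j => x (i.succAbove j)) := by
  rw [conf_eq_cons_succAbove x i, Multiset.erase_cons_head]

theorem conf_fin_zero (x : Fin 0 → E d) : conf x = 0 := by simp [conf]

theorem sum_map_conf {ι : Type} [Fintype ι] {A : Type*} [AddCommMonoid A] (x : ι → E d)
    (g : E d → A) : ((conf x).map g).sum = ∑ i, g (x i) := by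
  rw [conf, Multiset.map_map]
  rfl

/-- Choosing first a point `q` of `Q` and then an `r`-point part of the remainder amounts to
choosing first the part and then `q` from its complement. -/
theorem sum_powersetCard_erase {A : Type*} [AddCommMonoid A] (Q : Conf d) (r : ℕ)
    (g : E d → Conf d → Conf d → A) :
    (Q.map fun q => (((Q.erase q).powersetCard r).map fun Q' => g q (Q.erase q - Q') Q').sum).sum
      = ((Q.powersetCard r).map fun Q' =>
          ((Q - Q').map fun q => g q ((Q - Q').erase q) Q').sum).sum := by
  obtain ⟨x, hx⟩ := exists_conf_eq Q
  generalize Q.card = l at x hx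
  subst hx
  have key : ∀ s : Finset (Fin l), (∀ (r : ℕ) (G : Conf d → A),
      (((s.val.map x).powersetCard r).map G).sum
        = ∑ t ∈ s.powersetCard r, G (t.val.map x)) := by
    intro s r G
    rw [Multiset.powersetCard_map, ← Finset.map_val_val_powersetCard, Multiset.map_map,
      Multiset.map_map]
    rfl
  have hsub : ∀ s t : Finset (Fin l), t ⊆ s → s.val.map x - t.val.map x = (s \ t).val.map x := by
    intro s t hts
    have : s.val = (s \ t).val + t.val := by
      rw [Finset.sdiff_val, tsub_add_cancel_of_le (Finset.val_le_iff.2 hts)]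
    rw [this, Multiset.map_add, add_tsub_cancel_right]
  have her : ∀ (s : Finset (Fin l)) (i : Fin l), i ∈ s →
      (s.val.map x).erase (x i) = (s.erase i).val.map x := by
    intro s i hi
    rw [Finset.erase_val, Multiset.map_erase_of_mem _ _ hi]
  have e1 : conf x = (Finset.univ : Finset (Fin l)).val.map x := rfl
  rw [sum_map_conf, e1, key]
  have h1 : ∀ i : Fin l, (((((Finset.univ : Finset (Fin l)).val.map x).erase (x i)).powersetCard
      r).map fun Q' => g (x i) (((Finset.univ : Finset (Fin l)).val.map x).erase (x i) - Q')
        Q').sum = ∑ t ∈ (Finset.univ.erase i).powersetCard r,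
        g (x i) (((Finset.univ.erase i) \ t).val.map x) (t.val.map x) := by
    intro i
    rw [her _ _ (Finset.mem_univ i), key]
    refine Finset.sum_congr rfl fun t ht => ?_
    rw [hsub _ _ (Finset.mem_powersetCard.1 ht).1]
  have h2 : ∀ t ∈ (Finset.univ : Finset (Fin l)).powersetCard r,
      (((((Finset.univ : Finset (Fin l)).val.map x) - t.val.map x)).map fun q =>
        g q ((((Finset.univ : Finset (Fin l)).val.map x) - t.val.map x).erase q)
          (t.val.map x)).sum = ∑ i ∈ Finset.univ \ t,
        g (x i) (((Finset.univ \ t).erase i).val.map x) (t.val.map x) := by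
    intro t _
    rw [hsub _ _ (Finset.subset_univ t), Multiset.map_map]
    refine Finset.sum_congr rfl fun i hi => ?_
    simp only [Function.comp_apply]
    rw [her _ _ hi]
  rw [Finset.sum_congr rfl fun i _ => h1 i, Finset.sum_congr rfl h2]
  refine (Finset.sum_comm' (s := Finset.univ) (t' := Finset.univ.powersetCard r)
    (s' := fun t => Finset.univ \ t) ?_).trans ?_
  · intro i t
    simp only [Finset.mem_univ, true_and, Finset.mem_powersetCard, Finset.subset_univ,
      Finset.mem_sdiff, Finset.subset_erase]
  · refine Finset.sum_congr rfl fun t _ => Finset.sum_congr rfl fun i hi => ?_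
    rw [Finset.erase_sdiff_comm]

end Configurations

/-! ### The Lebesgue-Poisson measure -/

section Measure

variable {d : ℕ}

theorem measurable_of_conf {β : Type*} [MeasurableSpace β] {G : Conf d → β}
    (h : ∀ l, Measurable fun x : Fin l → E d => G (conf x)) : Measurable G := by
  intro s hs
  exact MeasurableSpace.measurableSet_iInf.2 fun l => h l hs

theorem measurable_card : Measurable fun Q : Conf d => Q.card :=
  measurable_of_conf fun l => by simp only [card_conf, measurable_const]

theorem measurable_cons (Q : Conf d) : Measurable fun k : E d => k ::ₘ Q := by
  obtain ⟨x, hx⟩ := exists_conf_eq Q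
  rw [← hx]
  simp only [← conf_cons]
  exact (measurable_conf d _).comp (by fun_prop)

theorem measurable_cons_conf (l : ℕ) :
    Measurable fun p : E d × (Fin l → E d) => p.1 ::ₘ conf p.2 := by
  simp only [← conf_cons]
  exact (measurable_conf d _).comp (by fun_prop)

theorem lintegral_lebesguePoisson {G : Conf d → ℝ≥0∞} (hG : Measurable G) :
    ∫⁻ Q, G Q ∂lebesguePoisson d
      = ∑' l : ℕ, ((l.factorial : ℝ≥0∞)⁻¹) * ∫⁻ x : Fin l → E d, G (conf x) := by
  rw [lebesguePoisson, lintegral_sum_measure]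
  refine tsum_congr fun l => ?_
  rw [lintegral_smul_measure, lintegral_map hG (measurable_conf d l), smul_eq_mul]

/-- The Mecke formula: summing over a point of a configuration and integrating over the
configuration is the same as integrating over the point and the remaining configuration. -/
theorem mecke {g : E d → Conf d → ℝ≥0∞}
    (hg : ∀ l, Measurable fun p : E d × (Fin l → E d) => g p.1 (conf p.2)) :
    ∫⁻ Q, (Q.map fun q => g q (Q.erase q)).sum ∂lebesguePoisson d
      = ∫⁻ Q, ∫⁻ q, g q Q ∂volume ∂lebesguePoisson d := by
  have hpt : ∀ (l : ℕ) (x : Fin (l + 1) → E d),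
      ((conf x).map fun q => g q ((conf x).erase q)).sum
        = ∑ i, g (x i) (conf fun j => x (i.succAbove j)) := by
    intro l x
    rw [sum_map_conf]
    exact Finset.sum_congr rfl fun i _ => by rw [conf_erase]
  have hm1 : ∀ (l : ℕ) (i : Fin (l + 1)), Measurable fun x : Fin (l + 1) → E d =>
      g (x i) (conf fun j => x (i.succAbove j)) := fun l i =>
    (hg l).comp (f := fun x : Fin (l + 1) → E d => (x i, fun j => x (i.succAbove j)))
      (by fun_prop)
  have hL : Measurable fun Q : Conf d => (Q.map fun q => g q (Q.erase q)).sum := by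
    refine measurable_of_conf fun l => ?_
    cases l with
    | zero => simp only [conf_fin_zero]; exact measurable_const
    | succ l =>
      simp only [hpt]
      exact Finset.measurable_sum _ fun i _ => hm1 l i
  have hR : Measurable fun Q : Conf d => ∫⁻ q, g q Q := by
    refine measurable_of_conf fun l => ?_
    exact (hg l).lintegral_prod_left'
  rw [lintegral_lebesguePoisson hL, lintegral_lebesguePoisson hR,
    tsum_eq_zero_add' ENNReal.summable]
  have h0 : ∫⁻ x : Fin 0 → E d, ((conf x).map fun q => g q ((conf x).erase q)).sum = 0 := by
    simp [conf_fin_zero]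
  rw [h0, mul_zero, zero_add]
  refine tsum_congr fun l => ?_
  simp only [hpt]
  rw [lintegral_finsetSum _ fun i _ => hm1 l i]
  have h1 : ∀ i : Fin (l + 1), ∫⁻ x : Fin (l + 1) → E d,
      g (x i) (conf fun j => x (i.succAbove j)) = ∫⁻ y : Fin l → E d, ∫⁻ q, g q (conf y) := by
    intro i
    have := (volume_preserving_piFinSuccAbove (fun _ => E d) i).lintegral_comp (hg l)
    refine Eq.trans this ?_
    rw [Measure.volume_eq_prod, lintegral_prod_symm' _ (hg l)]
  rw [Finset.sum_congr rfl fun i _ => h1 i]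
  simp only [Finset.sum_const, Finset.card_univ, Fintype.card_fin, nsmul_eq_mul]
  rw [← mul_assoc]
  congr 1
  rw [Nat.factorial_succ, Nat.cast_mul, ENNReal.mul_inv (Or.inl (by simp)) (Or.inl (by simp)),
    mul_right_comm, ENNReal.inv_mul_cancel (by simp) (by simp), one_mul]

theorem mecke_cons {G : Conf d → ℝ≥0∞} (hG : Measurable G) :
    ∫⁻ Q, ∫⁻ q, G (q ::ₘ Q) ∂volume ∂lebesguePoisson d
      = ∫⁻ Q, Q.card * G Q ∂lebesguePoisson d := by
  rw [← mecke (g := fun q Q => G (q ::ₘ Q)) fun l => hG.comp (measurable_cons_conf l)]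
  refine lintegral_congr fun Q => ?_
  rw [Multiset.map_congr rfl fun q hq => by rw [Multiset.cons_erase hq]]
  simp

/-- By the Mecke formula almost every configuration stays outside of a null set when almost any
point is added. -/
theorem ae_cons {P : Conf d → Prop} (h : ∀ᵐ Q ∂lebesguePoisson d, P Q) :
    ∀ᵐ Q ∂lebesguePoisson d, ∀ᵐ k : E d, P (k ::ₘ Q) := by
  obtain ⟨N, hN, hNm, hN0⟩ := exists_measurable_superset_of_null (ae_iff.1 h)
  have hG : Measurable (N.indicator (fun _ => (1 : ℝ≥0∞))) := measurable_const.indicator hNm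
  have h1 := mecke_cons hG
  have h2 : ∫⁻ Q, (Q.card : ℝ≥0∞) * N.indicator (fun _ => 1) Q ∂lebesguePoisson d = 0 := by
    rw [lintegral_congr_ae (g := fun _ => 0), lintegral_zero]
    filter_upwards [measure_eq_zero_iff_ae_notMem.1 hN0] with Q hQ
    simp [hQ]
  rw [h2, lintegral_eq_zero_iff] at h1
  · filter_upwards [h1] with Q hQ
    filter_upwards [(lintegral_eq_zero_iff (hG.comp (measurable_cons Q))).1 hQ] with k hk
    by_contra hP
    have : k ::ₘ Q ∈ N := hN hP
    simp [this] at hk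
  · refine measurable_of_conf fun l => ?_
    exact (hG.comp (measurable_cons_conf l)).lintegral_prod_left'

/-- By the Mecke formula almost every configuration stays outside of a null set when any of its
points is removed. -/
theorem ae_erase {P : Conf d → Prop} (h : ∀ᵐ Q ∂lebesguePoisson d, P Q) :
    ∀ᵐ Q ∂lebesguePoisson d, ∀ q ∈ Q, P (Q.erase q) := by
  obtain ⟨N, hN, hNm, hN0⟩ := exists_measurable_superset_of_null (ae_iff.1 h)
  have hG : Measurable (N.indicator (fun _ => (1 : ℝ≥0∞))) := measurable_const.indicator hNm
  have hg : ∀ l, Measurable fun p : E d × (Fin l → E d) =>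
      N.indicator (fun _ => (1 : ℝ≥0∞)) (conf p.2) := fun l =>
    hG.comp ((measurable_conf d l).comp measurable_snd)
  have h1 := mecke (g := fun _ Q => N.indicator (fun _ => (1 : ℝ≥0∞)) Q) hg
  have h2 : ∫⁻ Q, ∫⁻ _ : E d, N.indicator (fun _ => (1 : ℝ≥0∞)) Q ∂volume
      ∂lebesguePoisson d = 0 := by
    rw [lintegral_congr_ae (g := fun _ => 0)]
    · simp
    · filter_upwards [measure_eq_zero_iff_ae_notMem.1 hN0] with Q hQ
      simp [hQ]
  rw [h2, lintegral_eq_zero_iff] at h1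
  · filter_upwards [h1] with Q hQ q hq
    by_contra hP
    have h3 : Q.erase q ∈ N := hN hP
    rw [Pi.zero_apply, Multiset.sum_eq_zero_iff] at hQ
    have := hQ _ (Multiset.mem_map_of_mem _ hq)
    simp [h3] at this
  · refine measurable_of_conf fun l => ?_
    cases l with
    | zero => simp only [conf_fin_zero]; exact measurable_const
    | succ l =>
      simp only [sum_map_conf, conf_erase]
      exact Finset.measurable_sum _ fun i _ =>
        hG.comp ((measurable_conf d l).comp (by fun_prop))

theorem ae_le {P : Conf d → Prop} (h : ∀ᵐ Q ∂lebesguePoisson d, P Q) :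
    ∀ᵐ Q ∂lebesguePoisson d, ∀ Q' ≤ Q, P Q' := by
  have h1 : ∀ j : ℕ, ∀ᵐ Q ∂lebesguePoisson d, ∀ Q' ≤ Q, Q'.card + j = Q.card → P Q' := by
    intro j
    induction j with
    | zero =>
      filter_upwards [h] with Q hQ Q' hle hc
      rwa [Multiset.eq_of_le_of_card_le hle (by omega)]
    | succ j ih =>
      filter_upwards [ae_erase ih] with Q hQ Q' hle hc
      obtain ⟨q, hq⟩ := Multiset.lt_iff_cons_le.1 (lt_of_le_of_ne hle (by rintro rfl; omega))
      have hmem : q ∈ Q := Multiset.mem_of_le hq (Multiset.mem_cons_self _ _)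
      refine hQ q hmem Q' ?_ ?_
      · have := Multiset.erase_le_erase q hq
        rwa [Multiset.erase_cons_head] at this
      · rw [Multiset.card_erase_of_mem hmem, Nat.pred_eq_sub_one]
        omega
  filter_upwards [ae_all_iff.2 h1] with Q hQ Q' hle
  exact hQ (Q.card - Q'.card) Q' hle (by have := Multiset.card_le_card hle; omega)

end Measure

/-! ### Creation and annihilation in `L²` -/

section FockSpace

variable {d : ℕ}

theorem eLpNorm_two_sq {α V : Type*} {mα : MeasurableSpace α} [NormedAddCommGroup V]
    (μ : Measure α) (F : α → V) : eLpNorm F 2 μ ^ 2 = ∫⁻ x, ‖F x‖ₑ ^ 2 ∂μ := by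
  have := eLpNorm_nnreal_pow_eq_lintegral (f := F) (μ := μ) (p := 2) two_ne_zero
  simpa using this

theorem stronglyMeasurable_clm_apply {α : Type*} {mα : MeasurableSpace α} {A : α → M2}
    {F : α → Spin} (hA : StronglyMeasurable A) (hF : StronglyMeasurable F) :
    StronglyMeasurable fun x => A x (F x) :=
  isBoundedBilinearMap_apply.continuous.comp_stronglyMeasurable (hA.prodMk hF)

/-- A pointwise operation on functions that respects almost everywhere equality, is linear up to
null sets and is bounded in `L²` defines a bounded operator. -/
theorem exists_clm_of_eLpNorm_le (T : (Conf d → Spin) → Conf d → Spin) (C : ℝ) (hC : 0 ≤ C)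
    (hcongr : ∀ F G, F =ᵐ[lebesguePoisson d] G → T F =ᵐ[lebesguePoisson d] T G)
    (hmeas : ∀ F, StronglyMeasurable F → AEStronglyMeasurable (T F) (lebesguePoisson d))
    (hbound : ∀ F, StronglyMeasurable F → MemLp F 2 (lebesguePoisson d) →
      eLpNorm (T F) 2 (lebesguePoisson d) ≤ ENNReal.ofReal C * eLpNorm F 2 (lebesguePoisson d))
    (hadd : ∀ F G, StronglyMeasurable F → StronglyMeasurable G →
      MemLp F 2 (lebesguePoisson d) → MemLp G 2 (lebesguePoisson d) →
        T (F + G) =ᵐ[lebesguePoisson d] T F + T G)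
    (hsmul : ∀ (c : ℂ) F, T (c • F) =ᵐ[lebesguePoisson d] c • T F) :
    ∃ L : Hilb d →L[ℂ] Hilb d, ‖L‖ ≤ C ∧ ∀ F : Hilb d, L F =ᵐ[lebesguePoisson d] T F := by
  have hmem : ∀ F : Hilb d, MemLp (T F) 2 (lebesguePoisson d) := fun F =>
    ⟨hmeas F (Lp.stronglyMeasurable F), (hbound F (Lp.stronglyMeasurable F) (Lp.memLp F)).trans_lt
      (ENNReal.mul_lt_top ENNReal.ofReal_lt_top (Lp.memLp F).2)⟩
  let L0 : Hilb d →ₗ[ℂ] Hilb d :=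
    { toFun := fun F => (hmem F).toLp
      map_add' := fun F G => by
        rw [← MemLp.toLp_add]
        exact MemLp.toLp_congr _ _ ((hcongr _ _ (Lp.coeFn_add F G)).trans
          (hadd _ _ (Lp.stronglyMeasurable F) (Lp.stronglyMeasurable G) (Lp.memLp F)
            (Lp.memLp G)))
      map_smul' := fun c F => by
        rw [RingHom.id_apply, ← MemLp.toLp_const_smul]
        exact MemLp.toLp_congr _ _ ((hcongr _ _ (Lp.coeFn_smul c F)).trans (hsmul c _)) }
  have hb : ∀ F, ‖L0 F‖ ≤ C * ‖F‖ := by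
    intro F
    change ‖(hmem F).toLp‖ ≤ _
    rw [Lp.norm_toLp, Lp.norm_def, ← ENNReal.toReal_ofReal hC, ← ENNReal.toReal_mul]
    exact ENNReal.toReal_mono (ENNReal.mul_ne_top ENNReal.ofReal_ne_top (Lp.memLp F).2.ne)
      (hbound F (Lp.stronglyMeasurable F) (Lp.memLp F))
  exact ⟨L0.mkContinuous C hb, L0.mkContinuous_norm_le hC hb, fun F => (hmem F).coeFn_toLp⟩

theorem exists_mul_clm {A : Conf d → M2} (hA : StronglyMeasurable A) {C : ℝ} (hC : 0 ≤ C)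
    (hAC : ∀ Q, ‖A Q‖ ≤ C) :
    ∃ L : Hilb d →L[ℂ] Hilb d, ‖L‖ ≤ C ∧
      ∀ F : Hilb d, L F =ᵐ[lebesguePoisson d] fun Q => A Q (F Q) := by
  refine exists_clm_of_eLpNorm_le (fun F Q => A Q (F Q)) C hC ?_ ?_ ?_ ?_ ?_
  · intro F G h
    filter_upwards [h] with Q hQ
    rw [hQ]
  · intro F hF
    exact (stronglyMeasurable_clm_apply hA hF).aestronglyMeasurable
  · intro F hF _
    refine eLpNorm_le_mul_eLpNorm_of_ae_le_mul (Eventually.of_forall fun Q => ?_) 2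
    exact ((A Q).le_opNorm _).trans (mul_le_mul_of_nonneg_right (hAC Q) (norm_nonneg _))
  · intro F G _ _ _ _
    exact Eventually.of_forall fun Q => by simp
  · intro c F
    exact Eventually.of_forall fun Q => by simp

namespace Model

variable (S : Model d)

theorem memLp_lam : MemLp S.lam 2 volume :=
  S.h_memLp.of_le S.lam_contDiff.continuous.aestronglyMeasurable
    (Eventually.of_forall fun q => by
      rw [Real.norm_of_nonneg (S.h_pos q).le]
      exact S.lam_le q)

theorem create_congr_ae {F G : Conf d → Spin} (h : F =ᵐ[lebesguePoisson d] G) :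
    S.create F =ᵐ[lebesguePoisson d] S.create G := by
  filter_upwards [ae_erase h] with Q hQ
  unfold create
  rw [Multiset.map_congr rfl fun q hq => by rw [hQ q hq]]

theorem annihilate_congr_ae {F G : Conf d → Spin} (h : F =ᵐ[lebesguePoisson d] G) :
    S.annihilate F =ᵐ[lebesguePoisson d] S.annihilate G := by
  filter_upwards [ae_cons h] with Q hQ
  unfold annihilate
  refine integral_congr_ae ?_
  filter_upwards [hQ] with k hk
  rw [hk]

theorem create_conf {l : ℕ} (F : Conf d → Spin) (x : Fin (l + 1) → E d) :
    S.create F (conf x) = ∑ i, S.lam (x i) • F (conf fun j => x (i.succAbove j)) := by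
  unfold create
  rw [sum_map_conf]
  exact Finset.sum_congr rfl fun i _ => by rw [conf_erase]

theorem measurable_create {F : Conf d → Spin} (hF : Measurable F) : Measurable (S.create F) := by
  refine measurable_of_conf fun l => ?_
  cases l with
  | zero => simp only [conf_fin_zero]; exact measurable_const
  | succ l =>
    simp only [create_conf]
    refine Finset.measurable_sum _ fun i _ => ?_
    exact (S.lam_contDiff.continuous.measurable.comp (measurable_pi_apply i)).smul
      (hF.comp ((measurable_conf d l).comp (by fun_prop)))

theorem measurable_annihilate {F : Conf d → Spin} (hF : Measurable F) :
    Measurable (S.annihilate F) := by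
  refine measurable_of_conf fun l => ?_
  have h1 : Measurable fun p : E d × (Fin l → E d) => conj (S.lam p.1) • F (p.1 ::ₘ conf p.2) :=
    ((Complex.continuous_conj.comp S.lam_contDiff.continuous).measurable.comp
      measurable_fst).smul (hF.comp (measurable_cons_conf l))
  exact (h1.stronglyMeasurable.integral_prod_left'
    (f := fun p : E d × (Fin l → E d) => conj (S.lam p.1) • F (p.1 ::ₘ conf p.2))).measurable

theorem enorm_create_sq_le (F : Conf d → Spin) (Q : Conf d) :
    ‖S.create F Q‖ₑ ^ 2
      ≤ (Q.map fun q => (Q.card : ℝ≥0∞) * (‖S.lam q‖ₑ ^ 2 * ‖F (Q.erase q)‖ₑ ^ 2)).sum := by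
  obtain ⟨x, hx⟩ := exists_conf_eq Q
  generalize Q.card = l at x hx
  subst hx
  rw [create, sum_map_conf, sum_map_conf]
  have h1 : ‖∑ i, S.lam (x i) • F ((conf x).erase (x i))‖₊ ^ 2
      ≤ ∑ i, (l : NNReal) * (‖S.lam (x i)‖₊ ^ 2 * ‖F ((conf x).erase (x i))‖₊ ^ 2) := by
    calc _ ≤ (∑ i, ‖S.lam (x i) • F ((conf x).erase (x i))‖₊) ^ 2 := by
            gcongr
            exact nnnorm_sum_le _ _
      _ ≤ _ := sq_sum_le_card_mul_sum_sq
      _ = _ := by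
        rw [Finset.card_univ, Fintype.card_fin, Finset.mul_sum]
        exact Finset.sum_congr rfl fun i _ => by rw [nnnorm_smul, mul_pow]
  simp only [enorm_eq_nnnorm]
  exact_mod_cast h1

theorem enorm_annihilate_sq_le {F : Conf d → Spin} (hF : Measurable F) (Q : Conf d) :
    ‖S.annihilate F Q‖ₑ ^ 2
      ≤ eLpNorm S.lam 2 volume ^ 2 * ∫⁻ k, ‖F (k ::ₘ Q)‖ₑ ^ 2 := by
  rw [eLpNorm_two_sq]
  have h1 : ‖S.annihilate F Q‖ₑ ≤ ∫⁻ k, ‖S.lam k‖ₑ * ‖F (k ::ₘ Q)‖ₑ := by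
    refine (enorm_integral_le_lintegral_enorm _).trans (le_of_eq ?_)
    refine lintegral_congr fun k => ?_
    rw [enorm_smul]
    congr 1
    simp [enorm_eq_nnnorm]
  have h2 := ENNReal.lintegral_mul_le_Lp_mul_Lq volume Real.HolderConjugate.two_two
    (f := fun k => ‖S.lam k‖ₑ) (g := fun k => ‖F (k ::ₘ Q)‖ₑ)
    S.lam_contDiff.continuous.measurable.enorm.aemeasurable
    (hF.comp (measurable_cons Q)).enorm.aemeasurable
  have h3 := h1.trans h2
  have e : ∀ t : ℝ≥0∞, (t ^ (1 / (2 : ℝ))) ^ 2 = t := by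
    intro t
    rw [← ENNReal.rpow_natCast, ← ENNReal.rpow_mul]
    norm_num
  calc _ ≤ _ := pow_le_pow_left' h3 2
    _ = _ := by
      rw [mul_pow, e, e]
      norm_num

/-- The creation operator grows like the square root of the particle number.  The weight `c`
depends on the particle number only. -/
theorem lintegral_create_le {F : Conf d → Spin} (hF : Measurable F) (c : ℕ → ℝ≥0∞) :
    ∫⁻ Q, c Q.card * ‖S.create F Q‖ₑ ^ 2 ∂lebesguePoisson d
      ≤ eLpNorm S.lam 2 volume ^ 2 *
        ∫⁻ Q, c (Q.card + 1) * (Q.card + 1) * ‖F Q‖ₑ ^ 2 ∂lebesguePoisson d := by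
  have hm : ∀ l, Measurable fun x : Fin l → E d => ‖F (conf x)‖ₑ ^ 2 := fun l =>
    ((hF.comp (measurable_conf d l)).enorm).pow_const 2
  have hl : Measurable fun k : E d => ‖S.lam k‖ₑ ^ 2 :=
    S.lam_contDiff.continuous.measurable.enorm.pow_const 2
  calc _ ≤ ∫⁻ Q, (Q.map fun q => c ((Q.erase q).card + 1) * ((Q.erase q).card + 1) *
            (‖S.lam q‖ₑ ^ 2 * ‖F (Q.erase q)‖ₑ ^ 2)).sum ∂lebesguePoisson d := by
        refine lintegral_mono fun Q => ?_
        refine (mul_le_mul_right (S.enorm_create_sq_le F Q) _).trans (le_of_eq ?_)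
        rw [← Multiset.sum_map_mul_left]
        congr 1
        refine Multiset.map_congr rfl fun q hq => ?_
        have h1 : (Q.erase q).card + 1 = Q.card := by
          rw [Multiset.card_erase_of_mem hq]
          exact Nat.succ_pred_eq_of_pos (Multiset.card_pos_iff_exists_mem.2 ⟨q, hq⟩)
        have h2 : ((Q.erase q).card : ℝ≥0∞) + 1 = Q.card := by exact_mod_cast h1
        rw [h1, h2, mul_assoc]
    _ = ∫⁻ Q, ∫⁻ q, c (Q.card + 1) * (Q.card + 1) * (‖S.lam q‖ₑ ^ 2 * ‖F Q‖ₑ ^ 2)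
          ∂volume ∂lebesguePoisson d := by
        refine mecke (g := fun q Q => c (Q.card + 1) * (Q.card + 1) *
          (‖S.lam q‖ₑ ^ 2 * ‖F Q‖ₑ ^ 2)) fun l => ?_
        simp only [card_conf]
        exact ((hl.comp measurable_fst).mul ((hm l).comp measurable_snd)).const_mul _
    _ = ∫⁻ Q, eLpNorm S.lam 2 volume ^ 2 * (c (Q.card + 1) * (Q.card + 1) * ‖F Q‖ₑ ^ 2)
          ∂lebesguePoisson d := by
        refine lintegral_congr fun Q => ?_
        rw [lintegral_const_mul _ (hl.mul_const _), lintegral_mul_const _ hl, eLpNorm_two_sq]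
        ring
    _ = _ := by
        rw [lintegral_const_mul]
        refine measurable_of_conf fun l => ?_
        simp only [card_conf]
        exact (hm l).const_mul _

/-- The annihilation operator grows like the square root of the particle number.  At `Q.card = 0`
the truncated subtraction is harmless because of the factor `Q.card`. -/
theorem lintegral_annihilate_le {F : Conf d → Spin} (hF : Measurable F) (c : ℕ → ℝ≥0∞) :
    ∫⁻ Q, c Q.card * ‖S.annihilate F Q‖ₑ ^ 2 ∂lebesguePoisson d
      ≤ eLpNorm S.lam 2 volume ^ 2 *
        ∫⁻ Q, c (Q.card - 1) * Q.card * ‖F Q‖ₑ ^ 2 ∂lebesguePoisson d := by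
  have hG : Measurable fun Q : Conf d => c (Q.card - 1) * ‖F Q‖ₑ ^ 2 := by
    refine measurable_of_conf fun l => ?_
    simp only [card_conf]
    exact (((hF.comp (measurable_conf d l)).enorm).pow_const 2).const_mul _
  calc _ ≤ ∫⁻ Q, eLpNorm S.lam 2 volume ^ 2 * ∫⁻ k, c ((k ::ₘ Q).card - 1) * ‖F (k ::ₘ Q)‖ₑ ^ 2
          ∂volume ∂lebesguePoisson d := by
        refine lintegral_mono fun Q => ?_
        have hFc : ∀ Q : Conf d, Measurable fun k => ‖F (k ::ₘ Q)‖ₑ ^ 2 := fun Q =>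
          (hF.comp (measurable_cons Q)).enorm.pow_const 2
        simp only [Multiset.card_cons, add_tsub_cancel_right]
        rw [lintegral_const_mul _ (hFc Q),
          mul_left_comm]
        exact mul_le_mul_right (S.enorm_annihilate_sq_le hF Q) _
    _ = _ := by
        rw [lintegral_const_mul, mecke_cons hG]
        · congr 1
          exact lintegral_congr fun Q => by ring
        · refine measurable_of_conf fun l => ?_
          exact (hG.comp (measurable_cons_conf l)).lintegral_prod_left'

/-- Almost every one-point extension of a square integrable function is square integrable in the
added point. -/
theorem _root_.SpinBoson.ae_memLp_cons {F : Conf d → Spin} (hF : Measurable F)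
    (hF2 : MemLp F 2 (lebesguePoisson d)) :
    ∀ᵐ Q ∂lebesguePoisson d, MemLp (fun k => F (k ::ₘ Q)) 2 volume := by
  have hG : Measurable fun Q : Conf d => (Q.card : ℝ≥0∞)⁻¹ * ‖F Q‖ₑ ^ 2 := by
    refine measurable_of_conf fun l => ?_
    simp only [card_conf]
    exact (((hF.comp (measurable_conf d l)).enorm).pow_const 2).const_mul _
  have h1 := mecke_cons hG
  have h2 : ∫⁻ Q, ∫⁻ k, ((k ::ₘ Q).card : ℝ≥0∞)⁻¹ * ‖F (k ::ₘ Q)‖ₑ ^ 2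
      ∂volume ∂lebesguePoisson d ≠ ∞ := by
    rw [h1]
    refine ne_top_of_le_ne_top (ENNReal.pow_ne_top hF2.2.ne (n := 2)) ?_
    rw [eLpNorm_two_sq]
    refine lintegral_mono fun Q => ?_
    rw [← mul_assoc]
    refine (mul_le_mul_left (ENNReal.mul_inv_le_one _) _).trans (by rw [one_mul])
  have h3 : Measurable fun Q : Conf d =>
      ∫⁻ k, ((k ::ₘ Q).card : ℝ≥0∞)⁻¹ * ‖F (k ::ₘ Q)‖ₑ ^ 2 := by
    refine measurable_of_conf fun l => ?_
    exact (hG.comp (measurable_cons_conf l)).lintegral_prod_left'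
  filter_upwards [ae_lt_top h3 h2] with Q hQ
  refine ⟨(hF.comp (measurable_cons Q)).aestronglyMeasurable, ?_⟩
  have hFc : ∀ Q : Conf d, Measurable fun k => ‖F (k ::ₘ Q)‖ₑ ^ 2 := fun Q =>
          (hF.comp (measurable_cons Q)).enorm.pow_const 2
  simp only [Multiset.card_cons] at hQ
  rw [lintegral_const_mul _ (hFc Q)] at hQ
  have h4 : eLpNorm (fun k => F (k ::ₘ Q)) 2 volume ^ 2 < ∞ := by
    rw [eLpNorm_two_sq]
    refine ENNReal.lt_top_of_mul_ne_top_right hQ.ne ?_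
    exact ENNReal.inv_ne_zero.2 (ENNReal.natCast_ne_top _)
  rw [lt_top_iff_ne_top] at h4 ⊢
  intro h5
  exact h4 (by rw [h5]; simp)

theorem create_add (F G : Conf d → Spin) : S.create (F + G) = S.create F + S.create G := by
  funext Q
  simp only [create, Pi.add_apply, smul_add, Multiset.sum_map_add]

theorem create_smul (c : ℂ) (F : Conf d → Spin) : S.create (c • F) = c • S.create F := by
  funext Q
  simp only [create, Pi.smul_apply, smul_comm _ c, Multiset.smul_sum, Multiset.map_map]
  rfl

theorem annihilate_smul (c : ℂ) (F : Conf d → Spin) :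
    S.annihilate (c • F) = c • S.annihilate F := by
  funext Q
  simp only [annihilate, Pi.smul_apply, smul_comm _ c, integral_smul]

theorem annihilate_add {F G : Conf d → Spin} (hF : Measurable F) (hG : Measurable G)
    (hF2 : MemLp F 2 (lebesguePoisson d)) (hG2 : MemLp G 2 (lebesguePoisson d)) :
    S.annihilate (F + G) =ᵐ[lebesguePoisson d] S.annihilate F + S.annihilate G := by
  have hl : MemLp (fun k => conj (S.lam k)) 2 volume :=
    S.memLp_lam.of_le (Complex.continuous_conj.comp
      S.lam_contDiff.continuous).aestronglyMeasurable (Eventually.of_forall fun k => by simp)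
  filter_upwards [ae_memLp_cons hF hF2, ae_memLp_cons hG hG2] with Q h1 h2
  simp only [annihilate, Pi.add_apply, smul_add]
  exact integral_add (memLp_one_iff_integrable.1 (h1.smul hl))
    (memLp_one_iff_integrable.1 (h2.smul hl))

/-- The operator `A σ₁ (a*(λ) + a(λ)) B`, for matrix-valued multiplication operators `A`, `B`
whose size depends on the particle number in such a way that the growth of the creation and
annihilation operators is compensated. -/
theorem exists_coupling_clm {A B : Conf d → M2} (hA : StronglyMeasurable A)
    (hB : StronglyMeasurable B) {a b : ℕ → ℝ≥0∞} (ha : ∀ Q, ‖A Q‖ₑ ≤ a Q.card)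
    (hb : ∀ Q, ‖B Q‖ₑ ≤ b Q.card) (hbt : ∃ b' : ℝ, ∀ Q, ‖B Q‖ ≤ b') {c : NNReal}
    (h1 : ∀ l : ℕ, a (l + 1) ^ 2 * (l + 1) * b l ^ 2 ≤ (c : ℝ≥0∞) ^ 2)
    (h2 : ∀ l : ℕ, a l ^ 2 * (l + 1) * b (l + 1) ^ 2 ≤ (c : ℝ≥0∞) ^ 2) :
    ∃ L : Hilb d →L[ℂ] Hilb d,
      ‖L‖ ≤ 2 * (‖σ₁‖ * (eLpNorm S.lam 2 volume).toReal * c) ∧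
      ∀ F : Hilb d, L F =ᵐ[lebesguePoisson d] fun Q => A Q (σ₁
        (S.create (fun Q => B Q (F Q)) Q + S.annihilate (fun Q => B Q (F Q)) Q)) := by
  have hBm : ∀ F : Conf d → Spin, StronglyMeasurable F → Measurable fun Q => B Q (F Q) :=
    fun F hF => (stronglyMeasurable_clm_apply hB hF).measurable
  have hAs : StronglyMeasurable fun Q => (A Q).comp σ₁ :=
    ((ContinuousLinearMap.compL ℂ Spin Spin Spin).flip σ₁).continuous.comp_stronglyMeasurable hA
  have hB2 : ∀ F : Conf d → Spin, StronglyMeasurable F → MemLp F 2 (lebesguePoisson d) →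
      MemLp (fun Q => B Q (F Q)) 2 (lebesguePoisson d) := by
    intro F hF hF2
    obtain ⟨b', hb'⟩ := hbt
    refine hF2.of_le_mul (c := b') (hBm F hF).aestronglyMeasurable
      (Eventually.of_forall fun Q => ?_)
    exact ((B Q).le_opNorm _).trans (mul_le_mul_of_nonneg_right (hb' Q) (norm_nonneg _))
  set N : ℝ≥0∞ := eLpNorm S.lam 2 volume with hN
  have hNt : N ≠ ∞ := S.memLp_lam.2.ne
  -- each of the two terms is estimated through its squared norm
  have key : ∀ (F G : Conf d → Spin) (w : ℕ → ℝ≥0∞), StronglyMeasurable F →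
      (∀ l, w l * b l ^ 2 ≤ (c : ℝ≥0∞) ^ 2) →
      (∫⁻ Q, a Q.card ^ 2 * ‖G Q‖ₑ ^ 2 ∂lebesguePoisson d
        ≤ N ^ 2 * ∫⁻ Q, w Q.card * ‖B Q (F Q)‖ₑ ^ 2 ∂lebesguePoisson d) →
      eLpNorm (fun Q => A Q (σ₁ (G Q))) 2 (lebesguePoisson d)
        ≤ ‖σ₁‖ₑ * N * c * eLpNorm F 2 (lebesguePoisson d) := by
    intro F G w hF hw hG
    refine (ENNReal.pow_le_pow_left_iff two_ne_zero).1 ?_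
    have hFm : Measurable fun Q => ‖F Q‖ₑ ^ 2 := hF.measurable.enorm.pow_const 2
    rw [eLpNorm_two_sq, mul_pow, mul_pow, mul_pow, eLpNorm_two_sq _ F]
    calc ∫⁻ Q, ‖A Q (σ₁ (G Q))‖ₑ ^ 2 ∂lebesguePoisson d
        ≤ ∫⁻ Q, ‖σ₁‖ₑ ^ 2 * (a Q.card ^ 2 * ‖G Q‖ₑ ^ 2) ∂lebesguePoisson d := by
          refine lintegral_mono fun Q => ?_
          have : ‖A Q (σ₁ (G Q))‖ₑ ≤ ‖σ₁‖ₑ * (a Q.card * ‖G Q‖ₑ) := by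
            calc _ ≤ ‖A Q‖ₑ * ‖σ₁ (G Q)‖ₑ := (A Q).le_opENorm _
              _ ≤ a Q.card * (‖σ₁‖ₑ * ‖G Q‖ₑ) := mul_le_mul' (ha Q) (σ₁.le_opENorm _)
              _ = _ := by ring
          calc _ ≤ _ := pow_le_pow_left' this 2
            _ = _ := by rw [mul_pow, mul_pow]
      _ ≤ ‖σ₁‖ₑ ^ 2 * (N ^ 2 * ∫⁻ Q, w Q.card * ‖B Q (F Q)‖ₑ ^ 2 ∂lebesguePoisson d) := by
          rw [lintegral_const_mul' _ _ (by simp)]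
          exact mul_le_mul_right hG _
      _ ≤ ‖σ₁‖ₑ ^ 2 * (N ^ 2 * ∫⁻ Q, (c : ℝ≥0∞) ^ 2 * ‖F Q‖ₑ ^ 2 ∂lebesguePoisson d) := by
          refine mul_le_mul_right (mul_le_mul_right (lintegral_mono fun Q => ?_) _) _
          calc w Q.card * ‖B Q (F Q)‖ₑ ^ 2 ≤ w Q.card * (b Q.card * ‖F Q‖ₑ) ^ 2 := by
                refine mul_le_mul_right (pow_le_pow_left' ?_ 2) _
                exact ((B Q).le_opENorm _).trans (mul_le_mul_left (hb Q) _)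
            _ = (w Q.card * b Q.card ^ 2) * ‖F Q‖ₑ ^ 2 := by ring
            _ ≤ _ := mul_le_mul_left (hw _) _
      _ = _ := by
          rw [lintegral_const_mul _ hFm]
          ring
  refine exists_clm_of_eLpNorm_le (fun F Q => A Q (σ₁
        (S.create (fun Q => B Q (F Q)) Q + S.annihilate (fun Q => B Q (F Q)) Q)))
    _ (by positivity) ?_ ?_ ?_ ?_ ?_
  · intro F G h
    have h3 : (fun Q => B Q (F Q)) =ᵐ[lebesguePoisson d] fun Q => B Q (G Q) := by
      filter_upwards [h] with Q hQ
      rw [hQ]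
    filter_upwards [S.create_congr_ae h3, S.annihilate_congr_ae h3] with Q h4 h5
    rw [h4, h5]
  · intro F hF
    exact (stronglyMeasurable_clm_apply hAs ((S.measurable_create (hBm F hF)).add
      (S.measurable_annihilate (hBm F hF))).stronglyMeasurable).aestronglyMeasurable
  · intro F hF hF2
    have h3 := key F (S.create fun Q => B Q (F Q)) (fun l => a (l + 1) ^ 2 * (l + 1)) hF
      (fun l => by exact_mod_cast h1 l) (S.lintegral_create_le (hBm F hF) fun l => a l ^ 2)
    have h4 := key F (S.annihilate fun Q => B Q (F Q)) (fun l => a (l - 1) ^ 2 * l) hF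
      (fun l => by
        cases l with
        | zero => simp
        | succ l => simpa using h2 l)
      (S.lintegral_annihilate_le (hBm F hF) fun l => a l ^ 2)
    simp only [map_add]
    refine (eLpNorm_add_le (stronglyMeasurable_clm_apply hAs
        (S.measurable_create (hBm F hF)).stronglyMeasurable).aestronglyMeasurable
      (stronglyMeasurable_clm_apply hAs
        (S.measurable_annihilate (hBm F hF)).stronglyMeasurable).aestronglyMeasurable
      (by norm_num)).trans ((add_le_add h3 h4).trans (le_of_eq ?_))
    rw [ENNReal.ofReal_mul (by norm_num), ENNReal.ofReal_mul (by positivity),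
      ENNReal.ofReal_mul (by positivity), ENNReal.ofReal_toReal hNt, ofReal_norm,
      ENNReal.ofReal_coe_nnreal]
    simp only [ENNReal.ofReal_ofNat]
    ring
  · intro F G hF hG hF2 hG2
    have h3 := S.annihilate_add (hBm F hF) (hBm G hG) (hB2 F hF hF2) (hB2 G hG hG2)
    have e : (fun Q => B Q ((F + G) Q)) = (fun Q => B Q (F Q)) + fun Q => B Q (G Q) := by
      funext Q
      simp
    filter_upwards [h3] with Q hQ
    rw [e, S.create_add, hQ]
    simp only [Pi.add_apply, map_add]
    abel
  · intro s F
    have e : (fun Q => B Q ((s • F) Q)) = s • fun Q => B Q (F Q) := by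
      funext Q
      simp
    refine Eventually.of_forall fun Q => ?_
    simp only
    rw [e, S.create_smul, S.annihilate_smul]
    simp only [Pi.smul_apply, map_add, map_smul, smul_add]

end Model

end FockSpace

/-! ### The free resolvent -/

section FreeResolvent

variable {d : ℕ}

theorem σ₃_mul_self : σ₃ * σ₃ = 1 := by
  unfold σ₃ ofMatrix
  rw [← map_mul, ← map_one (Matrix.toEuclideanCLM (n := Fin 2) (𝕜 := ℂ))]
  congr 1
  ext i j
  fin_cases i <;> fin_cases j <;> simp

/-- The spectral projection of `σ₃` for the eigenvalue `1`. -/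
noncomputable def projUp : M2 := (2⁻¹ : ℂ) • (1 + σ₃)

/-- The spectral projection of `σ₃` for the eigenvalue `-1`. -/
noncomputable def projDown : M2 := (2⁻¹ : ℂ) • (1 - σ₃)

/-- A bound for the spectral projections of `σ₃`. -/
noncomputable def projNorm : ℝ := ‖projUp‖ + ‖projDown‖

theorem projNorm_nonneg : 0 ≤ projNorm := by unfold projNorm; positivity

theorem combination_mul_combination_of_involution {R : Type*} [Ring R] [Algebra ℂ R] {s : R}
    (h : s * s = 1) (a b a' b' : ℂ) :
    (a • ((2⁻¹ : ℂ) • (1 + s)) + b • ((2⁻¹ : ℂ) • (1 - s)))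
        * (a' • ((2⁻¹ : ℂ) • (1 + s)) + b' • ((2⁻¹ : ℂ) • (1 - s)))
      = (a * a') • ((2⁻¹ : ℂ) • (1 + s)) + (b * b') • ((2⁻¹ : ℂ) • (1 - s)) := by
  simp only [smul_smul, add_mul, mul_add, smul_mul_smul_comm, sub_mul, mul_sub, h, one_mul,
    mul_one]
  module

theorem combination_mul_combination (a b a' b' : ℂ) :
    (a • projUp + b • projDown) * (a' • projUp + b' • projDown)
      = (a * a') • projUp + (b * b') • projDown :=
  combination_mul_combination_of_involution σ₃_mul_self a b a' b'

theorem smul_σ₃_add_smul_one (s t : ℂ) :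
    s • σ₃ + t • (1 : M2) = (t + s) • projUp + (t - s) • projDown := by
  unfold projUp projDown
  module

theorem projUp_add_projDown : (1 : ℂ) • projUp + (1 : ℂ) • projDown = 1 := by
  unfold projUp projDown
  module

namespace Model

variable (S : Model d)

theorem kappa_pos : 0 < S.kappa := S.ω_pos 0

theorem omegaConf_add (Q Q' : Conf d) :
    S.omegaConf (Q + Q') = S.omegaConf Q + S.omegaConf Q' := by
  simp [omegaConf]

theorem omegaConf_conf {ι : Type} [Fintype ι] (x : ι → E d) :
    S.omegaConf (conf x) = ∑ i, S.ω (x i) := sum_map_conf x S.ω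

theorem card_mul_kappa_le (Q : Conf d) : Q.card * S.kappa ≤ S.omegaConf Q := by
  obtain ⟨x, hx⟩ := exists_conf_eq Q
  rw [← hx, omegaConf_conf, card_conf]
  have := Finset.sum_le_sum fun i (_ : i ∈ Finset.univ) => S.ω_min (x i)
  simpa using! this

/-- The inverse of `ε σ₃ + t - z`, written in terms of the spectral projections of `σ₃`. -/
noncomputable def resAt (z : ℂ) (t : ℝ) : M2 :=
  ((t : ℂ) + S.ε - z)⁻¹ • projUp + ((t : ℂ) - S.ε - z)⁻¹ • projDown

theorem le_norm_up {z : ℂ} {t : ℝ} : t - S.ε - z.re ≤ ‖(t : ℂ) + S.ε - z‖ := by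
  have h1 := Complex.re_le_norm ((t : ℂ) + S.ε - z)
  have h2 := S.ε_pos
  simp only [Complex.sub_re, Complex.add_re, Complex.ofReal_re] at h1
  linarith

theorem le_norm_down {z : ℂ} {t : ℝ} : t - S.ε - z.re ≤ ‖(t : ℂ) - S.ε - z‖ := by
  have h1 := Complex.re_le_norm ((t : ℂ) - S.ε - z)
  simpa only [Complex.sub_re, Complex.ofReal_re] using h1

variable {S} in
theorem up_ne_zero {z : ℂ} {t : ℝ} (h : 0 < t - S.ε - z.re) : (t : ℂ) + S.ε - z ≠ 0 :=
  norm_pos_iff.1 (h.trans_le S.le_norm_up)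

variable {S} in
theorem down_ne_zero {z : ℂ} {t : ℝ} (h : 0 < t - S.ε - z.re) : (t : ℂ) - S.ε - z ≠ 0 :=
  norm_pos_iff.1 (h.trans_le S.le_norm_down)

theorem mul_resAt {z : ℂ} {t : ℝ} (h : 0 < t - S.ε - z.re) :
    ((S.ε : ℂ) • σ₃ + ((t : ℂ) - z) • (1 : M2)) * S.resAt z t = 1 := by
  rw [smul_σ₃_add_smul_one, resAt, combination_mul_combination, sub_add_eq_add_sub,
    mul_inv_cancel₀ (up_ne_zero h), sub_right_comm (t : ℂ) z, mul_inv_cancel₀ (down_ne_zero h),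
    projUp_add_projDown]

theorem resAt_mul {z : ℂ} {t : ℝ} (h : 0 < t - S.ε - z.re) :
    S.resAt z t * ((S.ε : ℂ) • σ₃ + ((t : ℂ) - z) • (1 : M2)) = 1 := by
  rw [smul_σ₃_add_smul_one, resAt, combination_mul_combination, sub_add_eq_add_sub,
    inv_mul_cancel₀ (up_ne_zero h), sub_right_comm (t : ℂ) z, inv_mul_cancel₀ (down_ne_zero h),
    projUp_add_projDown]

theorem freeRes_eq {z : ℂ} {Q : Conf d} (h : 0 < S.omegaConf Q - S.ε - z.re) :
    S.freeRes z Q = S.resAt z (S.omegaConf Q) :=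
  Ring.inverse_unit (⟨_, _, S.mul_resAt h, S.resAt_mul h⟩ : M2ˣ)

theorem norm_resAt_le {z : ℂ} {t : ℝ} (h : 0 < t - S.ε - z.re) :
    ‖S.resAt z t‖ ≤ projNorm / (t - S.ε - z.re) := by
  unfold resAt projNorm
  refine (norm_add_le _ _).trans ?_
  rw [norm_smul, norm_smul, norm_inv, norm_inv, add_div, div_eq_inv_mul, div_eq_inv_mul]
  gcongr
  · exact S.le_norm_up
  · exact S.le_norm_down

theorem norm_freeRes_le {z : ℂ} {Q : Conf d} (h : 0 < S.omegaConf Q - S.ε - z.re) :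
    ‖S.freeRes z Q‖ ≤ projNorm / (S.omegaConf Q - S.ε - z.re) := by
  rw [S.freeRes_eq h]
  exact S.norm_resAt_le h

/-- The first resolvent identity. -/
theorem freeRes_sub_freeRes {z w : ℂ} {Q : Conf d} (hz : 0 < S.omegaConf Q - S.ε - z.re)
    (hw : 0 < S.omegaConf Q - S.ε - w.re) :
    S.freeRes z Q - S.freeRes w Q = (z - w) • (S.freeRes z Q * S.freeRes w Q) := by
  rw [S.freeRes_eq hz, S.freeRes_eq hw, resAt, resAt, combination_mul_combination, smul_add,
    smul_smul, smul_smul]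
  have h1 := up_ne_zero hz
  have h2 := up_ne_zero hw
  have h3 := down_ne_zero hz
  have h4 := down_ne_zero hw
  have e1 : ((S.omegaConf Q : ℂ) + S.ε - z)⁻¹ - ((S.omegaConf Q : ℂ) + S.ε - w)⁻¹
      = (z - w) * (((S.omegaConf Q : ℂ) + S.ε - z)⁻¹ * ((S.omegaConf Q : ℂ) + S.ε - w)⁻¹) := by
    field_simp
    ring
  have e2 : ((S.omegaConf Q : ℂ) - S.ε - z)⁻¹ - ((S.omegaConf Q : ℂ) - S.ε - w)⁻¹
      = (z - w) * (((S.omegaConf Q : ℂ) - S.ε - z)⁻¹ * ((S.omegaConf Q : ℂ) - S.ε - w)⁻¹) := by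
    field_simp
    ring
  rw [← e1, ← e2]
  module

/-- A shift of the spectral parameter by `ω(Q')` amounts to the presence of the bosons `Q'`. -/
theorem freeRes_sub {z : ℂ} (Q Q' : Conf d) :
    S.freeRes (z - S.omegaConf Q') Q = S.freeRes z (Q + Q') := by
  unfold freeRes
  rw [omegaConf_add]
  congr 3
  push_cast
  ring

/-- On configurations with more than `n` points the gap between the free energy and the half-plane
`halfPlane n η` grows linearly in the number of points. -/
theorem gap_lt {n : ℕ} {η : ℝ} {z : ℂ} (hz : z ∈ S.halfPlane n η) (Q : Conf d) :
    η + (Q.card - (n + 1)) * S.kappa < S.omegaConf Q - S.ε - z.re := by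
  have h1 := S.card_mul_kappa_le Q
  have h2 : z.re < -S.ε + (n + 1) * S.kappa - η := hz
  nlinarith

theorem gap_pos {n : ℕ} {η : ℝ} (hη : 0 < η) {z : ℂ} (hz : z ∈ S.halfPlane n η) {Q : Conf d}
    (hQ : n < Q.card) : 0 < S.omegaConf Q - S.ε - z.re := by
  have h1 := S.gap_lt hz Q
  have h2 : ((n : ℝ) + 1) ≤ Q.card := by exact_mod_cast hQ
  nlinarith [S.kappa_pos]

theorem hasDerivAt_resAt {z : ℂ} {t : ℝ} (h : 0 < t - S.ε - z.re) :
    HasDerivAt (S.resAt z) (-(((t : ℂ) + S.ε - z)⁻¹ ^ 2 • projUp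
      + ((t : ℂ) - S.ε - z)⁻¹ ^ 2 • projDown)) t := by
  have hc : HasDerivAt (fun t : ℝ => (t : ℂ)) 1 t := (hasDerivAt_id t).ofReal_comp
  have h1 := (((hc.add_const (S.ε : ℂ)).sub_const z).inv (up_ne_zero h)).smul_const projUp
  have h2 := (((hc.sub_const (S.ε : ℂ)).sub_const z).inv (down_ne_zero h)).smul_const projDown
  refine (h1.add h2).congr_deriv ?_
  simp only [neg_div, one_div, inv_pow]
  module

theorem norm_deriv_resAt_le {z : ℂ} {t : ℝ} (h : 0 < t - S.ε - z.re) :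
    ‖-(((t : ℂ) + S.ε - z)⁻¹ ^ 2 • projUp + ((t : ℂ) - S.ε - z)⁻¹ ^ 2 • projDown)‖
      ≤ projNorm / (t - S.ε - z.re) ^ 2 := by
  rw [norm_neg]
  unfold projNorm
  refine (norm_add_le _ _).trans ?_
  rw [norm_smul, norm_smul, norm_pow, norm_pow, norm_inv, norm_inv, add_div, div_eq_inv_mul,
    div_eq_inv_mul, inv_pow, inv_pow]
  gcongr
  · exact S.le_norm_up
  · exact S.le_norm_down

/-- Near infinity this is the growth condition on `ω`, and on a compact set it holds because `ω` is
positive. -/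
theorem exists_fderiv_ω_le : ∃ C : ℝ, 0 ≤ C ∧ ∀ q, ‖fderiv ℝ S.ω q‖ ≤ C * S.ω q := by
  have hc : Continuous fun q => ‖fderiv ℝ S.ω q‖ / S.ω q :=
    (S.ω_contDiff.continuous_fderiv one_ne_zero).norm.div S.ω_contDiff.continuous
      fun q => (S.ω_pos q).ne'
  have h1 : ∀ᶠ q in cocompact (E d), ‖fderiv ℝ S.ω q‖ / S.ω q < 1 :=
    S.ω_growth.eventually_lt_const one_pos
  obtain ⟨K, hK, hK1⟩ := Filter.mem_cocompact.1 h1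
  obtain ⟨C, hC⟩ := hK.exists_bound_of_continuousOn hc.continuousOn
  refine ⟨max C 1, by positivity, fun q => ?_⟩
  rw [← div_le_iff₀ (S.ω_pos q)]
  by_cases hq : q ∈ K
  · exact (Real.le_norm_self _).trans ((hC q hq).trans (le_max_left _ _))
  · exact (hK1 hq).le.trans (le_max_right _ _)

end Model

end FreeResolvent

/-! ### Weighted bounds on functions and their first derivatives -/

section WeightedBounds

variable {d : ℕ} {ι ι' : Type}

/-- The map `p` between tuples of momenta is a substitution: each entry of `p x` is either an
entry of `x` or does not depend on `x`, and no entry of `x` is used twice.  The entry `j` of `p x`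
is the entry `i` of `x` if `σ j = some i`. -/
structure IsSubst (σ : ι' → Option ι) (p : (ι → E d) → ι' → E d) : Prop where
  some : ∀ j i, σ j = some i → ∀ x, p x j = x i
  none : ∀ j, σ j = none → ∀ x y, p x j = p y j
  inj : ∀ i j j', σ j = Option.some i → σ j' = Option.some i → j = j'

/-- The derivative of a substitution. -/
noncomputable def substDeriv (d : ℕ) (σ : ι' → Option ι) : (ι → E d) →L[ℝ] (ι' → E d) :=
  ContinuousLinearMap.pi fun j => (σ j).elim 0 fun i => ContinuousLinearMap.proj i

theorem substDeriv_single [DecidableEq ι] [DecidableEq ι'] {σ : ι' → Option ι}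
    (hinj : ∀ i j j', σ j = some i → σ j' = some i → j = j') (i : ι) (v : E d) :
    substDeriv d σ (Pi.single i v) = 0 ∨
      ∃ j, σ j = some i ∧ substDeriv d σ (Pi.single i v) = Pi.single j v := by
  by_cases h : ∃ j, σ j = some i
  · obtain ⟨j, hj⟩ := h
    refine Or.inr ⟨j, hj, ?_⟩
    funext j'
    rcases eq_or_ne j' j with rfl | hne
    · simp [substDeriv, hj]
    · rw [Pi.single_eq_of_ne hne]
      cases hj' : σ j' with
      | none => simp [substDeriv, hj']
      | some i' =>
        have : i' ≠ i := by
          rintro rfl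
          exact hne (hinj _ _ _ hj' hj)
        simp [substDeriv, hj', Pi.single_eq_of_ne this]
  · refine Or.inl ?_
    funext j'
    cases hj' : σ j' with
    | none => simp [substDeriv, hj']
    | some i' =>
      have : i' ≠ i := by
        rintro rfl
        exact h ⟨j', hj'⟩
      simp [substDeriv, hj', Pi.single_eq_of_ne this]

theorem IsSubst.hasFDerivAt [Fintype ι] [Fintype ι'] {σ : ι' → Option ι}
    {p : (ι → E d) → ι' → E d} (hp : IsSubst σ p) (x : ι → E d) :
    HasFDerivAt p (substDeriv d σ) x := by
  refine hasFDerivAt_pi.2 fun j => ?_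
  cases hj : σ j with
  | none =>
    rw [funext fun y => hp.none j hj y x]
    simpa using hasFDerivAt_const (p x j) x
  | some i =>
    rw [funext fun y => hp.some j i hj y]
    exact hasFDerivAt_apply i x

theorem IsSubst.contDiff [Fintype ι] [Fintype ι'] {σ : ι' → Option ι}
    {p : (ι → E d) → ι' → E d} (hp : IsSubst σ p) :
    ContDiff ℝ 1 p := by
  refine contDiff_pi.2 fun j => ?_
  cases hj : σ j with
  | none =>
    rw [funext fun y => hp.none j hj y 0]
    exact contDiff_const
  | some i =>
    rw [funext fun y => hp.some j i hj y]
    exact contDiff_apply _ _ i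

variable [Fintype ι] [DecidableEq ι] [Fintype ι'] [DecidableEq ι']

/-- The function `g` of a tuple of momenta is continuously differentiable, and it and its
first-order partial derivatives are bounded by `M` times the weight `w`. -/
structure C1Bound (w : (ι → E d) → ℝ) (g : (ι → E d) → M2) (M : ℝ) : Prop where
  contDiff : ContDiff ℝ 1 g
  norm_le : ∀ x, ‖g x‖ ≤ M * w x
  norm_fderiv_le : ∀ x (i : ι) (c : Fin d),
    ‖fderiv ℝ g x (Pi.single i (EuclideanSpace.single c 1))‖ ≤ M * w x

theorem opNorm_le_of_partial (L : (ι → E d) →L[ℝ] M2) {B : ℝ} (hB : 0 ≤ B)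
    (h : ∀ (i : ι) (c : Fin d), ‖L (Pi.single i (EuclideanSpace.single c 1))‖ ≤ B) :
    ‖L‖ ≤ Fintype.card ι * d * B := by
  refine L.opNorm_le_bound (by positivity) fun v => ?_
  have hv : v = ∑ i : ι, ∑ c : Fin d,
      (v i c) • (Pi.single i (EuclideanSpace.single c (1 : ℝ)) : ι → E d) := by
    funext j
    ext c'
    simp [Finset.sum_apply, Pi.single_apply, apply_ite, Finset.sum_ite_eq]
  calc ‖L v‖ = ‖∑ i : ι, ∑ c : Fin d,
        (v i c) • L (Pi.single i (EuclideanSpace.single c (1 : ℝ)) : ι → E d)‖ := by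
        conv_lhs => rw [hv]
        simp only [map_sum, map_smul]
    _ ≤ ∑ i : ι, ∑ c : Fin d, ‖v‖ * B := by
        refine norm_sum_le_of_le _ fun i _ => norm_sum_le_of_le _ fun c _ => ?_
        rw [norm_smul]
        exact mul_le_mul ((PiLp.norm_apply_le (v i) c).trans (norm_le_pi_norm v i)) (h i c)
          (norm_nonneg _) (norm_nonneg _)
    _ = _ := by
        simp
        ring

namespace C1Bound

variable {w : (ι → E d) → ℝ} {w' : (ι' → E d) → ℝ} {g g₁ g₂ : (ι → E d) → M2} {M M₁ M₂ : ℝ}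

theorem hasFDerivAt (h : C1Bound w g M) (x : ι → E d) : HasFDerivAt g (fderiv ℝ g x) x :=
  (h.contDiff.differentiable one_ne_zero x).hasFDerivAt

theorem nonneg (h : C1Bound w g M) (x : ι → E d) : 0 ≤ M * w x :=
  (norm_nonneg _).trans (h.norm_le x)

theorem opNorm_fderiv_le (h : C1Bound w g M) (x : ι → E d) :
    ‖fderiv ℝ g x‖ ≤ Fintype.card ι * d * (M * w x) :=
  opNorm_le_of_partial _ (h.nonneg x) (h.norm_fderiv_le x)

theorem zero (w : (ι → E d) → ℝ) : C1Bound w (fun _ => (0 : M2)) 0 :=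
  ⟨contDiff_const, fun x => by simp, fun x i c => by simp⟩

theorem mono (h : C1Bound w g M₁) (hw : ∀ x, 0 ≤ w x) (hM : M₁ ≤ M₂) : C1Bound w g M₂ :=
  ⟨h.contDiff, fun x => (h.norm_le x).trans (mul_le_mul_of_nonneg_right hM (hw x)),
    fun x i c => (h.norm_fderiv_le x i c).trans (mul_le_mul_of_nonneg_right hM (hw x))⟩

theorem add (h₁ : C1Bound w g₁ M₁) (h₂ : C1Bound w g₂ M₂) :
    C1Bound w (fun x => g₁ x + g₂ x) (M₁ + M₂) := by
  refine ⟨h₁.contDiff.add h₂.contDiff, fun x => ?_, fun x i c => ?_⟩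
  · rw [add_mul]
    exact (norm_add_le _ _).trans (add_le_add (h₁.norm_le x) (h₂.norm_le x))
  · have hD : HasFDerivAt (fun x => g₁ x + g₂ x) _ x :=
      (h₁.hasFDerivAt x).add (h₂.hasFDerivAt x)
    rw [hD.fderiv, add_mul]
    exact (norm_add_le _ _).trans (add_le_add (h₁.norm_fderiv_le x i c) (h₂.norm_fderiv_le x i c))

theorem sum {J : Type*} (s : Finset J) {g : J → (ι → E d) → M2} {M : ℝ}
    (h : ∀ j ∈ s, C1Bound w (g j) M) : C1Bound w (fun x => ∑ j ∈ s, g j x) (s.card * M) := by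
  classical
  induction s using Finset.induction_on with
  | empty => simpa using zero w
  | insert a s ha ih =>
    simp only [Finset.sum_insert ha]
    rw [Finset.card_insert_of_notMem ha, Nat.cast_succ, add_mul, one_mul, add_comm]
    exact (h a (Finset.mem_insert_self a s)).add
      (ih fun j hj => h j (Finset.mem_insert_of_mem hj))

theorem clm_comp (h : C1Bound w g M) (L : M2 →L[ℝ] M2) :
    C1Bound w (fun x => L (g x)) (‖L‖ * M) := by
  refine ⟨L.contDiff.comp h.contDiff, fun x => ?_, fun x i c => ?_⟩
  · rw [mul_assoc]
    exact (L.le_opNorm _).trans (mul_le_mul_of_nonneg_left (h.norm_le x) (norm_nonneg _))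
  · have hD : HasFDerivAt (fun x => L (g x)) _ x := L.hasFDerivAt.comp x (h.hasFDerivAt x)
    rw [hD.fderiv, mul_assoc]
    exact (L.le_opNorm _).trans
      (mul_le_mul_of_nonneg_left (h.norm_fderiv_le x i c) (norm_nonneg _))

theorem const_smul (h : C1Bound w g M) (a : ℂ) : C1Bound w (fun x => a • g x) (‖a‖ * M) := by
  refine ⟨h.contDiff.const_smul a, fun x => ?_, fun x i c => ?_⟩
  · rw [norm_smul, mul_assoc]
    exact mul_le_mul_of_nonneg_left (h.norm_le x) (norm_nonneg _)
  · have hD : HasFDerivAt (fun x => a • g x) _ x := (h.hasFDerivAt x).const_smul a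
    rw [hD.fderiv, _root_.smul_apply, norm_smul,
      mul_assoc]
    exact mul_le_mul_of_nonneg_left (h.norm_fderiv_le x i c) (norm_nonneg _)

theorem mul_left (h : C1Bound w g M) {A : (ι → E d) → M2} (hA : ContDiff ℝ 1 A) {a b : ℝ}
    (ha : ∀ x, ‖A x‖ ≤ a)
    (hb : ∀ x (i : ι) (c : Fin d),
      ‖fderiv ℝ A x (Pi.single i (EuclideanSpace.single c 1))‖ ≤ b) (hb0 : 0 ≤ b) :
    C1Bound w (fun x => A x * g x) ((a + b) * M) := by
  have hAx : ∀ x, HasFDerivAt A (fderiv ℝ A x) x := fun x =>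
    (hA.differentiable one_ne_zero x).hasFDerivAt
  refine ⟨hA.mul h.contDiff, fun x => ?_, fun x i c => ?_⟩
  · rw [mul_assoc, add_mul]
    have h1 : ‖A x * g x‖ ≤ a * (M * w x) := (norm_mul_le _ _).trans
      (mul_le_mul (ha x) (h.norm_le x) (norm_nonneg _) ((norm_nonneg _).trans (ha x)))
    have h2 := mul_nonneg hb0 (h.nonneg x)
    linarith
  · have hD : HasFDerivAt (fun x => A x * g x) _ x := (hAx x).mul' (h.hasFDerivAt x)
    rw [hD.fderiv, mul_assoc, add_mul]
    refine (norm_add_le _ _).trans (add_le_add ?_ ?_)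
    · exact (norm_mul_le _ _).trans (mul_le_mul (ha x) (h.norm_fderiv_le x i c) (norm_nonneg _)
        ((norm_nonneg _).trans (ha x)))
    · exact (norm_mul_le _ _).trans (mul_le_mul (hb x i c) (h.norm_le x) (norm_nonneg _) hb0)

end C1Bound

namespace C1Bound

variable {w : (ι → E d) → ℝ} {w' : (ι' → E d) → ℝ} {g : (ι' → E d) → M2} {M : ℝ}

theorem comp_subst (h : C1Bound w' g M) {σ : ι' → Option ι} {p : (ι → E d) → ι' → E d}
    (hp : IsSubst σ p) : C1Bound (fun x => w' (p x)) (fun x => g (p x)) M := by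
  refine ⟨h.contDiff.comp hp.contDiff, fun x => h.norm_le _, fun x i c => ?_⟩
  have hD : HasFDerivAt (fun x => g (p x)) _ x :=
    (h.hasFDerivAt (p x)).comp x (hp.hasFDerivAt x)
  rw [hD.fderiv, ContinuousLinearMap.comp_apply]
  rcases substDeriv_single hp.inj i (EuclideanSpace.single c (1 : ℝ) : E d) with h0 | ⟨j, _, hj⟩
  · rw [h0, map_zero, norm_zero]
    exact h.nonneg _
  · rw [hj]
    exact h.norm_fderiv_le _ _ _

/-- Multiplication by a form factor in the variable `x i₀` adds the factor `η (x i₀)` to the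
weight. -/
theorem form_factor_smul {u : E d → ℂ} {η : E d → ℝ} {C : ℝ} (hC : 0 ≤ C) (hη : ∀ q, 0 ≤ η q)
    (hu : ContDiff ℝ 1 u) (hu0 : ∀ q, ‖u q‖ ≤ η q)
    (hu1 : ∀ q v, ‖fderiv ℝ u q v‖ ≤ C * η q * ‖v‖) {g : (ι → E d) → M2}
    (h : C1Bound w g M) (i₀ : ι) :
    C1Bound (fun x => η (x i₀) * w x) (fun x => u (x i₀) • g x) ((1 + C) * M) := by
  have hd : ∀ x : ι → E d, HasFDerivAt (fun x : ι → E d => u (x i₀))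
      ((fderiv ℝ u (x i₀)).comp (ContinuousLinearMap.proj i₀)) x := fun x =>
    (hu.differentiable one_ne_zero (x i₀)).hasFDerivAt.comp x (hasFDerivAt_apply i₀ x)
  have hM : ∀ x, 0 ≤ η (x i₀) * (M * w x) := fun x => mul_nonneg (hη _) (h.nonneg x)
  have hv : ∀ (i : ι) (c : Fin d),
      ‖(Pi.single i (EuclideanSpace.single c (1 : ℝ)) : ι → E d) i₀‖ ≤ 1 := by
    intro i c
    rw [Pi.single_apply]
    split_ifs
    · simp
    · simp
  refine ⟨(hu.comp (contDiff_apply _ _ i₀)).smul h.contDiff, fun x => ?_, fun x i c => ?_⟩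
  · rw [norm_smul]
    have h1 := mul_le_mul (hu0 (x i₀)) (h.norm_le x) (norm_nonneg _) (hη _)
    have h2 := mul_nonneg hC (hM x)
    linarith
  · have hD : HasFDerivAt (fun x => u (x i₀) • g x) _ x := (hd x).smul (h.hasFDerivAt x)
    rw [hD.fderiv]
    have h1 : ‖u (x i₀) • fderiv ℝ g x (Pi.single i (EuclideanSpace.single c 1))‖
        ≤ η (x i₀) * (M * w x) := by
      rw [norm_smul]
      exact mul_le_mul (hu0 (x i₀)) (h.norm_fderiv_le x i c) (norm_nonneg _) (hη _)
    have h2 : ‖fderiv ℝ u (x i₀) ((Pi.single i (EuclideanSpace.single c (1 : ℝ)) :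
        ι → E d) i₀) • g x‖ ≤ C * (η (x i₀) * (M * w x)) := by
      rw [norm_smul]
      have h3 : ‖fderiv ℝ u (x i₀) ((Pi.single i (EuclideanSpace.single c (1 : ℝ)) :
          ι → E d) i₀)‖ ≤ C * η (x i₀) :=
        (hu1 _ _).trans (mul_le_of_le_one_right (mul_nonneg hC (hη _)) (hv i c))
      refine (mul_le_mul h3 (h.norm_le x) (norm_nonneg _) (mul_nonneg hC (hη _))).trans
        (le_of_eq (by ring))
    refine (norm_add_le _ _).trans ((add_le_add h1 h2).trans (le_of_eq (by ring)))

/-- Differentiation under the integral over one momentum. -/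
theorem integral_subst {u : E d → ℂ} {η : E d → ℝ} (hη : ∀ q, 0 ≤ η q) (hu : Continuous u)
    (hu0 : ∀ q, ‖u q‖ ≤ η q) (hη2 : Integrable (fun q => η q ^ 2) volume)
    (h : C1Bound w' g M) {σ : ι' → Option ι} {p : E d → (ι → E d) → ι' → E d}
    (hp : ∀ q, IsSubst σ (p q)) (hpc : ∀ x, Continuous fun q => p q x)
    (hw : ∀ q x, w' (p q x) = η q * w x) (hw0 : ∀ x, 0 ≤ w x) (hw1 : ∀ x, w x ≤ 1)
    (hM : 0 ≤ M) :
    C1Bound w (fun x => ∫ q, u q • g (p q x)) ((∫ q, η q ^ 2) * M) := by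
  have hq : ∀ q, C1Bound w (fun x => u q • g (p q x)) (η q ^ 2 * M) := by
    intro q
    have h1 := (h.comp_subst (hp q)).const_smul (u q)
    simp only [hw q] at h1
    refine ⟨h1.contDiff, fun x => (h1.norm_le x).trans ?_,
      fun x i c => (h1.norm_fderiv_le x i c).trans ?_⟩
    all_goals
      have h2 := mul_le_mul_of_nonneg_right (hu0 q)
        (mul_nonneg hM (mul_nonneg (hη q) (hw0 x)))
      calc _ = ‖u q‖ * (M * (η q * w x)) := by ring
        _ ≤ _ := h2
        _ = _ := by ring
  have hfd : ∀ q x, fderiv ℝ (fun x => u q • g (p q x)) x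
      = u q • (fderiv ℝ g (p q x)).comp (substDeriv d σ) := fun q x =>
    (((h.hasFDerivAt (p q x)).comp x ((hp q).hasFDerivAt x)).const_smul (u q)).fderiv
  have hgc : Continuous (fderiv ℝ g) := h.contDiff.continuous_fderiv one_ne_zero
  have hmeas : ∀ x, AEStronglyMeasurable (fun q => u q • g (p q x)) volume := fun x =>
    (hu.smul (h.contDiff.continuous.comp (hpc x))).aestronglyMeasurable
  have hmeas' : ∀ x, AEStronglyMeasurable
      (fun q => fderiv ℝ (fun x => u q • g (p q x)) x) volume := by
    intro x
    simp only [hfd]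
    have hcc : Continuous fun q => (fderiv ℝ g (p q x)).comp (substDeriv d σ) :=
      (hgc.comp (hpc x)).clm_comp continuous_const
    exact (((ContinuousLinearMap.lsmul ℝ ℂ).continuous.comp hu).clm_comp
      hcc).aestronglyMeasurable
  have hb : ∀ q x, ‖u q • g (p q x)‖ ≤ η q ^ 2 * M := fun q x =>
    ((hq q).norm_le x).trans (mul_le_of_le_one_right (by positivity) (hw1 x))
  have hb' : ∀ q x, ‖fderiv ℝ (fun x => u q • g (p q x)) x‖
      ≤ Fintype.card ι * d * (η q ^ 2 * M) := fun q x =>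
    ((hq q).opNorm_fderiv_le x).trans (mul_le_mul_of_nonneg_left
      (mul_le_of_le_one_right (by positivity) (hw1 x)) (by positivity))
  have hi : Integrable (fun q => η q ^ 2 * M) volume := hη2.mul_const M
  have hi' : Integrable (fun q => Fintype.card ι * d * (η q ^ 2 * M)) volume := hi.const_mul _
  have hder : ∀ x, HasFDerivAt (fun x => ∫ q, u q • g (p q x))
      (∫ q, fderiv ℝ (fun x => u q • g (p q x)) x) x := by
    intro x
    refine hasFDerivAt_integral_of_dominated_of_fderiv_le (s := Set.univ)
      (F := fun x q => u q • g (p q x))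
      (F' := fun x q => fderiv ℝ (fun x => u q • g (p q x)) x) univ_mem
      (Eventually.of_forall fun x => hmeas x) (hi.mono' (hmeas x)
        (Eventually.of_forall fun q => hb q x)) (hmeas' x)
      (Eventually.of_forall fun q y _ => hb' q y) hi'
      (Eventually.of_forall fun q y _ => (hq q).hasFDerivAt y)
  have hI : ∀ (t : ℝ), ∫ q, η q ^ 2 * M * t = (∫ q, η q ^ 2) * M * t := fun t => by
    rw [integral_mul_const, integral_mul_const]
  refine ⟨contDiff_one_iff_fderiv.2 ⟨fun x => (hder x).differentiableAt, ?_⟩, fun x => ?_,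
    fun x i c => ?_⟩
  · rw [funext fun x => (hder x).fderiv]
    exact continuous_of_dominated hmeas' (fun x => Eventually.of_forall fun q => hb' q x) hi'
      (Eventually.of_forall fun q => (hq q).contDiff.continuous_fderiv one_ne_zero)
  · rw [← hI]
    exact norm_integral_le_of_norm_le (hi.mul_const _)
      (Eventually.of_forall fun q => (hq q).norm_le x)
  · rw [(hder x).fderiv, ContinuousLinearMap.integral_apply
      (hi'.mono' (hmeas' x) (Eventually.of_forall fun q => hb' q x)), ← hI]
    exact norm_integral_le_of_norm_le (hi.mul_const _)
      (Eventually.of_forall fun q => (hq q).norm_fderiv_le x i c)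

end C1Bound

end WeightedBounds

/-! ### The space of coefficient functions -/

/-- A pointwise limit of continuously differentiable functions whose derivatives form a uniform
Cauchy sequence is continuously differentiable. -/
theorem contDiff_one_of_tendsto {X V : Type*} [NormedAddCommGroup X] [NormedSpace ℝ X]
    [NormedAddCommGroup V] [NormedSpace ℝ V] [CompleteSpace V] {f : ℕ → X → V} {g : X → V}
    (hf : ∀ i, ContDiff ℝ 1 (f i))
    (hc : ∀ ε > 0, ∃ N, ∀ i ≥ N, ∀ j ≥ N, ∀ x, ‖fderiv ℝ (f i) x - fderiv ℝ (f j) x‖ ≤ ε)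
    (hg : ∀ x, Tendsto (fun i => f i x) atTop (𝓝 (g x))) :
    ContDiff ℝ 1 g ∧
      ∀ x v, Tendsto (fun i => fderiv ℝ (f i) x v) atTop (𝓝 (fderiv ℝ g x v)) := by
  have hDlim : ∀ x, ∃ D, Tendsto (fun i => fderiv ℝ (f i) x) atTop (𝓝 D) := by
    intro x
    refine cauchySeq_tendsto_of_complete (Metric.cauchySeq_iff.2 fun ε hε => ?_)
    obtain ⟨N, hN⟩ := hc (ε / 2) (by positivity)
    refine ⟨N, fun i hi j hj => ?_⟩
    rw [dist_eq_norm]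
    linarith [hN i hi j hj x]
  choose D hD using hDlim
  have hDu : TendstoUniformly (fun i => fderiv ℝ (f i)) D atTop := by
    refine Metric.tendstoUniformly_iff.2 fun ε hε => ?_
    obtain ⟨N, hN⟩ := hc (ε / 2) (by positivity)
    filter_upwards [eventually_ge_atTop N] with i hi x
    have h1 : ‖D x - fderiv ℝ (f i) x‖ ≤ ε / 2 := by
      refine le_of_tendsto ((hD x).sub_const _).norm ?_
      filter_upwards [eventually_ge_atTop N] with j hj
      exact hN j hj i hi x
    rw [dist_eq_norm]
    linarith
  have hder : ∀ x, HasFDerivAt g (D x) x := fun x =>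
    hasFDerivAt_of_tendstoUniformly hDu
      (fun i x => ((hf i).differentiable one_ne_zero x).hasFDerivAt) hg x
  have hfd : fderiv ℝ g = D := funext fun x => (hder x).fderiv
  refine ⟨contDiff_one_iff_fderiv.2 ⟨fun x => (hder x).differentiableAt, ?_⟩, fun x v => ?_⟩
  · rw [hfd]
    exact hDu.continuous (Frequently.of_forall fun i => (hf i).continuous_fderiv one_ne_zero)
  · rw [hfd]
    exact ((ContinuousLinearMap.apply ℝ V v).continuous.tendsto _).comp (hD x)

section CoefficientSpace

variable {d : ℕ} {h : E d → ℝ} {n : ℕ}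

theorem weight_nonneg (hh : ∀ q, 0 ≤ h q) {m l r : ℕ} (x : Fin l ⊕ (Fin r ⊕ Fin m) → E d) :
    0 ≤ weight h x :=
  mul_nonneg (Finset.prod_nonneg fun _ _ => hh _) (Finset.prod_nonneg fun _ _ => hh _)

theorem weight_le_one (hh : ∀ q, 0 ≤ h q) (hh1 : ∀ q, h q ≤ 1) {m l r : ℕ}
    (x : Fin l ⊕ (Fin r ⊕ Fin m) → E d) : weight h x ≤ 1 :=
  mul_le_one₀ (Finset.prod_le_one (fun _ _ => hh _) fun _ _ => hh1 _)
    (Finset.prod_nonneg fun _ _ => hh _) (Finset.prod_le_one (fun _ _ => hh _) fun _ _ => hh1 _)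

/-- Every argument list of a coefficient function comes from a tuple of momenta. -/
theorem exists_joint_eq (m : ℕ) (Q₁ Q₂ : Conf d) (k : Fin m → E d) :
    ∃ x : Fin Q₁.card ⊕ (Fin Q₂.card ⊕ Fin m) → E d,
      (∀ μ : Coeff d, joint μ m Q₁.card Q₂.card x = μ m Q₁ Q₂ k) ∧
      weight h x = (Q₁.map h).prod * ∏ i, h (k i) := by
  obtain ⟨a, ha⟩ := exists_conf_eq Q₁
  obtain ⟨b, hb⟩ := exists_conf_eq Q₂
  refine ⟨Sum.elim a (Sum.elim b k), fun μ => ?_, ?_⟩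
  · simp only [joint, Sum.elim_inl, Sum.elim_inr]
    rw [ha, hb]
  · simp only [weight, Sum.elim_inl, Sum.elim_inr]
    congr 1
    have h1 : ((conf a).map h).prod = ∏ i, h (a i) := by
      rw [conf, Multiset.map_map]
      rfl
    rw [← h1, ha]

namespace CoeffSpace

theorem c1Bound (μ : CoeffSpace h n) (m l r : ℕ) :
    C1Bound (weight h) (joint μ.fn m l r) ‖μ‖ :=
  ⟨μ.2.2.1 m l r, fun x => (μ.norm_mem.2 m l r x).1, fun x i c => (μ.norm_mem.2 m l r x).2 i c⟩

theorem eq_zero (μ : CoeffSpace h n) {m : ℕ} {Q₁ Q₂ : Conf d}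
    (hs : ¬(m < Q₁.card ∧ Q₂.card + m = n)) (k : Fin m → E d) : μ.fn m Q₁ Q₂ k = 0 :=
  μ.2.1 m Q₁ Q₂ k hs

theorem norm_fn_le (μ : CoeffSpace h n) (m : ℕ) (Q₁ Q₂ : Conf d) (k : Fin m → E d) :
    ‖μ.fn m Q₁ Q₂ k‖ ≤ ‖μ‖ * ((Q₁.map h).prod * ∏ i, h (k i)) := by
  obtain ⟨x, hx, hw⟩ := exists_joint_eq (h := h) m Q₁ Q₂ k
  rw [← hx μ.fn, ← hw]
  exact (μ.c1Bound _ _ _).norm_le x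

theorem fn_injective : Function.Injective (fn : CoeffSpace h n → Coeff d) :=
  Subtype.val_injective

theorem fn_add (μ ν : CoeffSpace h n) : (μ + ν).fn = μ.fn + ν.fn := rfl

theorem fn_sub (μ ν : CoeffSpace h n) : (μ - ν).fn = μ.fn - ν.fn := rfl

theorem fn_smul (a : ℂ) (μ : CoeffSpace h n) : (a • μ).fn = a • μ.fn := rfl

/-- Coefficient functions with weighted bounds on each sector define an element of `𝓑_n`. -/
theorem exists_of_c1Bound (hh : ∀ q, 0 ≤ h q) {ν : Coeff d} {M : ℝ} (hM : 0 ≤ M)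
    (hv : ∀ m Q₁ Q₂ k, ¬(m < Q₁.card ∧ Q₂.card + m = n) → ν m Q₁ Q₂ k = 0)
    (hb : ∀ m l r, m < l → r + m = n → C1Bound (weight h) (joint ν m l r) M) :
    ∃ μ : CoeffSpace h n, μ.fn = ν ∧ ‖μ‖ ≤ M := by
  have hb' : ∀ m l r, C1Bound (weight h) (joint ν m l r) M := by
    intro m l r
    by_cases hs : m < l ∧ r + m = n
    · exact hb m l r hs.1 hs.2
    · have h0 : joint ν m l r = fun _ => 0 := by
        funext x
        exact hv _ _ _ _ (by simpa [card_conf] using hs)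
      rw [h0]
      exact (C1Bound.zero _).mono (fun x => weight_nonneg hh x) hM
  have hB : HasBound h ν M := fun m l r x =>
    ⟨(hb' m l r).norm_le x, (hb' m l r).norm_fderiv_le x⟩
  exact ⟨⟨ν, hv, fun m l r => (hb' m l r).contDiff, M, hM, hB⟩, rfl, norm_le hM hB⟩

/-- A bounded operator on `𝓑_n` from a linear operation on families of functions. -/
theorem exists_clm (hh : ∀ q, 0 ≤ h q) (T : Coeff d → Coeff d) {C : ℝ} (hC : 0 ≤ C)
    (hadd : ∀ μ ν : CoeffSpace h n, T (μ.fn + ν.fn) = T μ.fn + T ν.fn)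
    (hsmul : ∀ (a : ℂ) (μ : CoeffSpace h n), T (a • μ.fn) = a • T μ.fn)
    (hv : ∀ μ m Q₁ Q₂ k, ¬(m < Q₁.card ∧ Q₂.card + m = n) → T μ m Q₁ Q₂ k = 0)
    (hb : ∀ (μ : CoeffSpace h n) m l r, m < l → r + m = n →
      C1Bound (weight h) (joint (T μ.fn) m l r) (C * ‖μ‖)) :
    ∃ L : CoeffSpace h n →L[ℂ] CoeffSpace h n, ‖L‖ ≤ C ∧ ∀ μ, (L μ).fn = T μ.fn := by
  choose L hL hL' using fun μ : CoeffSpace h n =>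
    exists_of_c1Bound (n := n) hh (mul_nonneg hC (norm_nonneg μ)) (hv μ.fn) (hb μ)
  let L0 : CoeffSpace h n →ₗ[ℂ] CoeffSpace h n :=
    { toFun := L
      map_add' := fun μ ν => fn_injective (by rw [hL, fn_add, fn_add, hadd, hL, hL])
      map_smul' := fun a μ => fn_injective (by
        rw [RingHom.id_apply, hL, fn_smul, fn_smul, hsmul, hL]) }
  exact ⟨L0.mkContinuous C hL', L0.mkContinuous_norm_le hC hL', hL⟩

/-- A Cauchy sequence converges pointwise, and its derivatives converge uniformly on each space of
tuples; the weighted bounds pass to the limit. -/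
theorem completeSpace (hh : ∀ q, 0 ≤ h q) (hh1 : ∀ q, h q ≤ 1) :
    CompleteSpace (CoeffSpace h n) := by
  refine Metric.complete_of_cauchySeq_tendsto fun u hu => ?_
  have hcs : ∀ ε > 0, ∃ N, ∀ i ≥ N, ∀ j ≥ N, ‖u i - u j‖ ≤ ε := by
    intro ε hε
    obtain ⟨N, hN⟩ := Metric.cauchySeq_iff.1 hu ε hε
    refine ⟨N, fun i hi j hj => ?_⟩
    have h1 := (hN i hi j hj).le
    rwa [dist_eq_norm] at h1
  have hdiff : ∀ i j m l r, C1Bound (weight h)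
      (fun x => joint (u i).fn m l r x - joint (u j).fn m l r x) ‖u i - u j‖ := fun i j m l r =>
    (u i - u j).c1Bound m l r
  have hfd : ∀ i j m l r x, fderiv ℝ
      (fun x => joint (u i).fn m l r x - joint (u j).fn m l r x) x
        = fderiv ℝ (joint (u i).fn m l r) x - fderiv ℝ (joint (u j).fn m l r) x :=
    fun i j m l r x => (((u i).c1Bound m l r).hasFDerivAt x |>.sub
      (((u j).c1Bound m l r).hasFDerivAt x)).fderiv
  have hlim : ∀ m Q₁ Q₂ k, ∃ a, Tendsto (fun i => (u i).fn m Q₁ Q₂ k) atTop (𝓝 a) := by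
    intro m Q₁ Q₂ k
    refine cauchySeq_tendsto_of_complete (Metric.cauchySeq_iff.2 fun ε hε => ?_)
    obtain ⟨N, hN⟩ := hcs (ε / 2) (by positivity)
    refine ⟨N, fun i hi j hj => ?_⟩
    obtain ⟨x, hx, -⟩ := exists_joint_eq (h := h) m Q₁ Q₂ k
    rw [← hx (u i).fn, ← hx (u j).fn, dist_eq_norm]
    have h1 := ((hdiff i j m _ _).norm_le x).trans
      (mul_le_of_le_one_right (norm_nonneg _) (weight_le_one hh hh1 x))
    linarith [hN i hi j hj]
  choose ν hν using hlim
  have hνj : ∀ m l r x, Tendsto (fun i => joint (u i).fn m l r x) atTop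
      (𝓝 (joint ν m l r x)) := fun m l r x => hν _ _ _ _
  -- uniform Cauchy estimate for the derivatives
  have hDc : ∀ m l r, ∀ ε > 0, ∃ N, ∀ i ≥ N, ∀ j ≥ N, ∀ x,
      ‖fderiv ℝ (joint (u i).fn m l r) x - fderiv ℝ (joint (u j).fn m l r) x‖ ≤ ε := by
    intro m l r ε hε
    set K : ℝ := Fintype.card (Fin l ⊕ (Fin r ⊕ Fin m)) * d + 1 with hK
    have hK0 : 0 < K := by positivity
    obtain ⟨N, hN⟩ := hcs (ε / K) (by positivity)
    refine ⟨N, fun i hi j hj x => ?_⟩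
    rw [← hfd]
    have hw := mul_le_of_le_one_right (norm_nonneg (u i - u j)) (weight_le_one hh hh1 x)
    calc _ ≤ _ := (hdiff i j m l r).opNorm_fderiv_le x
      _ ≤ K * (ε / K) := by
        refine mul_le_mul (by rw [hK]; linarith) (hw.trans (hN i hi j hj))
          ((hdiff i j m l r).nonneg x) hK0.le
      _ = ε := by field_simp
  have hC1 := fun m l r => contDiff_one_of_tendsto (f := fun i => joint (u i).fn m l r)
    (fun i => ((u i).c1Bound m l r).contDiff) (hDc m l r) (hνj m l r)
  have hcd : ∀ m l r, ContDiff ℝ 1 (joint ν m l r) := fun m l r => (hC1 m l r).1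
  obtain ⟨N₁, hN₁⟩ := hcs 1 one_pos
  have hvan : ∀ m Q₁ Q₂ k, ¬(m < Q₁.card ∧ Q₂.card + m = n) → ν m Q₁ Q₂ k = 0 := by
    intro m Q₁ Q₂ k hs
    refine tendsto_nhds_unique (hν m Q₁ Q₂ k) ?_
    simp only [fun i => (u i).eq_zero hs k]
    exact tendsto_const_nhds
  have hdν : ∀ i m l r x, fderiv ℝ (fun x => joint (u i).fn m l r x - joint ν m l r x) x
      = fderiv ℝ (joint (u i).fn m l r) x - fderiv ℝ (joint ν m l r) x := fun i m l r x =>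
    ((((u i).c1Bound m l r).hasFDerivAt x).sub
      ((hcd m l r).differentiable one_ne_zero x).hasFDerivAt).fderiv
  have hclose : ∀ (ε : ℝ) (N : ℕ), (∀ i ≥ N, ∀ j ≥ N, ‖u i - u j‖ ≤ ε) → ∀ i ≥ N, ∀ m l r,
      C1Bound (weight h) (fun x => joint (u i).fn m l r x - joint ν m l r x) ε := by
    intro ε N hN i hi m l r
    refine ⟨((u i).c1Bound m l r).contDiff.sub (hcd m l r), fun x => ?_, fun x j c => ?_⟩
    · refine le_of_tendsto ((hνj m l r x).const_sub _).norm ?_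
      filter_upwards [eventually_ge_atTop N] with j hj
      exact ((hdiff i j m l r).norm_le x).trans
        (mul_le_mul_of_nonneg_right (hN i hi j hj) (weight_nonneg hh x))
    · rw [hdν, sub_apply]
      have ht := ((hC1 m l r).2 x (Pi.single j (EuclideanSpace.single c 1))).const_sub
        (fderiv ℝ (joint (u i).fn m l r) x (Pi.single j (EuclideanSpace.single c 1)))
      refine le_of_tendsto ht.norm ?_
      filter_upwards [eventually_ge_atTop N] with j' hj'
      change ‖(fderiv ℝ (joint (u i).fn m l r) x - fderiv ℝ (joint (u j').fn m l r) x)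
        (Pi.single j (EuclideanSpace.single c 1))‖ ≤ _
      rw [← hfd]
      exact ((hdiff i j' m l r).norm_fderiv_le x j c).trans
        (mul_le_mul_of_nonneg_right (hN i hi j' hj') (weight_nonneg hh x))
  have hνb : ∀ m l r, C1Bound (weight h) (joint ν m l r) (‖u N₁‖ + 1) := by
    intro m l r
    have h1 := ((u N₁).c1Bound m l r).add
      ((hclose 1 N₁ hN₁ N₁ le_rfl m l r).const_smul (-1))
    have e : joint ν m l r = fun x => joint (u N₁).fn m l r x
        + (-1 : ℂ) • (joint (u N₁).fn m l r x - joint ν m l r x) := by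
      funext x
      module
    rw [e]
    simpa only [norm_neg, norm_one, one_mul] using h1
  obtain ⟨μ, hμ, -⟩ := exists_of_c1Bound (n := n) hh (by positivity) hvan
    fun m l r _ _ => hνb m l r
  refine ⟨μ, Metric.tendsto_atTop.2 fun ε hε => ?_⟩
  obtain ⟨N, hN⟩ := hcs (ε / 2) (by positivity)
  refine ⟨N, fun i hi => ?_⟩
  rw [dist_eq_norm]
  refine lt_of_le_of_lt (norm_le (M := ε / 2) (by positivity) fun m l r x => ?_) (by linarith)
  rw [fn_sub, hμ]
  exact ⟨(hclose _ N hN i hi m l r).norm_le x, (hclose _ N hN i hi m l r).norm_fderiv_le x⟩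

end CoeffSpace

end CoefficientSpace

/-! ### The free resolvent acting on coefficient functions -/

/-- The general `smul_zero`, for which the action of `ℂ` on `M2` is not found by unification. -/
theorem M2.smul_zero (a : ℂ) : a • (0 : M2) = 0 := by
  ext v
  simp

namespace Model

variable {d : ℕ} (S : Model d)

theorem h_nonneg (q : E d) : 0 ≤ S.h q := (S.h_pos q).le

theorem omega_add_le {J : Type} [Fintype J] [DecidableEq J] (y : J → E d) (j : J) :
    S.ω (y j) + (Fintype.card J - 1) * S.kappa ≤ ∑ i, S.ω (y i) := by
  rw [← Finset.add_sum_erase _ _ (Finset.mem_univ j)]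
  have h1 : ((Finset.univ.erase j).card : ℝ) * S.kappa ≤ ∑ i ∈ Finset.univ.erase j, S.ω (y i) := by
    rw [← nsmul_eq_mul]
    exact Finset.card_nsmul_le_sum _ _ _ fun i _ => S.ω_min _
  rw [Finset.card_erase_of_mem (Finset.mem_univ j), Finset.card_univ,
    Nat.cast_pred (Fintype.card_pos_iff.2 ⟨j⟩)] at h1
  linarith

/-- The derivative of the free resolvent with respect to one momentum is, like the free resolvent
itself, bounded by the inverse of the gap, because `∂ω` is dominated by `ω`. -/
theorem freeRes_conf_contDiff {η₀ : ℝ} (hη₀ : 0 < η₀) {Cω : ℝ} (hC0 : 0 ≤ Cω)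
    (hC : ∀ q, ‖fderiv ℝ S.ω q‖ ≤ Cω * S.ω q) {n : ℕ} {η : ℝ} (hη : η₀ ≤ η) {z : ℂ}
    (hz : z ∈ S.halfPlane n η) {ι J : Type} [Fintype ι] [DecidableEq ι] [Fintype J]
    [DecidableEq J] (ρ : J → ι) (hρ : Function.Injective ρ) (hJ : n < Fintype.card J) :
    ContDiff ℝ 1 (fun x : ι → E d => S.freeRes z (conf fun j => x (ρ j))) ∧
      ∀ (x : ι → E d) (i : ι) (c : Fin d),
        ‖fderiv ℝ (fun x : ι → E d => S.freeRes z (conf fun j => x (ρ j))) x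
          (Pi.single i (EuclideanSpace.single c 1))‖
            ≤ projNorm * (Cω * (1 + S.kappa / η₀))
              / (η + (Fintype.card J - (n + 1)) * S.kappa) := by
  have hκ := S.kappa_pos
  have hηp : 0 < η := hη₀.trans_le hη
  set Ω : (ι → E d) → ℝ := fun x => ∑ j, S.ω (x (ρ j)) with hΩ
  have hcard : ∀ x : ι → E d, n < (conf fun j => x (ρ j)).card := fun x => by
    rwa [card_conf]
  have hgap : ∀ x, 0 < Ω x - S.ε - z.re := fun x => by
    have := S.gap_pos hηp hz (hcard x)
    rwa [omegaConf_conf] at this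
  have hgap' : ∀ x, η + (Fintype.card J - (n + 1)) * S.kappa ≤ Ω x - S.ε - z.re := fun x => by
    have := (S.gap_lt hz (conf fun j => x (ρ j))).le
    rwa [omegaConf_conf, card_conf] at this
  have hJ' : (n : ℝ) + 1 ≤ Fintype.card J := by exact_mod_cast hJ
  have hD : 0 < η + (Fintype.card J - (n + 1)) * S.kappa := by
    have : 0 ≤ (Fintype.card J - ((n : ℝ) + 1)) * S.kappa :=
      mul_nonneg (by linarith) hκ.le
    linarith
  have hfun : (fun x : ι → E d => S.freeRes z (conf fun j => x (ρ j)))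
      = fun x => S.resAt z (Ω x) := by
    funext x
    rw [S.freeRes_eq, omegaConf_conf]
    rw [omegaConf_conf]
    exact hgap x
  have hΩd : ∀ x, HasFDerivAt Ω
      (∑ j, (fderiv ℝ S.ω (x (ρ j))).comp (ContinuousLinearMap.proj (ρ j))) x := by
    intro x
    refine HasFDerivAt.fun_sum fun j _ => ?_
    exact ((S.ω_contDiff.differentiable one_ne_zero (x (ρ j))).hasFDerivAt).comp x
      (hasFDerivAt_apply (ρ j) x)
  have hΩc : ContDiff ℝ 1 Ω :=
    ContDiff.sum fun j _ => S.ω_contDiff.comp (contDiff_apply _ _ (ρ j))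
  rw [hfun]
  have hcast : ContDiff ℝ 1 fun x => ((Ω x : ℝ) : ℂ) := Complex.ofRealCLM.contDiff.comp hΩc
  refine ⟨?_, fun x i c => ?_⟩
  · unfold resAt
    refine ContDiff.add (ContDiff.smul (ContDiff.inv ?_ fun x => up_ne_zero (hgap x))
      contDiff_const) (ContDiff.smul (ContDiff.inv ?_ fun x => down_ne_zero (hgap x))
      contDiff_const)
    · exact (hcast.add contDiff_const).sub contDiff_const
    · exact (hcast.sub contDiff_const).sub contDiff_const
  · have hcomp := ((S.hasDerivAt_resAt (hgap x)).hasFDerivAt).comp x (hΩd x)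
    have hcomp' : HasFDerivAt (fun x => S.resAt z (Ω x)) _ x := hcomp
    rw [hcomp'.fderiv]
    set e : ι → E d := Pi.single i (EuclideanSpace.single c (1 : ℝ)) with he
    have hval : ‖(∑ j, (fderiv ℝ S.ω (x (ρ j))).comp
        (ContinuousLinearMap.proj (ρ j) : (ι → E d) →L[ℝ] E d)) e‖
          ≤ Cω * (1 + S.kappa / η₀) * (Ω x - S.ε - z.re) := by
      have h0 : 0 ≤ Cω * (1 + S.kappa / η₀) * (Ω x - S.ε - z.re) :=
        mul_nonneg (by positivity) (hgap x).le
      have hs : (∑ j, (fderiv ℝ S.ω (x (ρ j))).comp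
          (ContinuousLinearMap.proj (ρ j) : (ι → E d) →L[ℝ] E d)) e
            = ∑ j, fderiv ℝ S.ω (x (ρ j)) (e (ρ j)) := by
        simp
      rw [hs]
      by_cases hi : ∃ j, ρ j = i
      · obtain ⟨j, hj⟩ := hi
        rw [Finset.sum_eq_single j]
        · have hej : e (ρ j) = EuclideanSpace.single c 1 := by rw [he, hj, Pi.single_eq_same]
          rw [hej]
          have h1 : ‖fderiv ℝ S.ω (x (ρ j)) (EuclideanSpace.single c 1)‖ ≤ Cω * S.ω (x (ρ j)) := by
            refine ((fderiv ℝ S.ω (x (ρ j))).le_opNorm _).trans ?_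
            simpa using hC (x (ρ j))
          refine h1.trans ?_
          rw [mul_assoc]
          refine mul_le_mul_of_nonneg_left ?_ hC0
          have h2 := S.omega_add_le (fun j => x (ρ j)) j
          have h3 : z.re < -S.ε + (n + 1) * S.kappa - η := hz
          have h4 : S.ω (x (ρ j)) - S.kappa + η ≤ Ω x - S.ε - z.re := by
            have h5 := mul_nonneg (sub_nonneg.2 hJ') hκ.le
            nlinarith
          have h6 : S.kappa ≤ S.ω (x (ρ j)) := S.ω_min _
          calc S.ω (x (ρ j)) = (S.ω (x (ρ j)) - S.kappa) + S.kappa / η₀ * η₀ := by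
                field_simp
                ring
            _ ≤ (1 + S.kappa / η₀) * (S.ω (x (ρ j)) - S.kappa + η) := by
                have h7 : S.kappa / η₀ * η₀ ≤ S.kappa / η₀ * (S.ω (x (ρ j)) - S.kappa + η) :=
                  mul_le_mul_of_nonneg_left (by linarith) (by positivity)
                linarith
            _ ≤ _ := mul_le_mul_of_nonneg_left h4 (by positivity)
        · intro j' _ hne
          have : e (ρ j') = 0 := by
            rw [he]
            refine Pi.single_eq_of_ne (fun h => hne (hρ (h.trans hj.symm))) _
          rw [this, map_zero]
        · exact fun h => absurd (Finset.mem_univ _) h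
      · rw [Finset.sum_eq_zero]
        · simpa using h0
        · intro j _
          have : e (ρ j) = 0 := by
            rw [he]
            refine Pi.single_eq_of_ne (fun h => hi ⟨j, h⟩) _
          rw [this, map_zero]
    rw [ContinuousLinearMap.comp_apply, ContinuousLinearMap.toSpanSingleton_apply, norm_smul]
    calc _ ≤ (Cω * (1 + S.kappa / η₀) * (Ω x - S.ε - z.re))
          * (projNorm / (Ω x - S.ε - z.re) ^ 2) :=
          mul_le_mul hval (S.norm_deriv_resAt_le (hgap x)) (norm_nonneg _)
            ((norm_nonneg _).trans hval)
      _ = projNorm * (Cω * (1 + S.kappa / η₀)) / (Ω x - S.ε - z.re) := by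
          have := (hgap x).ne'
          field_simp
      _ ≤ _ := by
          have := projNorm_nonneg
          exact div_le_div_of_nonneg_left (by positivity) hD (hgap' x)

/-- Multiplication of the coefficient functions by `s(|Q₁|) (ε σ₃ + ω(Q₁ ∪ Q₂) - z)⁻¹`. -/
noncomputable def resMul (s : ℕ → ℝ) (n : ℕ) (z : ℂ) (μ : Coeff d) : Coeff d :=
  fun m Q₁ Q₂ k =>
    if m < Q₁.card ∧ Q₂.card + m = n then
      ((s Q₁.card : ℝ) : ℂ) • (S.freeRes z (Q₁ + Q₂) * μ m Q₁ Q₂ k)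
    else 0

/-- The factor `s(|Q₁|)` is admissible as long as it grows no faster than the energy gap. -/
theorem exists_resMul_clm {η₀ : ℝ} (hη₀ : 0 < η₀) : ∃ b : ℝ, 0 ≤ b ∧
    ∀ η, η₀ ≤ η → ∀ (n : ℕ) (s : ℕ → ℝ) (a : ℝ), (∀ l, 0 ≤ s l) →
      (∀ m l r : ℕ, m < l → r + m = n → s l ≤ a * (η + (l + r - (n + 1)) * S.kappa)) →
      ∀ z ∈ S.halfPlane n η, ∃ L : CoeffSpace S.h n →L[ℂ] CoeffSpace S.h n,
        ‖L‖ ≤ b * a ∧ ∀ μ, (L μ).fn = S.resMul s n z μ.fn := by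
  obtain ⟨Cω, hC0, hC⟩ := S.exists_fderiv_ω_le
  have hκ := S.kappa_pos
  have hpn := projNorm_nonneg
  refine ⟨projNorm + projNorm * (Cω * (1 + S.kappa / η₀)), by positivity,
    fun η hη n s a hs hsa z hz => ?_⟩
  have hηp : 0 < η := hη₀.trans_le hη
  have hgapη : ∀ m l r : ℕ, m < l → r + m = n →
      0 < η + (l + r - (n + 1)) * S.kappa := by
    intro m l r hml hr
    have h2 : ((n : ℝ) + 1) ≤ l + r := by exact_mod_cast (by omega : n + 1 ≤ l + r)
    have := mul_nonneg (sub_nonneg.2 h2) hκ.le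
    linarith
  have ha : 0 ≤ a := by
    have h1 := hsa 0 1 n one_pos rfl
    have h2 := hgapη 0 1 n one_pos rfl
    exact nonneg_of_mul_nonneg_left ((hs 1).trans h1) h2
  refine CoeffSpace.exists_clm S.h_nonneg (S.resMul s n z) (by positivity) ?_ ?_ ?_ ?_
  · intro μ ν
    funext m Q₁ Q₂ k
    simp only [resMul, Pi.add_apply, mul_add, smul_add]
    split_ifs
    · rfl
    · simp
  · intro c μ
    funext m Q₁ Q₂ k
    simp only [resMul, Pi.smul_apply]
    split_ifs
    · exact (congrArg _ (mul_smul_comm _ _ _)).trans (smul_comm _ _ _)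
    · exact (M2.smul_zero _).symm
  · intro μ m Q₁ Q₂ k hv
    exact if_neg hv
  · intro μ m l r hml hr
    obtain ⟨h1, h2⟩ := S.freeRes_conf_contDiff hη₀ hC0 hC hη hz
      (Sum.elim Sum.inl (fun j => Sum.inr (Sum.inl j)) : Fin l ⊕ Fin r → Fin l ⊕ (Fin r ⊕ Fin m))
      (by
        rintro (i | i) (j | j) hij
        all_goals simp at hij
        all_goals rw [hij])
      (by simp; omega)
    have hg := hgapη m l r hml hr
    have hj : joint (S.resMul s n z μ.fn) m l r = fun x => ((s l : ℝ) : ℂ) •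
        (S.freeRes z (conf fun j => x ((Sum.elim Sum.inl (fun j => Sum.inr (Sum.inl j)) :
          Fin l ⊕ Fin r → Fin l ⊕ (Fin r ⊕ Fin m)) j)) * joint μ.fn m l r x) := by
      funext x
      rw [conf_sumElim]
      simp only [joint, resMul, card_conf, Fintype.card_fin, Sum.elim_inl, Sum.elim_inr]
      rw [if_pos ⟨hml, hr⟩]
    rw [hj]
    have hcard : ((Fintype.card (Fin l ⊕ Fin r) : ℕ) : ℝ) = l + r := by simp
    rw [hcard] at h2
    have h3 := ((μ.c1Bound m l r).mul_left h1 (a := projNorm / (η + (l + r - (n + 1)) * S.kappa))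
      (fun x => ?_) h2 (by positivity)).const_smul ((s l : ℝ) : ℂ)
    · refine h3.mono (fun x => weight_nonneg S.h_nonneg x) ?_
      rw [Complex.norm_real, Real.norm_of_nonneg (hs l), ← mul_assoc]
      refine mul_le_mul_of_nonneg_right ?_ (norm_nonneg μ)
      rw [← add_div, mul_div_assoc', div_le_iff₀ hg, mul_assoc, mul_comm]
      exact mul_le_mul_of_nonneg_left (hsa m l r hml hr) (by positivity)
    · have hc : n < (conf fun j => x ((Sum.elim Sum.inl (fun j => Sum.inr (Sum.inl j)) :
          Fin l ⊕ Fin r → Fin l ⊕ (Fin r ⊕ Fin m)) j)).card := by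
        rw [card_conf]
        simp
        omega
      refine (S.norm_freeRes_le (S.gap_pos hηp hz hc)).trans ?_
      have h4 := (S.gap_lt hz _ : _ < S.omegaConf (conf fun j => x ((Sum.elim Sum.inl
        (fun j => Sum.inr (Sum.inl j)) : Fin l ⊕ Fin r → Fin l ⊕ (Fin r ⊕ Fin m)) j)) - S.ε - z.re)
      rw [card_conf, hcard] at h4
      exact div_le_div_of_nonneg_left hpn hg h4.le

theorem _root_.SpinBoson.smul_mul_sub_smul_mul {R : Type*} [Ring R] [Algebra ℂ R] (a : ℂ)
    {c : ℂ} {x y : R} (v : R) (hxy : x - y = c • (x * y)) :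
    a • (x * v) - a • (y * v) = c • (((1 : ℝ) : ℂ) • (x * (a • (y * v)))) := by
  rw [← smul_sub, ← sub_mul, hxy, Complex.ofReal_one, one_smul, smul_mul_assoc, mul_smul_comm,
    mul_assoc, smul_comm]

/-- The first resolvent identity for the multiplication operators. -/
theorem resMul_sub_resMul {n : ℕ} {η : ℝ} (hη : 0 < η) {z w : ℂ} (hz : z ∈ S.halfPlane n η)
    (hw : w ∈ S.halfPlane n η) (s : ℕ → ℝ) (μ : Coeff d) :
    S.resMul s n z μ - S.resMul s n w μ
      = (z - w) • S.resMul (fun _ => 1) n z (S.resMul s n w μ) := by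
  funext m Q₁ Q₂ k
  simp only [resMul, Pi.sub_apply, Pi.smul_apply]
  split_ifs with hs
  · have hc : n < (Q₁ + Q₂).card := by
      rw [Multiset.card_add]
      omega
    exact smul_mul_sub_smul_mul _ _
      (S.freeRes_sub_freeRes (S.gap_pos hη hz hc) (S.gap_pos hη hw hc))
  · exact (sub_zero _).trans (M2.smul_zero _).symm

end Model

/-! ### The operator `Γ(z)` -/

/-- The general `smul_comm`, for which the action of `ℂ` on `M2` is not found by unification. -/
theorem M2.smul_comm (a b : ℂ) (x : M2) : a • b • x = b • a • x := SMulCommClass.smul_comm a b x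

namespace Model

variable {d : ℕ} (S : Model d)

theorem continuous_conj_lam : Continuous fun q => conj (S.lam q) :=
  Complex.continuous_conj.comp S.lam_contDiff.continuous

theorem norm_conj_lam_le (q : E d) : ‖conj (S.lam q)‖ ≤ S.h q := by
  rw [RCLike.norm_conj]
  exact S.lam_le q

theorem integrable_h_sq : Integrable (fun q => S.h q ^ 2) volume :=
  S.h_memLp.integrable_sq

/-- The creation, annihilation and lowering parts of `Γ(z)`, before multiplication by the free
resolvent: the sum of
`λ(q) μ^{(m)}(Q₁ \ q; Q₂; k)` over `q ∈ Q₁`, the integral of `conj λ(q') μ^{(m)}(Q₁ ∪ q'; Q₂; k)`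
and `lowerTerm`. -/
noncomputable def bracket (μ : Coeff d) (m : ℕ) (Q₁ Q₂ : Conf d) (k : Fin m → E d) : M2 :=
  (Q₁.map fun q => S.lam q • μ m (Q₁.erase q) Q₂ k).sum
    + (∫ q' : E d, conj (S.lam q') • μ m (q' ::ₘ Q₁) Q₂ k)
    + S.lowerTerm μ Q₁ Q₂ m k

/-- `Γ(z)` without the coupling constant and the free resolvent, divided by the number of points
of `Q₁`.  This division makes it a bounded operator. -/
noncomputable def core (n : ℕ) (μ : Coeff d) : Coeff d := fun m Q₁ Q₂ k =>
  if m < Q₁.card ∧ Q₂.card + m = n then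
    (Q₁.card : ℂ)⁻¹ • (σ₁ * S.bracket μ m Q₁ Q₂ k)
  else 0

/-- `μ̂_n(z)` without the coupling constant and the free resolvent. -/
noncomputable def coreHat (n : ℕ) : Coeff d := fun m Q₁ Q₂ _ =>
  if m = 0 ∧ Q₁.card = 1 ∧ Q₂.card = n then (Q₁.map S.lam).sum • σ₁ else 0

theorem _root_.SpinBoson.smul_mul_inv_smul {R : Type*} [Ring R] [Algebra ℂ R] (a : ℂ) {l : ℝ}
    (hl : l ≠ 0) (x y v : R) :
    a • (x * y * v) = a • ((l : ℂ) • (x * ((l : ℂ)⁻¹ • (y * v)))) := by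
  rw [mul_smul_comm, smul_smul (l : ℂ), mul_inv_cancel₀ (Complex.ofReal_ne_zero.2 hl), one_smul,
    mul_assoc]

theorem Gam_eq (α : ℝ) (n : ℕ) (z : ℂ) (μ : Coeff d) :
    S.Gam α n z μ = (α : ℂ) • S.resMul (fun l => l) n z (S.core n μ) := by
  funext m Q₁ Q₂ k
  simp only [Gam, resMul, core, Pi.smul_apply]
  split_ifs with hs
  · have := smul_mul_inv_smul (R := M2) (α : ℂ) (l := (Q₁.card : ℝ))
      (Nat.cast_ne_zero.2 (by omega)) (S.freeRes z (Q₁ + Q₂)) σ₁ (S.bracket μ m Q₁ Q₂ k)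
    rw [Complex.ofReal_natCast] at this ⊢
    exact this
  · exact (M2.smul_zero _).symm

theorem _root_.SpinBoson.smul_smul_mul {R : Type*} [Ring R] [Algebra ℂ R] (a b : ℂ) (x y : R) :
    a • (b • (x * y)) = a • (((1 : ℝ) : ℂ) • (x * (b • y))) := by
  rw [Complex.ofReal_one, one_smul, mul_smul_comm]

theorem muHat_eq (α : ℝ) (n : ℕ) (z : ℂ) :
    S.muHat α n z = (α : ℂ) • S.resMul (fun _ => 1) n z (S.coreHat n) := by
  funext m Q₁ Q₂ k
  simp only [muHat, resMul, coreHat, Pi.smul_apply]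
  split_ifs with h1 h2 h3
  · rw [add_comm Q₁ Q₂]
    exact smul_smul_mul _ _ _ _
  · omega
  · refine (congrArg _ ?_ : (α : ℂ) • (0 : M2) = _) |>.symm.trans (M2.smul_zero _) |>.symm
    rw [mul_zero]
    exact (M2.smul_zero _).symm
  · exact (M2.smul_zero _).symm

theorem _root_.SpinBoson.CoeffSpace.continuous_cons (μ : CoeffSpace S.h n) (m : ℕ)
    (Q₁ Q₂ : Conf d) (k : Fin m → E d) : Continuous fun q => μ.fn m (q ::ₘ Q₁) Q₂ k := by
  obtain ⟨a, ha⟩ := exists_conf_eq Q₁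
  obtain ⟨b, hb⟩ := exists_conf_eq Q₂
  have h1 : (fun q => μ.fn m (q ::ₘ Q₁) Q₂ k) = fun q => joint μ.fn m (Q₁.card + 1) Q₂.card
      (Sum.elim (Fin.cons q a) (Sum.elim b k)) := by
    funext q
    simp only [joint, Sum.elim_inl, Sum.elim_inr]
    rw [conf_cons, ha, hb]
  rw [h1]
  refine (μ.c1Bound _ _ _).contDiff.continuous.comp (continuous_pi fun i => ?_)
  rcases i with i | i
  · exact (continuous_apply i).comp (Continuous.finCons continuous_id continuous_const)
  · exact continuous_const

theorem norm_prod_le_one {m : ℕ} (Q₁ : Conf d) (k : Fin m → E d) :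
    (Q₁.map S.h).prod * ∏ i, S.h (k i) ≤ 1 ∧ 0 ≤ (Q₁.map S.h).prod * ∏ i, S.h (k i) := by
  obtain ⟨x, -, hx⟩ := exists_joint_eq (h := S.h) m Q₁ 0 k
  rw [← hx]
  exact ⟨weight_le_one S.h_nonneg S.h_le_one x, weight_nonneg S.h_nonneg x⟩

theorem integrable_conj_lam_smul {n : ℕ} (μ : CoeffSpace S.h n) (m : ℕ) (Q₁ Q₂ : Conf d)
    (k : Fin m → E d) : Integrable (fun q => conj (S.lam q) • μ.fn m (q ::ₘ Q₁) Q₂ k) volume := by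
  refine (S.integrable_h_sq.const_mul ‖μ‖).mono'
    (S.continuous_conj_lam.smul (CoeffSpace.continuous_cons S μ m Q₁ Q₂ k)).aestronglyMeasurable
    (Eventually.of_forall fun q => ?_)
  rw [norm_smul]
  have h1 := μ.norm_fn_le m (q ::ₘ Q₁) Q₂ k
  rw [Multiset.map_cons, Multiset.prod_cons, mul_assoc] at h1
  have h2 := S.norm_prod_le_one Q₁ k
  have h3 := S.h_nonneg q
  have h4 : ‖μ.fn m (q ::ₘ Q₁) Q₂ k‖ ≤ ‖μ‖ * S.h q :=
    h1.trans (mul_le_mul_of_nonneg_left (mul_le_of_le_one_right h3 h2.1) (norm_nonneg μ))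
  calc _ ≤ S.h q * (‖μ‖ * S.h q) :=
        mul_le_mul (S.norm_conj_lam_le q) h4 (norm_nonneg _) h3
    _ = _ := by ring

theorem bracket_add {n : ℕ} (μ ν : CoeffSpace S.h n) (m : ℕ) (Q₁ Q₂ : Conf d)
    (k : Fin m → E d) : S.bracket (μ.fn + ν.fn) m Q₁ Q₂ k
      = S.bracket μ.fn m Q₁ Q₂ k + S.bracket ν.fn m Q₁ Q₂ k := by
  have h1 : S.lowerTerm (μ.fn + ν.fn) Q₁ Q₂ m k
      = S.lowerTerm μ.fn Q₁ Q₂ m k + S.lowerTerm ν.fn Q₁ Q₂ m k := by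
    cases m with
    | zero => exact (add_zero _).symm
    | succ m => exact smul_add _ _ _
  have h2 : ∫ q' : E d, conj (S.lam q') • (μ.fn + ν.fn) m (q' ::ₘ Q₁) Q₂ k
      = (∫ q' : E d, conj (S.lam q') • μ.fn m (q' ::ₘ Q₁) Q₂ k)
        + ∫ q' : E d, conj (S.lam q') • ν.fn m (q' ::ₘ Q₁) Q₂ k := by
    rw [← integral_add (S.integrable_conj_lam_smul μ m Q₁ Q₂ k)
      (S.integrable_conj_lam_smul ν m Q₁ Q₂ k)]
    exact integral_congr_ae (Eventually.of_forall fun q => smul_add _ _ _)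
  have h3 : (Q₁.map fun q => S.lam q • (μ.fn + ν.fn) m (Q₁.erase q) Q₂ k).sum
      = (Q₁.map fun q => S.lam q • μ.fn m (Q₁.erase q) Q₂ k).sum
        + (Q₁.map fun q => S.lam q • ν.fn m (Q₁.erase q) Q₂ k).sum := by
    rw [← Multiset.sum_map_add]
    exact congrArg _ (Multiset.map_congr rfl fun q _ => smul_add _ _ _)
  unfold bracket
  rw [h1, h2, h3]
  abel

theorem bracket_smul (a : ℂ) (μ : Coeff d) (m : ℕ) (Q₁ Q₂ : Conf d)
    (k : Fin m → E d) : S.bracket (a • μ) m Q₁ Q₂ k = a • S.bracket μ m Q₁ Q₂ k := by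
  have h1 : S.lowerTerm (a • μ) Q₁ Q₂ m k = a • S.lowerTerm μ Q₁ Q₂ m k := by
    cases m with
    | zero => exact (M2.smul_zero a).symm
    | succ m => exact M2.smul_comm _ _ _
  have h2 : ∫ q' : E d, conj (S.lam q') • (a • μ) m (q' ::ₘ Q₁) Q₂ k
      = a • ∫ q' : E d, conj (S.lam q') • μ m (q' ::ₘ Q₁) Q₂ k := by
    refine Eq.trans ?_ (integral_smul a _)
    exact integral_congr_ae (Eventually.of_forall fun q => M2.smul_comm _ _ _)
  have h3 : (Q₁.map fun q => S.lam q • (a • μ) m (Q₁.erase q) Q₂ k).sum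
      = a • (Q₁.map fun q => S.lam q • μ m (Q₁.erase q) Q₂ k).sum := by
    rw [Multiset.smul_sum, Multiset.map_map]
    exact congrArg _ (Multiset.map_congr rfl fun q _ => M2.smul_comm _ _ _)
  unfold bracket
  rw [h1, h2, h3]
  module

theorem fderiv_lam_apply_le {C : ℝ} (hC : ∀ q, ‖fderiv ℝ S.lam q‖ ≤ C * S.h q) (q v : E d) :
    ‖fderiv ℝ S.lam q v‖ ≤ C * S.h q * ‖v‖ :=
  ((fderiv ℝ S.lam q).le_opNorm v).trans (mul_le_mul_of_nonneg_right (hC q) (norm_nonneg v))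

theorem contDiff_conj_lam : ContDiff ℝ 1 fun q => conj (S.lam q) :=
  Complex.conjCLE.contDiff.comp S.lam_contDiff

theorem fderiv_conj_lam_apply_le {C : ℝ} (hC : ∀ q, ‖fderiv ℝ S.lam q‖ ≤ C * S.h q)
    (q v : E d) : ‖fderiv ℝ (fun q => conj (S.lam q)) q v‖ ≤ C * S.h q * ‖v‖ := by
  have h1 : HasFDerivAt (fun q => conj (S.lam q)) _ q :=
    Complex.conjCLE.hasFDerivAt.comp q
      (S.lam_contDiff.differentiable one_ne_zero q).hasFDerivAt
  rw [h1.fderiv]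
  refine le_trans (le_of_eq ?_) (S.fderiv_lam_apply_le hC q v)
  exact RCLike.norm_conj (fderiv ℝ S.lam q v)

/-- The creation part: each of the `|Q₁|` summands is bounded. -/
theorem c1Bound_create {C : ℝ} (hC0 : 0 ≤ C) (hC : ∀ q, ‖fderiv ℝ S.lam q‖ ≤ C * S.h q) {n : ℕ}
    (μ : CoeffSpace S.h n) (m l r : ℕ) :
    C1Bound (weight S.h) (fun x : Fin (l + 1) ⊕ (Fin r ⊕ Fin m) → E d =>
        ∑ i : Fin (l + 1), S.lam (x (Sum.inl i)) • joint μ.fn m l r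
          (Sum.elim (fun j => x (Sum.inl (i.succAbove j))) (fun j => x (Sum.inr j))))
      (((l + 1 : ℕ) : ℝ) * ((1 + C) * ‖μ‖)) := by
  have h1 : ∀ i : Fin (l + 1), C1Bound (weight S.h)
      (fun x : Fin (l + 1) ⊕ (Fin r ⊕ Fin m) → E d =>
        S.lam (x (Sum.inl i)) • joint μ.fn m l r
          (Sum.elim (fun j => x (Sum.inl (i.succAbove j))) (fun j => x (Sum.inr j))))
      ((1 + C) * ‖μ‖) := by
    intro i
    have hp : IsSubst (d := d) (ι := Fin (l + 1) ⊕ (Fin r ⊕ Fin m))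
        (ι' := Fin l ⊕ (Fin r ⊕ Fin m))
        (Sum.elim (fun j => some (Sum.inl (i.succAbove j))) (fun j => some (Sum.inr j)))
        (fun x => Sum.elim (fun j => x (Sum.inl (i.succAbove j))) (fun j => x (Sum.inr j))) := by
      refine ⟨?_, ?_, ?_⟩
      · rintro (j | j) i' h x <;> simp at h <;> simp [← h]
      · rintro (j | j) h <;> simp at h
      · rintro i' (j | j) (j' | j') h h' <;> simp at h h' <;> rw [← h] at h' <;>
          simp at h' <;> rw [h']
    have h2 := C1Bound.form_factor_smul hC0 S.h_nonneg S.lam_contDiff S.lam_le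
      (S.fderiv_lam_apply_le hC) ((μ.c1Bound m l r).comp_subst hp) (Sum.inl i)
    have hw : (fun x : Fin (l + 1) ⊕ (Fin r ⊕ Fin m) → E d => S.h (x (Sum.inl i)) *
        weight S.h (Sum.elim (fun j => x (Sum.inl (i.succAbove j))) (fun j => x (Sum.inr j)) :
          Fin l ⊕ (Fin r ⊕ Fin m) → E d)) = weight S.h := by
      funext x
      simp only [weight, Sum.elim_inl, Sum.elim_inr]
      rw [Fin.prod_univ_succAbove _ i, mul_assoc]
    rwa [hw] at h2
  have h3 := C1Bound.sum Finset.univ fun i _ => h1 i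
  rwa [Finset.card_univ, Fintype.card_fin] at h3

/-- The annihilation part: two factors `h(q')`, one from `λ` and one from the weight of `μ`, make
the integral converge. -/
theorem c1Bound_annihilate {n : ℕ} (μ : CoeffSpace S.h n) (m l r : ℕ) :
    C1Bound (weight S.h) (fun x : Fin l ⊕ (Fin r ⊕ Fin m) → E d =>
        ∫ q, conj (S.lam q) • joint μ.fn m (l + 1) r
          (Sum.elim (Fin.cons q (fun j => x (Sum.inl j))) (fun j => x (Sum.inr j))))
      ((∫ q, S.h q ^ 2) * ‖μ‖) := by
  refine C1Bound.integral_subst (ι := Fin l ⊕ (Fin r ⊕ Fin m))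
    (ι' := Fin (l + 1) ⊕ (Fin r ⊕ Fin m))
    (σ := Sum.elim (Fin.cons none (fun j => some (Sum.inl j))) (fun j => some (Sum.inr j)))
    (p := fun q x => Sum.elim (Fin.cons q (fun j => x (Sum.inl j))) (fun j => x (Sum.inr j)))
    S.h_nonneg S.continuous_conj_lam S.norm_conj_lam_le
    S.integrable_h_sq (μ.c1Bound m (l + 1) r) ?_ ?_ ?_
    (fun x => weight_nonneg S.h_nonneg x) (fun x => weight_le_one S.h_nonneg S.h_le_one x)
    (norm_nonneg μ)
  · intro q
    refine ⟨?_, ?_, ?_⟩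
    · rintro (j | j) i h x
      · induction j using Fin.cases <;> simp at h
        simp [← h]
      · simp at h
        simp [← h]
    · rintro (j | j) h x y
      · induction j using Fin.cases <;> simp at h
        rfl
      · simp at h
    · rintro i (j | j) (j' | j') h h'
      · induction j using Fin.cases <;> simp at h
        induction j' using Fin.cases <;> simp at h'
        rw [← h] at h'
        simp at h'
        rw [h']
      · induction j using Fin.cases <;> simp at h h'
        rw [← h] at h'
        simp at h'
      · induction j' using Fin.cases <;> simp at h h'
        rw [← h] at h'
        simp at h'
      · simp at h h'
        rw [← h] at h'
        simp at h'
        rw [h']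
  · intro x
    refine continuous_pi fun i => ?_
    rcases i with i | i
    · exact (continuous_apply i).comp (Continuous.finCons continuous_id continuous_const)
    · exact continuous_const
  · intro q x
    simp only [weight, Sum.elim_inl, Sum.elim_inr]
    rw [Fin.prod_univ_succ, mul_assoc]
    simp only [Fin.cons_zero, Fin.cons_succ]

/-- The lowering part: the factor `conj λ(k_m)` supplies the factor `h(k_m)` of the weight. -/
theorem c1Bound_lower {C : ℝ} (hC0 : 0 ≤ C) (hC : ∀ q, ‖fderiv ℝ S.lam q‖ ≤ C * S.h q) {n : ℕ}
    (μ : CoeffSpace S.h n) (m l r : ℕ) :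
    C1Bound (weight S.h) (fun x : Fin l ⊕ (Fin r ⊕ Fin (m + 1)) → E d =>
        conj (S.lam (x (Sum.inr (Sum.inr (Fin.last m))))) • joint μ.fn m l (r + 1)
          (Sum.elim (fun j => x (Sum.inl j)) (Sum.elim
            (Fin.cons (x (Sum.inr (Sum.inr (Fin.last m)))) (fun j => x (Sum.inr (Sum.inl j))))
            (fun i => x (Sum.inr (Sum.inr i.castSucc))))))
      ((1 + C) * ‖μ‖) := by
  have hp : IsSubst (d := d) (ι := Fin l ⊕ (Fin r ⊕ Fin (m + 1)))
      (ι' := Fin l ⊕ (Fin (r + 1) ⊕ Fin m))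
      (Sum.elim (fun j => some (Sum.inl j)) (Sum.elim
        (Fin.cons (some (Sum.inr (Sum.inr (Fin.last m))))
          (fun j => some (Sum.inr (Sum.inl j))))
        (fun i => some (Sum.inr (Sum.inr i.castSucc)))))
      (fun x => Sum.elim (fun j => x (Sum.inl j)) (Sum.elim
            (Fin.cons (x (Sum.inr (Sum.inr (Fin.last m)))) (fun j => x (Sum.inr (Sum.inl j))))
            (fun i => x (Sum.inr (Sum.inr i.castSucc))))) := by
    refine ⟨?_, ?_, ?_⟩
    · rintro (j | j | j) i h x
      · simp at h
        simp [← h]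
      · induction j using Fin.cases <;> simp at h <;> simp [← h]
      · simp at h
        simp [← h]
    · rintro (j | j | j) h
      · simp at h
      · induction j using Fin.cases <;> simp at h
      · simp at h
    · rintro i (j | j | j) (j' | j' | j') h h' <;>
        (try induction j using Fin.cases) <;> (try induction j' using Fin.cases) <;>
        simp at h h' <;> rw [← h] at h' <;> simp at h' <;>
        first
          | rfl
          | rw [h']
          | exact absurd h' (Fin.castSucc_ne_last _)
          | exact absurd h'.symm (Fin.castSucc_ne_last _)
  have h2 := C1Bound.form_factor_smul hC0 S.h_nonneg S.contDiff_conj_lam S.norm_conj_lam_le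
    (S.fderiv_conj_lam_apply_le hC) ((μ.c1Bound m l (r + 1)).comp_subst hp)
    (Sum.inr (Sum.inr (Fin.last m)))
  have hw : (fun x : Fin l ⊕ (Fin r ⊕ Fin (m + 1)) → E d =>
      S.h (x (Sum.inr (Sum.inr (Fin.last m)))) *
      weight S.h (Sum.elim (fun j => x (Sum.inl j)) (Sum.elim
            (Fin.cons (x (Sum.inr (Sum.inr (Fin.last m)))) (fun j => x (Sum.inr (Sum.inl j))))
            (fun i => x (Sum.inr (Sum.inr i.castSucc)))) :
        Fin l ⊕ (Fin (r + 1) ⊕ Fin m) → E d)) = weight S.h := by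
    funext x
    simp only [weight, Sum.elim_inl, Sum.elim_inr]
    rw [Fin.prod_univ_castSucc]
    ring
  rwa [hw] at h2

/-- Of the three parts only the creation part grows with `|Q₁|`, and it does so linearly. -/
theorem exists_core_clm : ∃ A : ℝ, 0 ≤ A ∧ ∀ n : ℕ,
    ∃ L : CoeffSpace S.h n →L[ℂ] CoeffSpace S.h n, ‖L‖ ≤ A ∧ ∀ μ, (L μ).fn = S.core n μ.fn := by
  obtain ⟨C, hC0, hC⟩ := S.fderiv_lam_le
  have hI : 0 ≤ ∫ q, S.h q ^ 2 := integral_nonneg fun q => sq_nonneg _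
  refine ⟨‖σ₁‖ * ((1 + C) + (∫ q, S.h q ^ 2) + (1 + C)), by positivity, fun n => ?_⟩
  refine CoeffSpace.exists_clm S.h_nonneg (S.core n) (by positivity) ?_ ?_ ?_ ?_
  · intro μ ν
    funext m Q₁ Q₂ k
    simp only [core, Pi.add_apply, S.bracket_add, mul_add, smul_add]
    split_ifs
    · rfl
    · simp
  · intro a μ
    funext m Q₁ Q₂ k
    simp only [core, Pi.smul_apply, S.bracket_smul]
    split_ifs
    · exact (congrArg _ (mul_smul_comm _ _ _)).trans (smul_comm _ _ _)
    · exact (M2.smul_zero _).symm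
  · intro μ m Q₁ Q₂ k hv
    exact if_neg hv
  · intro μ m l r hml hr
    obtain ⟨l, rfl⟩ : ∃ l', l = l' + 1 := ⟨l - 1, by omega⟩
    have h1 := S.c1Bound_create hC0.le hC μ m l r
    have h2 := S.c1Bound_annihilate μ m (l + 1) r
    have h3 : C1Bound (weight S.h) (fun x : Fin (l + 1) ⊕ (Fin r ⊕ Fin m) → E d =>
        S.lowerTerm μ.fn (conf fun i => x (Sum.inl i)) (conf fun i => x (Sum.inr (Sum.inl i))) m
          (fun i => x (Sum.inr (Sum.inr i)))) ((1 + C) * ‖μ‖) := by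
      cases m with
      | zero =>
        exact (C1Bound.zero _).mono (fun x => weight_nonneg S.h_nonneg x) (by positivity)
      | succ m =>
        have h4 := S.c1Bound_lower hC0.le hC μ m (l + 1) r
        simp only [joint, Sum.elim_inl, Sum.elim_inr, conf_cons] at h4
        exact h4
    have h5 := (((h1.add h2).add h3).clm_comp
      (ContinuousLinearMap.mul ℝ M2 σ₁)).const_smul (((l + 1 : ℕ) : ℂ)⁻¹)
    have hj : joint (S.core n μ.fn) m (l + 1) r = fun x =>
        (((l + 1 : ℕ) : ℂ)⁻¹) • (ContinuousLinearMap.mul ℝ M2 σ₁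
          (∑ i : Fin (l + 1), S.lam (x (Sum.inl i)) • joint μ.fn m l r
              (Sum.elim (fun j => x (Sum.inl (i.succAbove j))) (fun j => x (Sum.inr j)))
            + (∫ q, conj (S.lam q) • joint μ.fn m (l + 1 + 1) r
              (Sum.elim (Fin.cons q (fun j => x (Sum.inl j))) (fun j => x (Sum.inr j))))
            + S.lowerTerm μ.fn (conf fun i => x (Sum.inl i))
              (conf fun i => x (Sum.inr (Sum.inl i))) m (fun i => x (Sum.inr (Sum.inr i))))) := by
      funext x
      simp only [joint, core, bracket, card_conf, Fintype.card_fin, Sum.elim_inl, Sum.elim_inr,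
        sum_map_conf, conf_cons]
      rw [if_pos ⟨hml, hr⟩]
      have he : ∀ i : Fin (l + 1), (conf fun i => x (Sum.inl i)).erase (x (Sum.inl i))
          = conf fun j => x (Sum.inl (i.succAbove j)) := fun i =>
        conf_erase (fun i => x (Sum.inl i)) i
      simp only [he]
      rfl
    rw [hj]
    refine h5.mono (fun x => weight_nonneg S.h_nonneg x) ?_
    have hl : (1 : ℝ) ≤ ((l + 1 : ℕ) : ℝ) := by exact_mod_cast Nat.succ_pos l
    rw [norm_inv, Complex.norm_natCast, inv_mul_le_iff₀ (by positivity)]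
    have hn := ContinuousLinearMap.opNorm_mul_apply_le ℝ M2 σ₁
    set t : ℝ := ((l + 1 : ℕ) : ℝ)
    have h6 : ((∫ q, S.h q ^ 2) + (1 + C)) * ‖μ‖ ≤ t * (((∫ q, S.h q ^ 2) + (1 + C)) * ‖μ‖) :=
      le_mul_of_one_le_left (by positivity) hl
    calc _ ≤ ‖σ₁‖ * (t * ((1 + C) * ‖μ‖) + (∫ q, S.h q ^ 2) * ‖μ‖ + (1 + C) * ‖μ‖) :=
          mul_le_mul_of_nonneg_right hn (by positivity)
      _ ≤ ‖σ₁‖ * (t * ((1 + C) * ‖μ‖) + t * (((∫ q, S.h q ^ 2) + (1 + C)) * ‖μ‖)) := by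
          refine mul_le_mul_of_nonneg_left ?_ (norm_nonneg _)
          linarith
      _ = _ := by ring

theorem exists_coreHat : ∃ A : ℝ, 0 ≤ A ∧ ∀ n : ℕ, ∃ ν : CoeffSpace S.h n,
    ν.fn = S.coreHat n ∧ ‖ν‖ ≤ A := by
  obtain ⟨C, hC0, hC⟩ := S.fderiv_lam_le
  refine ⟨(1 + C) * ‖σ₁‖, by positivity, fun n => ?_⟩
  refine CoeffSpace.exists_of_c1Bound S.h_nonneg (by positivity) ?_ ?_
  · intro m Q₁ Q₂ k hs
    exact if_neg (by omega)
  · intro m l r hml hr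
    by_cases h1 : m = 0 ∧ l = 1 ∧ r = n
    · obtain ⟨rfl, rfl, rfl⟩ := h1
      have h2 : C1Bound (ι := Fin 1 ⊕ (Fin r ⊕ Fin 0)) (d := d) (fun _ => 1) (fun _ => σ₁) ‖σ₁‖ :=
        ⟨contDiff_const, fun x => by simp, fun x i c => by simp⟩
      have h3 := C1Bound.form_factor_smul hC0.le S.h_nonneg S.lam_contDiff S.lam_le
        (S.fderiv_lam_apply_le hC) h2 (Sum.inl 0)
      have hw : (fun x : Fin 1 ⊕ (Fin r ⊕ Fin 0) → E d => S.h (x (Sum.inl 0)) * 1)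
          = weight S.h := by
        funext x
        simp [weight]
      have hj : joint (S.coreHat r) 0 1 r = fun x => S.lam (x (Sum.inl 0)) • σ₁ := by
        funext x
        simp [joint, coreHat, card_conf, sum_map_conf]
      rw [hw] at h3
      rwa [hj]
    · have hj : joint (S.coreHat n) m l r = fun _ => 0 := by
        funext x
        refine if_neg ?_
        simpa [card_conf] using h1
      rw [hj]
      exact (C1Bound.zero _).mono (fun x => weight_nonneg S.h_nonneg x) (by positivity)

end Model

/-! ### The coefficient functions `μ_n(z)` -/

/-- A family of operators that satisfies the first resolvent identity with respect to a bounded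
family is differentiable. -/
theorem differentiableOn_of_resolvent_identity {X : Type*} [NormedAddCommGroup X]
    [NormedSpace ℂ X] {D : Set ℂ} (hD : IsOpen D) {P R : ℂ → X →L[ℂ] X} {b : ℝ}
    (hb : ∀ z ∈ D, ‖P z‖ ≤ b)
    (hP : ∀ z ∈ D, ∀ w ∈ D, P z - P w = (z - w) • (P z).comp (P w))
    (hR : ∀ z ∈ D, ∀ w ∈ D, R z - R w = (z - w) • (P z).comp (R w)) :
    DifferentiableOn ℂ R D := by
  intro w hw
  have hDw : ∀ᶠ z in 𝓝 w, z ∈ D := hD.mem_nhds hw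
  have hcont : Tendsto P (𝓝 w) (𝓝 (P w)) := by
    rw [tendsto_iff_norm_sub_tendsto_zero]
    have h0 : Tendsto (fun z => ‖z - w‖ * (b * b)) (𝓝 w) (𝓝 0) := by
      have : Tendsto (fun z => ‖z - w‖ * (b * b)) (𝓝 w) (𝓝 (‖w - w‖ * (b * b))) :=
        ((continuous_id.sub continuous_const).norm.mul continuous_const).tendsto w
      simpa using this
    refine squeeze_zero' (Eventually.of_forall fun z => norm_nonneg _) ?_ h0
    filter_upwards [hDw] with z hz
    rw [hP z hz w hw, norm_smul]
    refine mul_le_mul_of_nonneg_left ?_ (norm_nonneg _)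
    exact ((P z).opNorm_comp_le (P w)).trans
      (mul_le_mul (hb z hz) (hb w hw) (norm_nonneg _) ((norm_nonneg _).trans (hb z hz)))
  have hder : HasDerivAt R ((P w).comp (R w)) w := by
    rw [hasDerivAt_iff_tendsto_slope]
    have h1 : Tendsto (fun z => (P z).comp (R w)) (𝓝 w) (𝓝 ((P w).comp (R w))) :=
      ((ContinuousLinearMap.compL ℂ X X X).flip (R w)).continuous.tendsto (P w) |>.comp hcont
    refine (h1.mono_left nhdsWithin_le_nhds).congr' ?_
    filter_upwards [nhdsWithin_le_nhds hDw, self_mem_nhdsWithin] with z hz hne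
    rw [slope_def_module, hR z hz w hw, smul_smul, inv_mul_cancel₀ (sub_ne_zero.2 hne), one_smul]
  exact hder.differentiableAt.differentiableWithinAt

namespace Model

variable {d : ℕ} (S : Model d)

theorem isOpen_halfPlane (n : ℕ) (η : ℝ) : IsOpen (S.halfPlane n η) :=
  isOpen_lt Complex.continuous_re continuous_const

/-- Without a factor the free resolvent is of size `1 / η`, and with the factor `|Q₁|` it is still
bounded.  Both families are differentiable in `z`. -/
theorem exists_resMul_family {η₀ : ℝ} (hη₀ : 0 < η₀) : ∃ b : ℝ, 0 ≤ b ∧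
    ∀ η, η₀ ≤ η → ∀ n : ℕ, ∃ P R : ℂ → CoeffSpace S.h n →L[ℂ] CoeffSpace S.h n,
      DifferentiableOn ℂ P (S.halfPlane n η) ∧ DifferentiableOn ℂ R (S.halfPlane n η) ∧
      ∀ z ∈ S.halfPlane n η, ‖P z‖ ≤ b / η ∧ ‖R z‖ ≤ b * ((n + 1) / η + 1 / S.kappa) ∧
        (∀ μ, (P z μ).fn = S.resMul (fun _ => 1) n z μ.fn) ∧
        ∀ μ, (R z μ).fn = S.resMul (fun l => l) n z μ.fn := by
  obtain ⟨b, hb, H⟩ := S.exists_resMul_clm hη₀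
  refine ⟨b, hb, fun η hη n => ?_⟩
  have hηp : 0 < η := hη₀.trans_le hη
  have hκ := S.kappa_pos
  have hnn : ∀ m l r : ℕ, m < l → r + m = n →
      ∃ t : ℝ, 0 ≤ t ∧ (l : ℝ) + r = t + (n + 1) ∧ (l : ℝ) ≤ t + (n + 1) := by
    intro m l r h1 h2
    refine ⟨((l + r - (n + 1) : ℕ) : ℝ), by positivity, ?_, ?_⟩
    · exact_mod_cast (by omega : l + r = l + r - (n + 1) + (n + 1))
    · exact_mod_cast (by omega : l ≤ l + r - (n + 1) + (n + 1))
  have H1 : ∀ z, ∃ L : CoeffSpace S.h n →L[ℂ] CoeffSpace S.h n, z ∈ S.halfPlane n η →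
      ‖L‖ ≤ b * (1 / η) ∧ ∀ μ, (L μ).fn = S.resMul (fun _ => 1) n z μ.fn := by
    intro z
    by_cases hz : z ∈ S.halfPlane n η
    · obtain ⟨L, hL⟩ := H η hη n (fun _ => 1) (1 / η) (fun _ => zero_le_one) (by
        intro m l r h1 h2
        obtain ⟨t, ht0, ht, -⟩ := hnn m l r h1 h2
        rw [ht, add_sub_cancel_right, one_div, inv_mul_eq_div, le_div_iff₀ hηp]
        have := mul_nonneg ht0 hκ.le
        linarith) z hz
      exact ⟨L, fun _ => hL⟩
    · exact ⟨0, fun h => absurd h hz⟩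
  have H2 : ∀ z, ∃ L : CoeffSpace S.h n →L[ℂ] CoeffSpace S.h n, z ∈ S.halfPlane n η →
      ‖L‖ ≤ b * ((n + 1) / η + 1 / S.kappa) ∧
        ∀ μ, (L μ).fn = S.resMul (fun l => l) n z μ.fn := by
    intro z
    by_cases hz : z ∈ S.halfPlane n η
    · obtain ⟨L, hL⟩ := H η hη n (fun l => l) ((n + 1) / η + 1 / S.kappa)
        (fun l => Nat.cast_nonneg l) (by
        intro m l r h1 h2
        obtain ⟨t, ht0, ht, hl⟩ := hnn m l r h1 h2
        rw [ht, add_sub_cancel_right]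
        refine hl.trans ?_
        have e : (((n : ℝ) + 1) / η + 1 / S.kappa) * (η + t * S.kappa)
            = t + (n + 1) + ((n + 1) / η * (t * S.kappa) + 1 / S.kappa * η) := by
          field_simp
          ring
        rw [e]
        have : 0 ≤ ((n : ℝ) + 1) / η * (t * S.kappa) + 1 / S.kappa * η := by positivity
        linarith) z hz
      exact ⟨L, fun _ => hL⟩
    · exact ⟨0, fun h => absurd h hz⟩
  choose P hP using H1
  choose R hR using H2
  have hPi : ∀ z ∈ S.halfPlane n η, ∀ w ∈ S.halfPlane n η,
      P z - P w = (z - w) • (P z).comp (P w) := by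
    intro z hz w hw
    refine ContinuousLinearMap.ext fun μ => CoeffSpace.fn_injective ?_
    change (P z μ).fn - (P w μ).fn = (z - w) • (P z (P w μ)).fn
    rw [(hP z hz).2, (hP w hw).2, (hP z hz).2, (hP w hw).2, S.resMul_sub_resMul hηp hz hw]
  have hRi : ∀ z ∈ S.halfPlane n η, ∀ w ∈ S.halfPlane n η,
      R z - R w = (z - w) • (P z).comp (R w) := by
    intro z hz w hw
    refine ContinuousLinearMap.ext fun μ => CoeffSpace.fn_injective ?_
    change (R z μ).fn - (R w μ).fn = (z - w) • (P z (R w μ)).fn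
    rw [(hR z hz).2, (hR w hw).2, (hP z hz).2, (hR w hw).2, S.resMul_sub_resMul hηp hz hw]
  have hPb : ∀ z ∈ S.halfPlane n η, ‖P z‖ ≤ b * (1 / η) := fun z hz => (hP z hz).1
  refine ⟨P, R, differentiableOn_of_resolvent_identity (S.isOpen_halfPlane n η) hPb hPi hPi,
    differentiableOn_of_resolvent_identity (S.isOpen_halfPlane n η) hPb hPi hRi,
    fun z hz => ⟨?_, (hR z hz).1, (hP z hz).2, (hR z hz).2⟩⟩
  have := hPb z hz
  rwa [mul_one_div] at this

/-- For small coupling `Γ(z)` is a contraction of `𝓑_n`, so `1 + Γ(z)` is invertible. -/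
theorem exists_solution {η₀ : ℝ} (hη₀ : 0 < η₀) : ∃ K : ℝ, 0 < K ∧
    ∀ η, η₀ ≤ η → ∀ n : ℕ, ∃ α₀ : ℝ, 0 < α₀ ∧ ∀ α : ℝ, 0 ≤ α → α < α₀ → ∀ m ≤ n,
      ∃ (G : ℂ → CoeffSpace S.h m →L[ℂ] CoeffSpace S.h m) (ν μ : ℂ → CoeffSpace S.h m),
        AnalyticOnNhd ℂ μ (S.halfPlane m η) ∧
        ∀ z ∈ S.halfPlane m η, (∀ μ, (G z μ).fn = S.Gam α m z μ.fn) ∧ ‖G z‖ ≤ 1 / 2 ∧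
          (ν z).fn = S.muHat α m z ∧ μ z + G z (μ z) = ν z ∧ S.IsSolution α m z (μ z) ∧
          (∀ μ', S.IsSolution α m z μ' → μ' = μ z) ∧ ‖μ z‖ ≤ K * α / η := by
  obtain ⟨b, hb, HP⟩ := S.exists_resMul_family hη₀
  obtain ⟨A, hA, HA⟩ := S.exists_core_clm
  obtain ⟨B, hB, HB⟩ := S.exists_coreHat
  have hκ := S.kappa_pos
  refine ⟨2 * (b * B) + 1, by positivity, fun η hη n => ?_⟩
  have hηp : 0 < η := hη₀.trans_le hη
  set c : ℝ := b * ((n + 1) / η + 1 / S.kappa) * A with hc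
  have hc0 : 0 ≤ c := by positivity
  refine ⟨1 / (2 * (c + 1)), by positivity, fun α hα0 hα m hm => ?_⟩
  have : CompleteSpace (CoeffSpace S.h m) := CoeffSpace.completeSpace S.h_nonneg S.h_le_one
  have hαc : α * c ≤ 1 / 2 := by
    have h1 : α * (2 * (c + 1)) < 1 := (lt_div_iff₀ (by positivity)).1 hα
    nlinarith
  obtain ⟨P, R, hPd, hRd, hPR⟩ := HP η hη m
  obtain ⟨L, hL, hL'⟩ := HA m
  obtain ⟨ν₀, hν₀, hν₀'⟩ := HB m
  set G : ℂ → CoeffSpace S.h m →L[ℂ] CoeffSpace S.h m := fun z => (α : ℂ) • (R z).comp L with hG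
  set ν : ℂ → CoeffSpace S.h m := fun z => (α : ℂ) • P z ν₀ with hν
  have hGn : ∀ z ∈ S.halfPlane m η, ‖G z‖ ≤ 1 / 2 := by
    intro z hz
    rw [hG, norm_smul, Complex.norm_real, Real.norm_of_nonneg hα0]
    refine (mul_le_mul_of_nonneg_left ?_ hα0).trans hαc
    have hmn : ((m : ℝ) + 1) / η ≤ (n + 1) / η := by gcongr
    exact ((R z).opNorm_comp_le L).trans (mul_le_mul ((hPR z hz).2.1.trans
      (mul_le_mul_of_nonneg_left (by linarith) hb)) hL (norm_nonneg _) (by positivity))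
  have hGf : ∀ z ∈ S.halfPlane m η, ∀ μ, (G z μ).fn = S.Gam α m z μ.fn := by
    intro z hz μ
    change (α : ℂ) • (R z (L μ)).fn = _
    rw [(hPR z hz).2.2.2, hL', S.Gam_eq]
  have hνf : ∀ z ∈ S.halfPlane m η, (ν z).fn = S.muHat α m z := by
    intro z hz
    change (α : ℂ) • (P z ν₀).fn = _
    rw [(hPR z hz).2.2.1, hν₀, S.muHat_eq]
  have hunit : ∀ z ∈ S.halfPlane m η, IsUnit (1 + G z) := by
    intro z hz
    have := isUnit_one_sub_of_norm_lt_one (x := -G z)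
      (by rw [norm_neg]; exact (hGn z hz).trans_lt (by norm_num))
    rwa [sub_neg_eq_add] at this
  set μ : ℂ → CoeffSpace S.h m := fun z => Ring.inverse (1 + G z) (ν z) with hμ
  have hsol : ∀ z ∈ S.halfPlane m η, μ z + G z (μ z) = ν z := by
    intro z hz
    have h1 := Ring.mul_inverse_cancel _ (hunit z hz)
    exact DFunLike.congr_fun h1 (ν z)
  have hiff : ∀ z ∈ S.halfPlane m η, ∀ μ', S.IsSolution α m z μ' ↔ μ' + G z μ' = ν z := by
    intro z hz μ'
    rw [IsSolution, ← hGf z hz, ← hνf z hz, ← CoeffSpace.fn_add]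
    exact CoeffSpace.fn_injective.eq_iff
  refine ⟨G, ν, μ, ?_, fun z hz => ⟨hGf z hz, hGn z hz, hνf z hz, hsol z hz,
    (hiff z hz _).2 (hsol z hz), fun μ' h' => ?_, ?_⟩⟩
  · refine DifferentiableOn.analyticOnNhd ?_ (S.isOpen_halfPlane m η)
    have hGd : DifferentiableOn ℂ (fun z => 1 + G z) (S.halfPlane m η) := by
      have h1 : DifferentiableOn ℂ (fun z => (R z).comp L) (S.halfPlane m η) :=
        hRd.clm_comp (differentiableOn_const L)
      exact (differentiableOn_const _).add (h1.const_smul (α : ℂ))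
    have hνd : DifferentiableOn ℂ ν (S.halfPlane m η) := by
      have h1 : DifferentiableOn ℂ (fun z => P z ν₀) (S.halfPlane m η) :=
        hPd.clm_apply (differentiableOn_const ν₀)
      exact h1.const_smul (α : ℂ)
    refine DifferentiableOn.clm_apply ?_ hνd
    intro z hz
    exact (differentiableAt_inverse (𝕜 := ℂ) (hunit z hz)).comp_differentiableWithinAt z (hGd z hz)
  · have h1 := (hiff z hz μ').1 h'
    rw [← hsol z hz] at h1
    set I : CoeffSpace S.h m →L[ℂ] CoeffSpace S.h m := Ring.inverse (1 + G z)
    have h2 := congrArg I h1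
    have h3 : ∀ x, I (x + G z x) = x := fun x =>
      DFunLike.congr_fun (Ring.inverse_mul_cancel _ (hunit z hz)) x
    rwa [h3, h3] at h2
  · have h1 : ‖ν z‖ ≤ α * (b / η * B) := by
      rw [hν, norm_smul, Complex.norm_real, Real.norm_of_nonneg hα0]
      refine mul_le_mul_of_nonneg_left ?_ hα0
      exact ((P z).le_opNorm ν₀).trans
        (mul_le_mul (hPR z hz).1 hν₀' (norm_nonneg _) (by positivity))
    have h2 : ‖μ z‖ ≤ ‖ν z‖ + 1 / 2 * ‖μ z‖ := by
      have h3 : μ z = ν z - G z (μ z) := by rw [← hsol z hz, add_sub_cancel_right]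
      calc ‖μ z‖ = ‖ν z - G z (μ z)‖ := by rw [← h3]
        _ ≤ ‖ν z‖ + ‖G z (μ z)‖ := norm_sub_le _ _
        _ ≤ _ := by
          have := ((G z).le_opNorm (μ z)).trans
            (mul_le_mul_of_nonneg_right (hGn z hz) (norm_nonneg _))
          linarith
    have h4 : (2 * (b * B) + 1) * α / η = 2 * (α * (b / η * B)) + α / η := by
      field_simp
    have h5 : 0 ≤ α / η := by positivity
    rw [h4]
    linarith

/-- Each boson has at least the energy `κ`. -/
theorem sub_omegaConf_mem_halfPlane {n m : ℕ} {η : ℝ} {z : ℂ} (hz : z ∈ S.halfPlane n η)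
    (Q : Conf d) (hQ : Q.card + m = n) : z - (S.omegaConf Q : ℂ) ∈ S.halfPlane m η := by
  have h1 := S.card_mul_kappa_le Q
  have h2 : z.re < -S.ε + (n + 1) * S.kappa - η := hz
  change (z - (S.omegaConf Q : ℂ)).re < -S.ε + (m + 1) * S.kappa - η
  rw [Complex.sub_re, Complex.ofReal_re]
  have h3 : (Q.card : ℝ) + m = n := by exact_mod_cast hQ
  rw [← h3] at h2
  linarith

/-- Freezing a configuration `Q` among the points of `Q₂` turns a solution for `n` bosons and the
spectral parameter `z` into one for `m = n - |Q|` bosons and the parameter `z - ω(Q)`. -/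
theorem exists_isSolution_freeze {α : ℝ} {n m : ℕ} {z : ℂ} (μ : CoeffSpace S.h n)
    (hμ : S.IsSolution α n z μ) (Q : Conf d) (hQ : Q.card + m = n) :
    ∃ ν : CoeffSpace S.h m, S.IsSolution α m (z - (S.omegaConf Q : ℂ)) ν ∧
      ∀ j Q₁ Q₂ k, ν.fn j Q₁ Q₂ k = μ.fn j Q₁ (Q₂ + Q) k := by
  obtain ⟨y, hy⟩ := exists_conf_eq Q
  obtain ⟨ν, hν, -⟩ := CoeffSpace.exists_of_c1Bound (n := m) S.h_nonneg
    (ν := fun j Q₁ Q₂ k => μ.fn j Q₁ (Q₂ + Q) k) (norm_nonneg μ) (by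
      intro j Q₁ Q₂ k hs
      refine μ.eq_zero ?_ k
      rw [Multiset.card_add]
      omega) (by
      intro j l r _ _
      have hp : IsSubst (d := d) (ι := Fin l ⊕ (Fin r ⊕ Fin j))
          (ι' := Fin l ⊕ (Fin (r + Q.card) ⊕ Fin j))
          (Sum.elim (fun i => some (Sum.inl i)) (Sum.elim
            (Fin.append (fun i => some (Sum.inr (Sum.inl i))) (fun _ => none))
            (fun i => some (Sum.inr (Sum.inr i)))))
          (fun x => Sum.elim (fun i => x (Sum.inl i)) (Sum.elim
            (Fin.append (fun i => x (Sum.inr (Sum.inl i))) y)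
            (fun i => x (Sum.inr (Sum.inr i))))) := by
        refine ⟨?_, ?_, ?_⟩
        · rintro (i | i | i) i' h x
          · simp at h
            simp [← h]
          · induction i using Fin.addCases <;> simp at h
            simp [← h]
          · simp at h
            simp [← h]
        · rintro (i | i | i) h x x'
          · simp at h
          · induction i using Fin.addCases <;> simp at h
            simp
          · simp at h
        · rintro i₀ (i | i | i) (i' | i' | i') h h' <;>
            (try induction i using Fin.addCases) <;> (try induction i' using Fin.addCases) <;>
            simp at h h' <;> rw [← h] at h' <;> simp at h' <;> rw [h']
      have h1 := (μ.c1Bound j l (r + Q.card)).comp_subst hp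
      have hw : (fun x : Fin l ⊕ (Fin r ⊕ Fin j) → E d => weight S.h
          (Sum.elim (fun i => x (Sum.inl i)) (Sum.elim
            (Fin.append (fun i => x (Sum.inr (Sum.inl i))) y)
            (fun i => x (Sum.inr (Sum.inr i)))) : Fin l ⊕ (Fin (r + Q.card) ⊕ Fin j) → E d))
          = weight S.h := by
        funext x
        simp only [weight, Sum.elim_inl, Sum.elim_inr]
      rw [hw] at h1
      have hj : joint (fun j Q₁ Q₂ k => μ.fn j Q₁ (Q₂ + Q) k) j l r = fun x =>
          joint μ.fn j l (r + Q.card) (Sum.elim (fun i => x (Sum.inl i)) (Sum.elim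
            (Fin.append (fun i => x (Sum.inr (Sum.inl i))) y)
            (fun i => x (Sum.inr (Sum.inr i))))) := by
        funext x
        have h2 : conf (Fin.append (fun i => x (Sum.inr (Sum.inl i))) y)
            = conf (fun i => x (Sum.inr (Sum.inl i))) + Q := by
          rw [← conf_comp_equiv finSumFinEquiv, conf_sumElim]
          simp only [finSumFinEquiv_apply_left, finSumFinEquiv_apply_right, Fin.append_left,
            Fin.append_right]
          rw [hy]
        simp only [joint, Sum.elim_inl, Sum.elim_inr]
        rw [← h2]
      rw [hj]
      exact h1)
  have hνf : ∀ j Q₁ Q₂ k, ν.fn j Q₁ Q₂ k = μ.fn j Q₁ (Q₂ + Q) k := fun j Q₁ Q₂ k => by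
    rw [hν]
  refine ⟨ν, ?_, hνf⟩
  funext j Q₁ Q₂ k
  have h1 : (μ.fn + S.Gam α n z μ.fn) j Q₁ (Q₂ + Q) k = S.muHat α n z j Q₁ (Q₂ + Q) k := by
    rw [hμ]
  have hlow : S.lowerTerm ν.fn Q₁ Q₂ j k = S.lowerTerm μ.fn Q₁ (Q₂ + Q) j k := by
    cases j with
    | zero => rfl
    | succ j => simp only [lowerTerm, hνf, Multiset.cons_add]
  have hc : (Q₂ + Q).card = Q₂.card + Q.card := Multiset.card_add _ _
  have hG : S.Gam α m (z - (S.omegaConf Q : ℂ)) ν.fn j Q₁ Q₂ k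
      = S.Gam α n z μ.fn j Q₁ (Q₂ + Q) k := by
    simp only [Gam, hνf, hlow, freeRes_sub, ← add_assoc]
    exact if_congr (by omega) rfl rfl
  have hM : S.muHat α m (z - (S.omegaConf Q : ℂ)) j Q₁ Q₂ k
      = S.muHat α n z j Q₁ (Q₂ + Q) k := by
    simp only [muHat, freeRes_sub, add_right_comm Q₂ Q₁ Q]
    exact if_congr (by omega) rfl rfl
  rw [hM, ← h1]
  simp only [Pi.add_apply]
  rw [hνf, hG]

end Model

/-! ### The resolvent of the compressed Hamiltonian -/

/-- The projection onto the particle numbers in `s`, as a multiplication operator. -/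
noncomputable def cutoff (d : ℕ) (s : Set ℕ) [DecidablePred (· ∈ s)] (Q : Conf d) : M2 :=
  if Q.card ∈ s then 1 else 0

theorem stronglyMeasurable_M2_of_conf {d : ℕ} {G : Conf d → M2}
    (h : ∀ l, Continuous fun x : Fin l → E d => G (conf x)) : StronglyMeasurable G := by
  have : ProperSpace M2 := FiniteDimensional.proper ℂ M2
  exact (measurable_of_conf fun l => (h l).measurable).stronglyMeasurable

theorem stronglyMeasurable_cutoff (d : ℕ) (s : Set ℕ) [DecidablePred (· ∈ s)] :
    StronglyMeasurable (cutoff d s) := by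
  refine stronglyMeasurable_M2_of_conf fun l => ?_
  simp only [cutoff, card_conf]
  exact continuous_const

theorem norm_cutoff_le (d : ℕ) (s : Set ℕ) [DecidablePred (· ∈ s)] (Q : Conf d) :
    ‖cutoff d s Q‖ ≤ if Q.card ∈ s then 1 else 0 := by
  unfold cutoff
  split_ifs
  · exact ContinuousLinearMap.norm_id_le
  · simp

theorem cutoff_apply {d : ℕ} (s : Set ℕ) [DecidablePred (· ∈ s)] (Q : Conf d) (v : Spin) :
    cutoff d s Q v = if Q.card ∈ s then v else 0 := by
  unfold cutoff
  split_ifs <;> simp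

theorem cutoff_apply_ae {d : ℕ} (s : Set ℕ) [DecidablePred (· ∈ s)] {F : Hilb d}
    (hF : F ∈ sector d s) : (fun Q => cutoff d s Q (F Q)) =ᵐ[lebesguePoisson d] F := by
  have hF' : ∀ᵐ Q ∂lebesguePoisson d, Q.card ∉ s → F Q = 0 := hF
  filter_upwards [hF'] with Q hQ
  rw [cutoff_apply]
  split_ifs with h
  · rfl
  · exact (hQ h).symm

theorem memLp_matrix_apply {d : ℕ} (A : M2) (F : Hilb d) :
    MemLp (fun Q => A (F Q)) 2 (lebesguePoisson d) :=
  (Lp.memLp F).of_le_mul (A.continuous.comp_aestronglyMeasurable (Lp.aestronglyMeasurable F))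
    (Eventually.of_forall fun Q => A.le_opNorm (F Q))

theorem memLp_cutoff_apply {d : ℕ} (s : Set ℕ) [DecidablePred (· ∈ s)] (F : Hilb d) :
    MemLp (fun Q => cutoff d s Q (F Q)) 2 (lebesguePoisson d) := by
  refine (Lp.memLp F).of_le (stronglyMeasurable_clm_apply
    (stronglyMeasurable_cutoff d s) (Lp.stronglyMeasurable F)).aestronglyMeasurable
    (Eventually.of_forall fun Q => ?_)
  rw [cutoff_apply]
  split_ifs <;> simp

/-- Used for `Y = ω F`, which the resolvent equation expresses through `F` and a square integrable
function. -/
theorem memLp_free_combination {d : ℕ} (a z : ℂ) (A : M2) (F : Hilb d) {X Y : Conf d → Spin}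
    (hX : MemLp X 2 (lebesguePoisson d)) (hY : Y =ᵐ[lebesguePoisson d] fun Q =>
      X Q + z • F Q + a • A (F Q)) : MemLp Y 2 (lebesguePoisson d) := by
  rw [memLp_congr_ae hY]
  exact (hX.add ((Lp.memLp F).const_smul z)).add ((memLp_matrix_apply A F).const_smul a)

namespace Model

variable {d : ℕ} (S : Model d)

/-- The free resolvent on the states with more than `n` bosons, extended by `0`. -/
noncomputable def cutRes (n : ℕ) (z : ℂ) (Q : Conf d) : M2 :=
  if n < Q.card then S.freeRes z Q else 0

/-- A bound for `cutRes n z` on the `l`-boson states, for `Re z < -ε + (n + 1) κ - η`. -/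
noncomputable def cutResBound (n : ℕ) (η : ℝ) (l : ℕ) : ℝ :=
  if n < l then projNorm / (η + (l - (n + 1)) * S.kappa) else 0

theorem cutRes_gap_pos {n l : ℕ} {η : ℝ} (hη : 0 < η) (hl : n < l) :
    0 < η + (l - (n + 1)) * S.kappa := by
  have h2 : ((n : ℝ) + 1) ≤ l := by exact_mod_cast hl
  have := mul_nonneg (sub_nonneg.2 h2) S.kappa_pos.le
  linarith

theorem cutResBound_nonneg {n : ℕ} {η : ℝ} (hη : 0 < η) (l : ℕ) : 0 ≤ S.cutResBound n η l := by
  unfold cutResBound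
  split_ifs with h
  · exact div_nonneg projNorm_nonneg (S.cutRes_gap_pos hη h).le
  · exact le_rfl

theorem norm_cutRes_le {n : ℕ} {η : ℝ} (hη : 0 < η) {z : ℂ} (hz : z ∈ S.halfPlane n η)
    (Q : Conf d) : ‖S.cutRes n z Q‖ ≤ S.cutResBound n η Q.card := by
  unfold cutRes cutResBound
  split_ifs with h
  · refine (S.norm_freeRes_le (S.gap_pos hη hz h)).trans ?_
    exact div_le_div_of_nonneg_left projNorm_nonneg (S.cutRes_gap_pos hη h) (S.gap_lt hz Q).le
  · simp

theorem cutResBound_le {n : ℕ} {η : ℝ} (hη : 0 < η) (l : ℕ) :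
    S.cutResBound n η l ≤ projNorm / η := by
  have hp := projNorm_nonneg
  unfold cutResBound
  split_ifs with h
  · refine div_le_div_of_nonneg_left hp hη ?_
    have h2 : ((n : ℝ) + 1) ≤ l := by exact_mod_cast h
    have := mul_nonneg (sub_nonneg.2 h2) S.kappa_pos.le
    linarith
  · positivity

theorem stronglyMeasurable_cutRes {n : ℕ} {η : ℝ} (hη : 0 < η) {z : ℂ}
    (hz : z ∈ S.halfPlane n η) : StronglyMeasurable (S.cutRes n z) := by
  obtain ⟨C, hC0, hC⟩ := S.exists_fderiv_ω_le
  refine stronglyMeasurable_M2_of_conf fun l => ?_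
  simp only [cutRes, card_conf, Fintype.card_fin]
  split_ifs with h
  · exact (S.freeRes_conf_contDiff hη hC0 hC le_rfl hz (id : Fin l → Fin l)
      Function.injective_id (by simpa using h)).1.continuous
  · exact continuous_const

/-- The free resolvent compensates the growth `√l` of the creation and annihilation operators. -/
theorem exists_cutResBound_sq_le (n : ℕ) {η : ℝ} (hη : 0 < η) : ∃ c : NNReal, ∀ l : ℕ, n < l →
    (l + 1) * S.cutResBound n η l ^ 2 ≤ (c : ℝ) ^ 2 ∧
      (l + 1) * S.cutResBound n η (l + 1) ^ 2 ≤ (c : ℝ) ^ 2 := by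
  have hκ := S.kappa_pos
  have hp := projNorm_nonneg
  set c2 : ℝ := projNorm ^ 2 * (((n + 2) / η + 1 / S.kappa) / η) with hc2
  have hc20 : 0 ≤ c2 := by positivity
  refine ⟨(Real.sqrt c2).toNNReal, fun l hl => ?_⟩
  have hcs : ((Real.sqrt c2).toNNReal : ℝ) ^ 2 = c2 := by
    rw [Real.coe_toNNReal _ (Real.sqrt_nonneg _), Real.sq_sqrt hc20]
  rw [hcs]
  have hg := S.cutRes_gap_pos (n := n) hη hl
  have h1 : (l + 1) * S.cutResBound n η l ^ 2 ≤ c2 := by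
    rw [cutResBound, if_pos hl]
    obtain ⟨t, ht0, ht⟩ : ∃ t : ℝ, 0 ≤ t ∧ (l : ℝ) = t + (n + 1) :=
      ⟨((l - (n + 1) : ℕ) : ℝ), by positivity,
        by exact_mod_cast (by omega : l = l - (n + 1) + (n + 1))⟩
    rw [ht, add_sub_cancel_right] at hg ⊢
    rw [hc2, div_pow, mul_div_assoc', div_le_iff₀ (by positivity), mul_comm _ (projNorm ^ 2),
      mul_assoc]
    refine mul_le_mul_of_nonneg_left ?_ (by positivity)
    have e : (((n : ℝ) + 2) / η + 1 / S.kappa) / η * (η + t * S.kappa) ^ 2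
        = (t + (n + 1) + 1) + (t + (η / S.kappa) + (n + 2) / η * (t * S.kappa) * 2
          + (n + 2) / η * (t * S.kappa) ^ 2 / η + t ^ 2 * S.kappa / η) := by
      field_simp
      ring
    rw [e]
    exact le_add_of_nonneg_right (by positivity)
  refine ⟨h1, le_trans ?_ h1⟩
  refine mul_le_mul_of_nonneg_left (pow_le_pow_left₀ (S.cutResBound_nonneg hη _) ?_ 2)
    (by positivity)
  rw [cutResBound, cutResBound, if_pos hl, if_pos (by omega)]
  refine div_le_div_of_nonneg_left hp hg ?_
  push_cast
  linarith

theorem exists_coupling_clm_of_real {A B : Conf d → M2} (hA : StronglyMeasurable A)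
    (hB : StronglyMeasurable B) {a b : ℕ → ℝ} (ha0 : ∀ l, 0 ≤ a l) (hb0 : ∀ l, 0 ≤ b l)
    (ha : ∀ Q, ‖A Q‖ ≤ a Q.card) (hb : ∀ Q, ‖B Q‖ ≤ b Q.card) {b' : ℝ} (hbb : ∀ l, b l ≤ b')
    {c : NNReal} (h1 : ∀ l : ℕ, a (l + 1) ^ 2 * (l + 1) * b l ^ 2 ≤ (c : ℝ) ^ 2)
    (h2 : ∀ l : ℕ, a l ^ 2 * (l + 1) * b (l + 1) ^ 2 ≤ (c : ℝ) ^ 2) :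
    ∃ L : Hilb d →L[ℂ] Hilb d,
      ‖L‖ ≤ 2 * (‖σ₁‖ * (eLpNorm S.lam 2 volume).toReal * c) ∧
      ∀ F : Hilb d, L F =ᵐ[lebesguePoisson d] fun Q => A Q (σ₁
        (S.create (fun Q => B Q (F Q)) Q + S.annihilate (fun Q => B Q (F Q)) Q)) := by
  have key : ∀ (l : ℕ) (x y : ℝ), 0 ≤ x → 0 ≤ y → x ^ 2 * (l + 1) * y ^ 2 ≤ (c : ℝ) ^ 2 →
      ENNReal.ofReal x ^ 2 * (l + 1) * ENNReal.ofReal y ^ 2 ≤ (c : ℝ≥0∞) ^ 2 := by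
    intro l x y hx hy hxy
    have h3 := ENNReal.ofReal_le_ofReal hxy
    rw [ENNReal.ofReal_mul (by positivity), ENNReal.ofReal_mul (by positivity),
      ENNReal.ofReal_pow hx, ENNReal.ofReal_pow hy, ENNReal.ofReal_pow c.coe_nonneg,
      ENNReal.ofReal_coe_nnreal] at h3
    have h4 : ENNReal.ofReal ((l : ℝ) + 1) = (l : ℝ≥0∞) + 1 := by
      rw [ENNReal.ofReal_add (by positivity) zero_le_one, ENNReal.ofReal_natCast,
        ENNReal.ofReal_one]
    rwa [h4] at h3
  refine S.exists_coupling_clm hA hB (a := fun l => ENNReal.ofReal (a l))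
    (b := fun l => ENNReal.ofReal (b l)) (fun Q => ?_) (fun Q => ?_)
    ⟨b', fun Q => (hb Q).trans (hbb _)⟩ (fun l => key l _ _ (ha0 _) (hb0 _) (h1 l))
    (fun l => key l _ _ (ha0 _) (hb0 _) (h2 l))
  · rw [← ofReal_norm]
    exact ENNReal.ofReal_le_ofReal (ha Q)
  · rw [← ofReal_norm]
    exact ENNReal.ofReal_le_ofReal (hb Q)

theorem _root_.SpinBoson.indicator_sq (p : Prop) [Decidable p] :
    (if p then (1 : ℝ) else 0) ^ 2 = if p then 1 else 0 := by
  split_ifs <;> norm_num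

/-- Between the particle numbers `n` and `n + 1` the creation operator is bounded; the annihilation
term of the field operator is cut off. -/
theorem exists_isCStar (α : ℝ) (n : ℕ) :
    ∃ T : HilbEq d n →L[ℂ] HilbGt d n, S.IsCStar α n T := by
  obtain ⟨L, -, hL⟩ := S.exists_coupling_clm_of_real
    (stronglyMeasurable_cutoff d {n + 1}) (stronglyMeasurable_cutoff d {n})
    (a := fun l => if l ∈ ({n + 1} : Set ℕ) then 1 else 0)
    (b := fun l => if l ∈ ({n} : Set ℕ) then 1 else 0) (b' := 1) (c := n + 1)
    (fun l => by positivity) (fun l => by positivity) (norm_cutoff_le d _) (norm_cutoff_le d _)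
    (fun l => by split_ifs <;> norm_num)
    (fun l => by
      simp only [indicator_sq, Set.mem_singleton_iff]
      split_ifs with h1 h2
      · subst h2
        push_cast
        nlinarith
      all_goals
        simp only [mul_zero, zero_mul]
        positivity)
    (fun l => by
      simp only [indicator_sq, Set.mem_singleton_iff]
      split_ifs with h1 h2
      · omega
      all_goals
        simp only [mul_zero, zero_mul]
        positivity)
  have hval : ∀ F : Hilb d, ∀ᵐ Q ∂lebesguePoisson d, ((α : ℂ) • L F : Hilb d) Q
      = if Q.card = n + 1 then (α : ℂ) • σ₁ (S.create (fun Q => cutoff d {n} Q (F Q)) Q)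
        else 0 := by
    intro F
    filter_upwards [hL F, Lp.coeFn_smul (α : ℂ) (L F)] with Q h1 h2
    rw [h2, Pi.smul_apply, h1, cutoff_apply]
    simp only [Set.mem_singleton_iff]
    split_ifs with h
    · have h3 : S.annihilate (fun Q => cutoff d {n} Q (F Q)) Q = 0 := by
        unfold annihilate
        refine integral_eq_zero_of_ae (Eventually.of_forall fun k => ?_)
        simp only
        rw [cutoff_apply, if_neg, smul_zero]
        · rfl
        · rw [Multiset.card_cons, Set.mem_singleton_iff]
          omega
      rw [h3, add_zero]
    · rw [smul_zero]
  have hmem : ∀ f : HilbEq d n, ((α : ℂ) • L).comp (HilbEq d n).subtypeL f ∈ HilbGt d n := by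
    intro f
    have : ∀ᵐ Q ∂lebesguePoisson d, Q.card ∉ Set.Ioi n → ((α : ℂ) • L f : Hilb d) Q = 0 := by
      filter_upwards [hval f] with Q hQ hn
      rw [hQ, if_neg]
      rw [Set.mem_Ioi] at hn
      omega
    exact this
  refine ⟨(((α : ℂ) • L).comp (HilbEq d n).subtypeL).codRestrict (HilbGt d n) hmem, fun f => ?_⟩
  filter_upwards [hval f, S.create_congr_ae (cutoff_apply_ae {n} f.2)] with Q h1 h2
  rw [← h2]
  exact h1

theorem freeHamiltonian_cutRes_apply {n : ℕ} {η : ℝ} (hη : 0 < η) {z : ℂ} (hz : z ∈ S.halfPlane n η)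
    {Q : Conf d} (hQ : n < Q.card) (v : Spin) :
    ((S.ε : ℂ) • σ₃ + (S.omegaConf Q : ℂ) • (1 : M2)) (S.cutRes n z Q v)
      = v + z • S.cutRes n z Q v := by
  have hg := S.gap_pos hη hz hQ
  rw [cutRes, if_pos hQ, S.freeRes_eq hg]
  have h1 : (S.ε : ℂ) • σ₃ (S.resAt z (S.omegaConf Q) v)
      + ((S.omegaConf Q : ℂ) - z) • S.resAt z (S.omegaConf Q) v = v :=
    DFunLike.congr_fun (S.mul_resAt hg) v
  rw [sub_smul] at h1
  change (S.ε : ℂ) • σ₃ (S.resAt z (S.omegaConf Q) v)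
    + (S.omegaConf Q : ℂ) • S.resAt z (S.omegaConf Q) v = _
  nth_rewrite 3 [← h1]
  abel

theorem cutRes_freeHamiltonian_apply {n : ℕ} {η : ℝ} (hη : 0 < η) {z : ℂ} (hz : z ∈ S.halfPlane n η)
    {Q : Conf d} (hQ : n < Q.card) (v : Spin) :
    S.cutRes n z Q ((S.ε : ℂ) • σ₃ v + (S.omegaConf Q : ℂ) • v - z • v) = v := by
  have hg := S.gap_pos hη hz hQ
  rw [cutRes, if_pos hQ, S.freeRes_eq hg]
  have h1 : S.resAt z (S.omegaConf Q) ((S.ε : ℂ) • σ₃ v + ((S.omegaConf Q : ℂ) - z) • v) = v :=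
    DFunLike.congr_fun (S.resAt_mul hg) v
  rw [sub_smul, ← add_sub_assoc] at h1
  exact h1

/-- The resolvent of `B_n`, from the Neumann series of `1 + α Φ R₀`, where `R₀` is the free
resolvent and `Φ` the field operator `σ₁ (a*(λ) + a(λ))`.  The operator `W = α R₀ Φ` is bounded as
well, and `F = R G` solves `F + W F = R₀ G`. -/
theorem exists_isResolvent {η : ℝ} (hη : 0 < η) (n : ℕ) : ∃ α₁ : ℝ, 0 < α₁ ∧
    ∀ α : ℝ, 0 ≤ α → α < α₁ → ∀ z ∈ S.halfPlane n η,
      ∃ (R : HilbGt d n →L[ℂ] HilbGt d n) (R₀ W : Hilb d →L[ℂ] Hilb d),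
        S.IsResolvent α n z R ∧ ‖W‖ ≤ 1 / 2 ∧
        (∀ F : Hilb d, R₀ F =ᵐ[lebesguePoisson d] fun Q => S.cutRes n z Q (F Q)) ∧
        (∀ F ∈ HilbGt d n, W F =ᵐ[lebesguePoisson d] fun Q =>
          S.cutRes n z Q ((α : ℂ) • σ₁ (S.create F Q + S.annihilate F Q))) ∧
        ∀ G : HilbGt d n, (R G : Hilb d) + W (R G : Hilb d) = R₀ G := by
  obtain ⟨c, hc⟩ := S.exists_cutResBound_sq_le n hη
  set N : ℝ := 2 * (‖σ₁‖ * (eLpNorm S.lam 2 volume).toReal * c) with hN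
  have hN0 : 0 ≤ N := by positivity
  refine ⟨1 / (2 * (N + 1)), by positivity, fun α hα0 hα z hz => ?_⟩
  have hαN : α * N ≤ 1 / 2 := by
    have h1 : α * (2 * (N + 1)) < 1 := (lt_div_iff₀ (by positivity)).1 hα
    nlinarith
  have hAm := S.stronglyMeasurable_cutRes hη hz
  have hAb := S.norm_cutRes_le hη hz
  have hB0 := S.cutResBound_nonneg (n := n) hη
  have hBz : ∀ l, ¬ n < l → S.cutResBound n η l = 0 := fun l hl => if_neg hl
  have hp := projNorm_nonneg
  obtain ⟨R₀, -, hR₀⟩ := exists_mul_clm hAm (C := projNorm / η) (by positivity)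
    fun Q => (hAb Q).trans (S.cutResBound_le hη _)
  obtain ⟨W, hW, hW'⟩ := S.exists_coupling_clm_of_real hAm (stronglyMeasurable_cutoff d (Set.Ioi n))
    (a := S.cutResBound n η) (b := fun l => if l ∈ Set.Ioi n then 1 else 0) (b' := 1) (c := c)
    hB0 (fun l => by positivity) hAb (norm_cutoff_le d _)
    (fun l => by split_ifs <;> norm_num)
    (fun l => by
      simp only [indicator_sq, Set.mem_Ioi]
      split_ifs with h
      · linarith [(hc l h).2]
      · rw [mul_zero]
        positivity)
    (fun l => by
      simp only [indicator_sq, Set.mem_Ioi]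
      by_cases h : n < l
      · rw [if_pos (by omega)]
        linarith [(hc l h).1]
      · rw [hBz l h]
        norm_num)
  obtain ⟨V, hV, hV'⟩ := S.exists_coupling_clm_of_real (stronglyMeasurable_cutoff d (Set.Ioi n)) hAm
    (b := S.cutResBound n η) (a := fun l => if l ∈ Set.Ioi n then 1 else 0) (b' := projNorm / η)
    (c := c) (fun l => by positivity) hB0 (norm_cutoff_le d _) hAb
    (fun l => S.cutResBound_le hη l)
    (fun l => by
      simp only [indicator_sq, Set.mem_Ioi]
      by_cases h : n < l
      · rw [if_pos (by omega)]
        linarith [(hc l h).1]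
      · rw [hBz l h]
        norm_num)
    (fun l => by
      simp only [indicator_sq, Set.mem_Ioi]
      split_ifs with h
      · linarith [(hc l h).2]
      · rw [zero_mul, zero_mul]
        positivity)
  have hscale : ∀ X : Hilb d →L[ℂ] Hilb d, ‖X‖ ≤ N → ‖(α : ℂ) • X‖ ≤ 1 / 2 := by
    intro X hX
    rw [norm_smul, Complex.norm_real, Real.norm_of_nonneg hα0]
    exact (mul_le_mul_of_nonneg_left hX hα0).trans hαN
  have hunit : IsUnit (1 + (α : ℂ) • V) := by
    have := isUnit_one_sub_of_norm_lt_one (x := -((α : ℂ) • V))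
      (by rw [norm_neg]; exact (hscale V hV).trans_lt (by norm_num))
    rwa [sub_neg_eq_add] at this
  set U : Hilb d →L[ℂ] Hilb d := Ring.inverse (1 + (α : ℂ) • V) with hU
  have hUr : ∀ G : Hilb d, U G + (α : ℂ) • V (U G) = G := fun G =>
    DFunLike.congr_fun (Ring.mul_inverse_cancel _ hunit) G
  have hUl : ∀ G : Hilb d, U (G + (α : ℂ) • V G) = G := fun G =>
    DFunLike.congr_fun (Ring.inverse_mul_cancel _ hunit) G
  have hR₀mem : ∀ F : Hilb d, R₀ F ∈ HilbGt d n := by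
    intro F
    have : ∀ᵐ Q ∂lebesguePoisson d, Q.card ∉ Set.Ioi n → (R₀ F : Hilb d) Q = 0 := by
      filter_upwards [hR₀ F] with Q hQ hn
      rw [hQ, cutRes, if_neg (show ¬ n < Q.card from hn)]
      rfl
    exact this
  set R : HilbGt d n →L[ℂ] HilbGt d n :=
    ((R₀.comp U).comp (HilbGt d n).subtypeL).codRestrict (HilbGt d n) fun F => hR₀mem _ with hR
  have hRval : ∀ G : HilbGt d n, (R G : Hilb d) = R₀ (U G) := fun G => rfl
  -- the coupling operator applied to `R₀ F`
  have hVval : ∀ F' : Hilb d, ∀ F : Hilb d, R₀ F' = F → ∀ᵐ Q ∂lebesguePoisson d, n < Q.card →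
      ((α : ℂ) • V F' : Hilb d) Q = (α : ℂ) • σ₁ (S.create F Q + S.annihilate F Q) := by
    intro F' F hF
    have h1 : (fun Q => S.cutRes n z Q (F' Q)) =ᵐ[lebesguePoisson d] F := by
      rw [← hF]
      exact (hR₀ F').symm
    filter_upwards [hV' F', Lp.coeFn_smul (α : ℂ) (V F'), S.create_congr_ae h1,
      S.annihilate_congr_ae h1] with Q h2 h3 h4 h5 hQ
    rw [h3, Pi.smul_apply, h2, cutoff_apply, if_pos (show Q.card ∈ Set.Ioi n from hQ), h4, h5]
  -- `R G` solves the resolvent equation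
  have hgraph : ∀ G : HilbGt d n, S.BGraph α n (R G) (G + z • R G) := by
    intro G
    have h1 := hVval (U G) (R G) rfl
    have h2 : ∀ᵐ Q ∂lebesguePoisson d, n < Q.card →
        (G : Hilb d) Q = (U G : Hilb d) Q + (α : ℂ) • σ₁ (S.create (R G : Hilb d) Q
          + S.annihilate (R G : Hilb d) Q) := by
      filter_upwards [h1, Lp.coeFn_add (U G : Hilb d) ((α : ℂ) • V (U G))] with Q h3 h4 hQ
      rw [← h3 hQ, ← Pi.add_apply, ← h4, hUr]
    constructor
    · have h3 : (fun Q => (S.omegaConf Q : ℂ) • (R G : Hilb d) Q) =ᵐ[lebesguePoisson d]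
          fun Q => cutoff d (Set.Ioi n) Q ((U G : Hilb d) Q) + z • (R G : Hilb d) Q
            + (-(S.ε : ℂ)) • σ₃ ((R G : Hilb d) Q) := by
        filter_upwards [hR₀ (U G)] with Q h3
        rw [hRval, h3, cutoff_apply]
        by_cases hQ : n < Q.card
        · have h5 := S.freeHamiltonian_cutRes_apply hη hz hQ ((U G : Hilb d) Q)
          rw [if_pos (show Q.card ∈ Set.Ioi n from hQ), ← h5]
          simp
        · rw [if_neg (show Q.card ∉ Set.Ioi n from hQ), cutRes, if_neg hQ]
          simp
      exact memLp_free_combination (-(S.ε : ℂ)) z σ₃ _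
        (memLp_cutoff_apply (Set.Ioi n) (U G : Hilb d)) h3
    · filter_upwards [h2, hR₀ (U G), Lp.coeFn_add (G : Hilb d) (z • (R G : Hilb d)),
        Lp.coeFn_smul z (R G : Hilb d)] with Q h3 h4 h5 h6 hQ
      change ((G : Hilb d) + z • (R G : Hilb d) : Hilb d) Q = _
      rw [h5, Pi.add_apply, h6, Pi.smul_apply, hamiltonian, h3 hQ]
      have h7 := S.freeHamiltonian_cutRes_apply hη hz hQ ((U G : Hilb d) Q)
      rw [← h4, ← hRval] at h7
      rw [h7]
      abel
  refine ⟨R, R₀, (α : ℂ) • W, ⟨hgraph, fun F G hFG => ?_⟩, hscale W hW, hR₀, fun F hF => ?_,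
    fun G => ?_⟩
  · -- `R` is a left inverse
    obtain ⟨hω, hG⟩ := hFG
    have hF' : MemLp (fun Q => (S.ε : ℂ) • σ₃ ((F : Hilb d) Q)
        + (S.omegaConf Q : ℂ) • (F : Hilb d) Q - z • (F : Hilb d) Q) 2 (lebesguePoisson d) :=
      memLp_free_combination (S.ε : ℂ) (-z) σ₃ (F : Hilb d) hω
        (Eventually.of_forall fun Q => by simp only [neg_smul]; abel)
    set F' : Hilb d := hF'.toLp with hF'def
    have hF'v : F' =ᵐ[lebesguePoisson d] fun Q => (S.ε : ℂ) • σ₃ ((F : Hilb d) Q)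
        + (S.omegaConf Q : ℂ) • (F : Hilb d) Q - z • (F : Hilb d) Q := hF'.coeFn_toLp
    have hFs : ∀ᵐ Q ∂lebesguePoisson d, Q.card ∉ Set.Ioi n → (F : Hilb d) Q = 0 := F.2
    have hR₀F : R₀ F' = F := by
      refine Lp.ext ?_
      filter_upwards [hR₀ F', hF'v, hFs] with Q h1 h2 h3
      rw [h1]
      by_cases hQ : n < Q.card
      · rw [h2, S.cutRes_freeHamiltonian_apply hη hz hQ]
      · rw [h3 hQ, cutRes, if_neg hQ]
        rfl
    have hGF : ((G - z • F : HilbGt d n) : Hilb d) = F' + (α : ℂ) • V F' := by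
      have hGs : ∀ᵐ Q ∂lebesguePoisson d, Q.card ∉ Set.Ioi n →
          ((G - z • F : HilbGt d n) : Hilb d) Q = 0 := (G - z • F).2
      refine Lp.ext ?_
      change ((G : Hilb d) - z • (F : Hilb d) : Hilb d) =ᵐ[_] _
      filter_upwards [hVval F' F hR₀F, hF'v, hG, hFs, hGs, hV' F',
        Lp.coeFn_smul (α : ℂ) (V F'), Lp.coeFn_add F' ((α : ℂ) • V F'),
        Lp.coeFn_sub (G : Hilb d) (z • (F : Hilb d)), Lp.coeFn_smul z (F : Hilb d)]
        with Q h1 h2 h3 h4 h5 h6 h7 h8 h9 h10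
      by_cases hQ : n < Q.card
      · rw [h9, Pi.sub_apply, h10, Pi.smul_apply, h8, Pi.add_apply, h1 hQ, h2, h3 hQ, hamiltonian]
        change (S.ε : ℂ) • σ₃ ((F : Hilb d) Q) + (S.omegaConf Q : ℂ) • (F : Hilb d) Q + _ - _ = _
        abel
      · refine (h5 hQ).trans ?_
        rw [h8, Pi.add_apply, h2, h7, Pi.smul_apply, h6, cutoff_apply,
          if_neg (show Q.card ∉ Set.Ioi n from hQ), h4 hQ]
        simp
    refine Subtype.ext ?_
    rw [hRval, hGF, hUl, hR₀F]
  · filter_upwards [hW' F, Lp.coeFn_smul (α : ℂ) (W F),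
      S.create_congr_ae (cutoff_apply_ae (Set.Ioi n) hF),
      S.annihilate_congr_ae (cutoff_apply_ae (Set.Ioi n) hF)] with Q h1 h2 h3 h4
    change ((α : ℂ) • W F : Hilb d) Q = _
    rw [h2, Pi.smul_apply, h1, h3, h4, map_smul]
  · -- `W (R₀ F) = R₀ (α V F)` by a pointwise comparison
    have h0 : ((α : ℂ) • W) (R G : Hilb d) = R₀ ((α : ℂ) • V (U G)) := by
      refine Lp.ext ?_
      have hF := cutoff_apply_ae (Set.Ioi n) (R G).2
      filter_upwards [hW' (R G : Hilb d), Lp.coeFn_smul (α : ℂ) (W (R G : Hilb d)),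
        hR₀ ((α : ℂ) • V (U G)), hVval (U G) (R G) rfl, S.create_congr_ae hF,
        S.annihilate_congr_ae hF] with Q h1 h2 h3 h4 h5 h6
      change ((α : ℂ) • W (R G : Hilb d) : Hilb d) Q = _
      rw [h2, Pi.smul_apply, h1, h3, h5, h6]
      by_cases hQ : n < Q.card
      · rw [h4 hQ, map_smul]
      · rw [cutRes, if_neg hQ]
        simp
    rw [h0, hRval, ← map_add, hUr]

end Model

/-! ### Adding several points to a configuration -/

theorem measurable_conf_add_conf (d l m : ℕ) :
    Measurable fun p : (Fin l → E d) × (Fin m → E d) => conf p.1 + conf p.2 := by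
  have h1 : (fun p : (Fin l → E d) × (Fin m → E d) => conf p.1 + conf p.2)
      = fun p => conf fun i =>
        (Sum.elim p.1 p.2 : Fin l ⊕ Fin m → E d) (finSumFinEquiv.symm i) := by
    funext p
    rw [conf_comp_equiv, conf_sumElim]
    rfl
  rw [h1]
  refine (measurable_conf d (l + m)).comp (measurable_pi_lambda _ fun i => ?_)
  rcases finSumFinEquiv.symm i with j | j
  · exact (measurable_pi_apply j).comp measurable_fst
  · exact (measurable_pi_apply j).comp measurable_snd

theorem measurable_add_conf {d : ℕ} (Q : Conf d) (m : ℕ) :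
    Measurable fun k : Fin m → E d => Q + conf k := by
  obtain ⟨x, hx⟩ := exists_conf_eq Q
  rw [← hx]
  exact (measurable_conf_add_conf d _ m).comp measurable_prodMk_left

theorem measurable_lintegral_add_conf {d : ℕ} {G : Conf d → ℝ≥0∞} (hG : Measurable G) (m : ℕ) :
    Measurable fun Q : Conf d => ∫⁻ k : Fin m → E d, G (Q + conf k) :=
  measurable_of_conf fun l => (hG.comp (measurable_conf_add_conf d l m)).lintegral_prod_right'

theorem lintegral_fin_succ {d : ℕ} {G : Conf d → ℝ≥0∞} (hG : Measurable G) (Q : Conf d) (m : ℕ) :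
    ∫⁻ k : Fin (m + 1) → E d, G (Q + conf k)
      = ∫⁻ q : E d, ∫⁻ k : Fin m → E d, G (q ::ₘ Q + conf k) := by
  have hp := volume_preserving_piFinSuccAbove (fun _ : Fin (m + 1) => E d) 0
  have hm : Measurable fun p : E d × (Fin m → E d) => G (p.1 ::ₘ Q + conf p.2) := by
    have h1 : (fun p : E d × (Fin m → E d) => p.1 ::ₘ Q + conf p.2)
        = fun p => Q + conf (Fin.cons p.1 p.2 : Fin (m + 1) → E d) := by
      funext p
      rw [conf_cons, Multiset.cons_add, Multiset.add_cons]
    refine hG.comp ?_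
    rw [h1]
    exact (measurable_add_conf Q (m + 1)).comp (by fun_prop)
  have h2 := lintegral_prod (μ := volume) (ν := volume) _ hm.aemeasurable
  refine Eq.trans ?_ h2
  refine Eq.trans (lintegral_congr fun k => ?_) (hp.lintegral_comp hm)
  rw [conf_eq_cons_succAbove k 0, Multiset.add_cons]
  change _ = G (k 0 ::ₘ Q + conf fun j => k ((0 : Fin (m + 1)).succAbove j))
  rw [Multiset.cons_add]

/-- The Mecke formula for `m` points. -/
theorem lintegral_lintegral_add_conf {d : ℕ} (m : ℕ) {G : Conf d → ℝ≥0∞} (hG : Measurable G) :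
    ∫⁻ Q, ∫⁻ k : Fin m → E d, G (Q + conf k) ∂volume ∂lebesguePoisson d
      = ∫⁻ Q, (Q.card.descFactorial m : ℝ≥0∞) * G Q ∂lebesguePoisson d := by
  induction m generalizing G with
  | zero =>
    refine lintegral_congr fun Q => ?_
    rw [volume_pi, Measure.pi_of_empty (fun _ : Fin 0 => (volume : Measure (E d))) 0,
      lintegral_dirac, conf_fin_zero, add_zero, Nat.descFactorial_zero, Nat.cast_one, one_mul]
  | succ m ih =>
    have hG2 : Measurable fun Q : Conf d => ((Q.card - m : ℕ) : ℝ≥0∞) * G Q :=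
      ((measurable_from_top (f := fun l : ℕ => ((l - m : ℕ) : ℝ≥0∞))).comp measurable_card).mul hG
    calc ∫⁻ Q, ∫⁻ k : Fin (m + 1) → E d, G (Q + conf k) ∂volume ∂lebesguePoisson d
        = ∫⁻ Q, ∫⁻ q : E d, ∫⁻ k : Fin m → E d, G (q ::ₘ Q + conf k) ∂volume ∂volume
            ∂lebesguePoisson d := lintegral_congr fun Q => lintegral_fin_succ hG Q m
      _ = ∫⁻ Q, Q.card * ∫⁻ k : Fin m → E d, G (Q + conf k) ∂volume ∂lebesguePoisson d :=
          mecke_cons (measurable_lintegral_add_conf hG m)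
      _ = ∫⁻ Q, ∫⁻ k : Fin m → E d, ((Q + conf k).card - m : ℕ) * G (Q + conf k)
            ∂volume ∂lebesguePoisson d := by
          refine lintegral_congr fun Q => ?_
          have hGk : Measurable fun k : Fin m → E d => G (Q + conf k) :=
            hG.comp (measurable_add_conf Q m)
          rw [← lintegral_const_mul _ hGk]
          refine lintegral_congr fun k => ?_
          rw [Multiset.card_add, card_conf, Fintype.card_fin, Nat.add_sub_cancel]
      _ = _ := by
          rw [ih hG2]
          refine lintegral_congr fun Q => ?_
          rw [Nat.descFactorial_succ, Nat.cast_mul]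
          ring

/-- The functions `k ↦ f(Q ∪ {k₁, ..., k_m})` are integrable against `∏ h(k_i)`, so that the
integrals of `f` against coefficient functions converge absolutely. -/
def IsGood {d : ℕ} (h : E d → ℝ) (f : Conf d → Spin) (Q : Conf d) : Prop :=
  ∀ m : ℕ, Integrable (fun k : Fin m → E d => (∏ i, h (k i)) * ‖f (Q + conf k)‖) volume

theorem memLp_prod_h {d m : ℕ} {h : E d → ℝ} (hh : MemLp h 2 volume) :
    MemLp (fun k : Fin m → E d => ∏ i, h (k i)) 2 volume := by
  have hm : AEStronglyMeasurable (fun k : Fin m → E d => ∏ i, h (k i)) volume := by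
    refine Finset.aestronglyMeasurable_fun_prod _ fun i _ => ?_
    exact hh.1.comp_quasiMeasurePreserving (Measure.quasiMeasurePreserving_eval _ i)
  rw [memLp_two_iff_integrable_sq hm]
  simp only [← Finset.prod_pow]
  exact Integrable.fintype_prod (f := fun _ : Fin m => fun q => h q ^ 2) fun _ => hh.integrable_sq

/-- By the Mecke formula `k ↦ f(Q ∪ {k₁, ..., k_m})` is square integrable for almost every `Q`.  The
number of bosons is fixed, so the combinatorial factor in the Mecke formula is bounded. -/
theorem ae_isGood {d n : ℕ} {h : E d → ℝ} (hh : MemLp h 2 volume) (f : HilbEq d n) :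
    ∀ᵐ Q ∂lebesguePoisson d, IsGood h (f : Hilb d) Q := by
  have hf : StronglyMeasurable (f : Hilb d) := Lp.stronglyMeasurable _
  have hG : Measurable fun Q : Conf d => ‖(f : Hilb d) Q‖ₑ ^ 2 := hf.measurable.enorm.pow_const 2
  have hfs : ∀ᵐ Q ∂lebesguePoisson d, Q.card ∉ ({n} : Set ℕ) → (f : Hilb d) Q = 0 := f.2
  refine ae_all_iff.2 fun m => ?_
  have h1 : ∫⁻ Q, ∫⁻ k : Fin m → E d, ‖(f : Hilb d) (Q + conf k)‖ₑ ^ 2 ∂volume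
      ∂lebesguePoisson d ≠ ∞ := by
    rw [lintegral_lintegral_add_conf m hG]
    have h2 : ∫⁻ Q, (Q.card.descFactorial m : ℝ≥0∞) * ‖(f : Hilb d) Q‖ₑ ^ 2 ∂lebesguePoisson d
        = (n.descFactorial m : ℝ≥0∞) * ∫⁻ Q, ‖(f : Hilb d) Q‖ₑ ^ 2 ∂lebesguePoisson d := by
      rw [← lintegral_const_mul _ hG]
      refine lintegral_congr_ae ?_
      filter_upwards [hfs] with Q hQ
      by_cases hc : Q.card = n
      · rw [hc]
      · rw [hQ hc, enorm_zero, zero_pow two_ne_zero, mul_zero, mul_zero]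
    rw [h2, ← eLpNorm_two_sq]
    exact ENNReal.mul_ne_top (ENNReal.natCast_ne_top _)
      (ENNReal.pow_ne_top (Lp.memLp (f : Hilb d)).2.ne)
  filter_upwards [ae_lt_top (measurable_lintegral_add_conf hG m) h1] with Q hQ
  have hsm : StronglyMeasurable fun k : Fin m → E d => (f : Hilb d) (Q + conf k) :=
    hf.comp_measurable (measurable_add_conf Q m)
  have h3 : MemLp (fun k : Fin m → E d => (f : Hilb d) (Q + conf k)) 2 volume := by
    refine ⟨hsm.aestronglyMeasurable, ?_⟩
    have h4 := eLpNorm_two_sq (volume : Measure (Fin m → E d))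
      (fun k : Fin m → E d => (f : Hilb d) (Q + conf k))
    rw [← h4] at hQ
    exact (ENNReal.pow_lt_top_iff.1 hQ).resolve_right two_ne_zero
  exact (memLp_prod_h hh).integrable_mul h3.norm

/-! ### Vectors given by coefficient functions -/

/-- `∫ μ^{(m)}(Q₁; Q₂; k) f(Q₂ ∪ k) dk`, where `k` ranges over `m`-tuples. -/
noncomputable def term {d : ℕ} (μ : Coeff d) (f : Conf d → Spin) (m : ℕ) (Q₁ Q₂ : Conf d) : Spin :=
  ∫ k : Fin m → E d, (μ m Q₁ Q₂ k) (f (Q₂ + conf k))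

/-- The right-hand side of `IsRepresentedBy`: the image of `f` under the operator with coefficient
functions `μ`. -/
noncomputable def rep {d : ℕ} (n : ℕ) (μ : Coeff d) (f : Conf d → Spin) (Q : Conf d) : Spin :=
  ∑ m ∈ Finset.range (n + 1),
    ((Q.powersetCard (n - m)).map fun Q' => term μ f m (Q - Q') Q').sum

theorem isRepresentedBy_of_rep {d n : ℕ} {h : E d → ℝ} {M : HilbEq d n →L[ℂ] HilbGt d n}
    {μ : CoeffSpace h n} (hM : ∀ f : HilbEq d n,
      (M f : Hilb d) =ᵐ[lebesguePoisson d] rep n μ.fn (f : Hilb d)) : IsRepresentedBy M μ := by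
  intro f
  filter_upwards [hM f] with Q hQ _
  rw [hQ]
  simp only [rep, term]

/-- For `|Q| ≤ n` the support condition on coefficient functions fails for every summand. -/
theorem rep_eq_zero {d n : ℕ} {h : E d → ℝ} (μ : CoeffSpace h n) (f : Conf d → Spin) {Q : Conf d}
    (hQ : Q.card ≤ n) : rep n μ.fn f Q = 0 := by
  refine Finset.sum_eq_zero fun m hm => ?_
  refine Multiset.sum_eq_zero fun v hv => ?_
  obtain ⟨Q', hQ', rfl⟩ := Multiset.mem_map.1 hv
  obtain ⟨hle, hc⟩ := Multiset.mem_powersetCard.1 hQ'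
  have h1 : ∀ k, μ.fn m (Q - Q') Q' k = 0 := fun k => μ.eq_zero (by
    rw [Multiset.card_sub hle]
    rw [Finset.mem_range] at hm
    omega) k
  simp [term, h1]

theorem stronglyMeasurable_comp_add_conf {d : ℕ} {f : Conf d → Spin} (hf : StronglyMeasurable f)
    (Q : Conf d) (m : ℕ) : StronglyMeasurable fun k : Fin m → E d => f (Q + conf k) :=
  hf.comp_measurable (measurable_add_conf Q m)

theorem CoeffSpace.continuous_joint_comp {d n : ℕ} {h : E d → ℝ} (μ : CoeffSpace h n) {X : Type*}
    [TopologicalSpace X] {m l r : ℕ} {a : X → Fin l → E d} {b : X → Fin r → E d}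
    {c : X → Fin m → E d} (ha : Continuous a) (hb : Continuous b) (hc : Continuous c) :
    Continuous fun x => μ.fn m (conf (a x)) (conf (b x)) (c x) := by
  have h1 : (fun x => μ.fn m (conf (a x)) (conf (b x)) (c x))
      = fun x => joint μ.fn m l r (Sum.elim (a x) (Sum.elim (b x) (c x))) := rfl
  rw [h1]
  refine (μ.c1Bound m l r).contDiff.continuous.comp (continuous_pi fun i => ?_)
  rcases i with i | i | i
  · exact (continuous_apply i).comp ha
  · exact (continuous_apply i).comp hb
  · exact (continuous_apply i).comp hc

theorem CoeffSpace.continuous_fn {d n : ℕ} {h : E d → ℝ} (μ : CoeffSpace h n) (m : ℕ)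
    (Q₁ Q₂ : Conf d) : Continuous fun k => μ.fn m Q₁ Q₂ k := by
  obtain ⟨a, ha⟩ := exists_conf_eq Q₁
  obtain ⟨b, hb⟩ := exists_conf_eq Q₂
  rw [← ha, ← hb]
  exact μ.continuous_joint_comp continuous_const continuous_const continuous_id

theorem exists_clm_multiset_sum {V W ι : Type*} [NormedAddCommGroup V] [NormedSpace ℂ V]
    [NormedAddCommGroup W] [NormedSpace ℂ W] (s : Multiset ι) (φ : ι → V → W)
    (hφ : ∀ i ∈ s, ∃ L : V →L[ℂ] W, ∀ v, L v = φ i v) :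
    ∃ L : V →L[ℂ] W, ∀ v, L v = (s.map fun i => φ i v).sum := by
  induction s using Multiset.induction with
  | empty => exact ⟨0, fun v => by simp⟩
  | cons a s ih =>
    obtain ⟨L, hL⟩ := ih fun i hi => hφ i (Multiset.mem_cons_of_mem hi)
    obtain ⟨L', hL'⟩ := hφ a (Multiset.mem_cons_self a s)
    exact ⟨L' + L, fun v => by simp [hL, hL']⟩

/-- The splitting of an `(m + 1)`-tuple into its last entry and the others. -/
theorem splitLast_eq (d m : ℕ) :
    (fun k : Fin (m + 1) → E d => (k (Fin.last m), (Fin.init k : Fin m → E d)))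
      = MeasurableEquiv.piFinSuccAbove (fun _ : Fin (m + 1) => E d) (Fin.last m) := by
  funext k
  refine Prod.ext rfl (funext fun i => ?_)
  change k i.castSucc = k ((Fin.last m).succAbove i)
  rw [Fin.succAbove_last]

theorem measurePreserving_splitLast (d m : ℕ) :
    MeasurePreserving (fun k : Fin (m + 1) → E d => (k (Fin.last m), (Fin.init k : Fin m → E d)))
      volume ((volume : Measure (E d)).prod volume) := by
  rw [splitLast_eq]
  exact volume_preserving_piFinSuccAbove (fun _ : Fin (m + 1) => E d) (Fin.last m)

theorem measurableEmbedding_splitLast (d m : ℕ) :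
    MeasurableEmbedding
      (fun k : Fin (m + 1) → E d => (k (Fin.last m), (Fin.init k : Fin m → E d))) := by
  rw [splitLast_eq]
  exact MeasurableEquiv.measurableEmbedding _

theorem add_conf_splitLast {d : ℕ} (Q : Conf d) {m : ℕ} (k : Fin (m + 1) → E d) :
    Q + conf k = k (Fin.last m) ::ₘ Q + conf (Fin.init k : Fin m → E d) := by
  rw [conf_eq_cons_succAbove k (Fin.last m), Multiset.add_cons, Multiset.cons_add]
  simp only [Fin.succAbove_last]
  rfl

theorem multiset_sum_apply {ι : Type*} (s : Multiset ι) (A : ι → M2) (v : Spin) :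
    (s.map A).sum v = (s.map fun i => A i v).sum := by
  induction s using Multiset.induction with
  | empty => simp
  | cons a s ih => simp only [Multiset.map_cons, Multiset.sum_cons, add_apply, ih]

namespace Model

variable {d : ℕ} (S : Model d)

theorem prod_conf_le_one (Q : Conf d) : 0 ≤ (Q.map S.h).prod ∧ (Q.map S.h).prod ≤ 1 := by
  have := S.norm_prod_le_one (m := 0) Q Fin.elim0
  simpa [and_comm] using this

theorem prod_h_nonneg {m : ℕ} (k : Fin m → E d) : 0 ≤ ∏ i, S.h (k i) :=
  Finset.prod_nonneg fun _ _ => S.h_nonneg _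

theorem norm_fn_apply_le {n : ℕ} (μ : CoeffSpace S.h n) (m : ℕ) (Q₁ Q₂ : Conf d)
    (k : Fin m → E d) (v : Spin) :
    ‖μ.fn m Q₁ Q₂ k v‖ ≤ ‖μ‖ * ((∏ i, S.h (k i)) * ‖v‖) := by
  have h1 := (μ.fn m Q₁ Q₂ k).le_opNorm v
  have h2 := μ.norm_fn_le m Q₁ Q₂ k
  have h3 := S.prod_conf_le_one Q₁
  refine h1.trans ?_
  rw [← mul_assoc]
  refine mul_le_mul_of_nonneg_right (h2.trans ?_) (norm_nonneg v)
  exact mul_le_mul_of_nonneg_left (mul_le_of_le_one_left (S.prod_h_nonneg k) h3.2) (norm_nonneg μ)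

theorem integrable_fn_apply {n : ℕ} (μ : CoeffSpace S.h n) {f : Conf d → Spin}
    (hf : StronglyMeasurable f) {Q₂ : Conf d} (hg : IsGood S.h f Q₂) (m : ℕ) (Q₁ : Conf d) :
    Integrable (fun k : Fin m → E d => μ.fn m Q₁ Q₂ k (f (Q₂ + conf k))) volume := by
  refine ((hg m).const_mul ‖μ‖).mono' ?_ (Eventually.of_forall fun k =>
    S.norm_fn_apply_le μ m Q₁ Q₂ k _)
  exact (stronglyMeasurable_clm_apply (μ.continuous_fn m Q₁ Q₂).stronglyMeasurable
    (stronglyMeasurable_comp_add_conf hf Q₂ m)).aestronglyMeasurable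

/-- `term` is a bounded linear function of the coefficient functions. -/
theorem exists_term_clm (n : ℕ) {f : Conf d → Spin}
    (hf : StronglyMeasurable f) {Q₂ : Conf d} (hg : IsGood S.h f Q₂) (m : ℕ) (Q₁ : Conf d) :
    ∃ L : CoeffSpace S.h n →L[ℂ] Spin, ∀ μ, L μ = term μ.fn f m Q₁ Q₂ := by
  refine ⟨LinearMap.mkContinuous
    { toFun := fun μ => term μ.fn f m Q₁ Q₂
      map_add' := fun μ ν => ?_
      map_smul' := fun a μ => ?_ }
    (∫ k : Fin m → E d, (∏ i, S.h (k i)) * ‖f (Q₂ + conf k)‖) fun μ => ?_, fun μ => rfl⟩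
  · exact integral_add (S.integrable_fn_apply μ hf hg m Q₁) (S.integrable_fn_apply ν hf hg m Q₁)
  · exact integral_smul a fun k : Fin m → E d => μ.fn m Q₁ Q₂ k (f (Q₂ + conf k))
  · rw [mul_comm, ← integral_const_mul]
    exact norm_integral_le_of_norm_le ((hg m).const_mul ‖μ‖)
      (Eventually.of_forall fun k => S.norm_fn_apply_le μ m Q₁ Q₂ k _)

/-- At a fixed good configuration `rep` is a bounded linear function of the coefficient
functions. -/
theorem exists_rep_clm (n : ℕ) {f : Conf d → Spin}
    (hf : StronglyMeasurable f) {Q : Conf d} (hg : ∀ Q' ≤ Q, IsGood S.h f Q') :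
    ∃ L : CoeffSpace S.h n →L[ℂ] Spin, ∀ μ, L μ = rep n μ.fn f Q := by
  refine exists_clm_multiset_sum (Finset.range (n + 1)).val _ fun m _ => ?_
  refine exists_clm_multiset_sum (Q.powersetCard (n - m))
    (fun Q' (μ : CoeffSpace S.h n) => term μ.fn f m (Q - Q') Q') fun Q' hQ' => ?_
  exact S.exists_term_clm n hf (hg _ (Multiset.mem_powersetCard.1 hQ').1) m _

/-! ### `Γ(z)` on coefficient functions and the field operator on vectors -/

theorem integrable_annihilate_prod {n : ℕ} (μ : CoeffSpace S.h n) {f : Conf d → Spin}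
    (hf : StronglyMeasurable f) {Q₂ : Conf d} (hg : IsGood S.h f Q₂) (m : ℕ) (Q₁ : Conf d) :
    Integrable (fun p : E d × (Fin m → E d) =>
      conj (S.lam p.1) • μ.fn m (p.1 ::ₘ Q₁) Q₂ p.2 (f (Q₂ + conf p.2)))
      ((volume : Measure (E d)).prod volume) := by
  refine ((S.integrable_h_sq.mul_prod (hg m)).const_mul ‖μ‖).mono' ?_
    (Eventually.of_forall fun p => ?_)
  · obtain ⟨a, ha⟩ := exists_conf_eq Q₁
    obtain ⟨b, hb⟩ := exists_conf_eq Q₂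
    have h1 : Continuous fun p : E d × (Fin m → E d) => μ.fn m (p.1 ::ₘ Q₁) Q₂ p.2 := by
      rw [← ha, ← hb]
      simp only [← conf_cons]
      exact μ.continuous_joint_comp (by fun_prop) continuous_const continuous_snd
    exact ((S.continuous_conj_lam.comp continuous_fst).stronglyMeasurable.smul
      (stronglyMeasurable_clm_apply h1.stronglyMeasurable
        ((stronglyMeasurable_comp_add_conf hf Q₂ m).comp_measurable
          measurable_snd))).aestronglyMeasurable
  · have h1 := (μ.fn m (p.1 ::ₘ Q₁) Q₂ p.2).le_opNorm (f (Q₂ + conf p.2))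
    have h2 := μ.norm_fn_le m (p.1 ::ₘ Q₁) Q₂ p.2
    rw [Multiset.map_cons, Multiset.prod_cons] at h2
    have h3 := S.prod_conf_le_one Q₁
    have h4 := S.h_nonneg p.1
    have h5 := S.prod_h_nonneg p.2
    have h6 : ‖μ.fn m (p.1 ::ₘ Q₁) Q₂ p.2‖ ≤ ‖μ‖ * (S.h p.1 * ∏ i, S.h (p.2 i)) := by
      refine h2.trans (mul_le_mul_of_nonneg_left (mul_le_mul_of_nonneg_right ?_ h5) (norm_nonneg μ))
      exact mul_le_of_le_one_right h4 h3.2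
    rw [norm_smul]
    calc _ ≤ S.h p.1 * (‖μ‖ * (S.h p.1 * ∏ i, S.h (p.2 i)) * ‖f (Q₂ + conf p.2)‖) :=
          mul_le_mul (S.norm_conj_lam_le _)
            (h1.trans (mul_le_mul_of_nonneg_right h6 (norm_nonneg _))) (norm_nonneg _) h4
      _ = _ := by ring

/-- This is integrability against `∏ h(k_i)` over `m + 1` variables, the last of which is `q`. -/
theorem integrable_lower_prod {n : ℕ} (μ : CoeffSpace S.h n) {f : Conf d → Spin}
    (hf : StronglyMeasurable f) {Q₂ : Conf d} (hg : IsGood S.h f Q₂) (m : ℕ) (Q₁ : Conf d) :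
    Integrable (fun p : E d × (Fin m → E d) =>
      conj (S.lam p.1) • μ.fn m Q₁ (p.1 ::ₘ Q₂) p.2 (f (p.1 ::ₘ Q₂ + conf p.2)))
      ((volume : Measure (E d)).prod volume) := by
  have hH : Integrable (fun p : E d × (Fin m → E d) =>
      (S.h p.1 * ∏ i, S.h (p.2 i)) * ‖f (p.1 ::ₘ Q₂ + conf p.2)‖)
      ((volume : Measure (E d)).prod volume) := by
    rw [← (measurePreserving_splitLast d m).integrable_comp_emb
      (measurableEmbedding_splitLast d m)]
    refine (hg (m + 1)).congr (Eventually.of_forall fun k => ?_)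
    change (∏ i, S.h (k i)) * ‖f (Q₂ + conf k)‖
      = (S.h (k (Fin.last m)) * ∏ i : Fin m, S.h (k i.castSucc)) * ‖f (_ + conf (Fin.init k))‖
    rw [add_conf_splitLast, Fin.prod_univ_castSucc, mul_comm (∏ i : Fin m, _)]
  obtain ⟨a, ha⟩ := exists_conf_eq Q₁
  obtain ⟨b, hb⟩ := exists_conf_eq Q₂
  refine (hH.const_mul ‖μ‖).mono' ?_ (Eventually.of_forall fun p => ?_)
  · have h1 : Continuous fun p : E d × (Fin m → E d) => μ.fn m Q₁ (p.1 ::ₘ Q₂) p.2 := by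
      rw [← ha, ← hb]
      simp only [← conf_cons]
      exact μ.continuous_joint_comp continuous_const (by fun_prop) continuous_snd
    have h2 : Measurable fun p : E d × (Fin m → E d) => p.1 ::ₘ Q₂ + conf p.2 := by
      rw [← hb]
      simp only [← conf_cons]
      exact (measurable_conf_add_conf d _ m).comp (f := fun p : E d × (Fin m → E d) =>
        ((Fin.cons p.1 b : Fin _ → E d), p.2)) (by fun_prop)
    exact ((S.continuous_conj_lam.comp continuous_fst).stronglyMeasurable.smul
      (stronglyMeasurable_clm_apply h1.stronglyMeasurable
        (hf.comp_measurable h2))).aestronglyMeasurable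
  · have h1 := S.norm_fn_apply_le μ m Q₁ (p.1 ::ₘ Q₂) p.2 (f (p.1 ::ₘ Q₂ + conf p.2))
    rw [norm_smul]
    calc _ ≤ S.h p.1 * (‖μ‖ * ((∏ i, S.h (p.2 i)) * ‖f (p.1 ::ₘ Q₂ + conf p.2)‖)) :=
          mul_le_mul (S.norm_conj_lam_le _) h1 (norm_nonneg _) (S.h_nonneg _)
      _ = _ := by ring

/-- The contribution of `lowerTerm` to the vector represented: the integration variable `k_m` has
joined the points of `Q₂`. -/
noncomputable def lowerRep (μ : Coeff d) (f : Conf d → Spin) (Q₁ Q₂ : Conf d) : ℕ → Spin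
  | 0 => 0
  | m + 1 => ∫ q : E d, conj (S.lam q) • term μ f m Q₁ (q ::ₘ Q₂)

theorem integrable_lowerTerm_apply {n : ℕ} (μ : CoeffSpace S.h n) {f : Conf d → Spin}
    (hf : StronglyMeasurable f) {Q₂ : Conf d} (hg : IsGood S.h f Q₂) (m : ℕ) (Q₁ : Conf d) :
    Integrable (fun k : Fin m → E d => S.lowerTerm μ.fn Q₁ Q₂ m k (f (Q₂ + conf k))) volume ∧
      ∫ k : Fin m → E d, S.lowerTerm μ.fn Q₁ Q₂ m k (f (Q₂ + conf k))
        = S.lowerRep μ.fn f Q₁ Q₂ m := by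
  cases m with
  | zero =>
    simp only [lowerTerm, lowerRep]
    exact ⟨by simp, by simp⟩
  | succ m =>
    have h1 := S.integrable_lower_prod μ hf hg m Q₁
    have h2 : (fun k : Fin (m + 1) → E d => S.lowerTerm μ.fn Q₁ Q₂ (m + 1) k (f (Q₂ + conf k)))
        = (fun p : E d × (Fin m → E d) =>
          conj (S.lam p.1) • μ.fn m Q₁ (p.1 ::ₘ Q₂) p.2 (f (p.1 ::ₘ Q₂ + conf p.2)))
          ∘ fun k : Fin (m + 1) → E d => (k (Fin.last m), (Fin.init k : Fin m → E d)) := by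
      funext k
      rw [add_conf_splitLast]
      rfl
    rw [h2]
    refine ⟨((measurePreserving_splitLast d m).integrable_comp_emb
      (measurableEmbedding_splitLast d m)).2 h1, ?_⟩
    refine ((measurePreserving_splitLast d m).integral_comp
      (measurableEmbedding_splitLast d m) fun p : E d × (Fin m → E d) =>
        conj (S.lam p.1) • μ.fn m Q₁ (p.1 ::ₘ Q₂) p.2 (f (p.1 ::ₘ Q₂ + conf p.2))).trans ?_
    rw [integral_prod _ h1, lowerRep]
    exact integral_congr_ae (Eventually.of_forall fun q => integral_smul (conj (S.lam q))
      fun k : Fin m → E d => μ.fn m Q₁ (q ::ₘ Q₂) k (f (q ::ₘ Q₂ + conf k)))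

theorem integrable_annihilate_apply {n : ℕ} (μ : CoeffSpace S.h n) {f : Conf d → Spin}
    (hf : StronglyMeasurable f) {Q₂ : Conf d} (hg : IsGood S.h f Q₂) (m : ℕ) (Q₁ : Conf d) :
    Integrable (fun k : Fin m → E d =>
        (∫ q : E d, conj (S.lam q) • μ.fn m (q ::ₘ Q₁) Q₂ k) (f (Q₂ + conf k))) volume ∧
      ∫ k : Fin m → E d,
          (∫ q : E d, conj (S.lam q) • μ.fn m (q ::ₘ Q₁) Q₂ k) (f (Q₂ + conf k))
        = ∫ q : E d, conj (S.lam q) • term μ.fn f m (q ::ₘ Q₁) Q₂ := by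
  have h1 := S.integrable_annihilate_prod μ hf hg m Q₁
  have h2 : (fun k : Fin m → E d =>
      (∫ q : E d, conj (S.lam q) • μ.fn m (q ::ₘ Q₁) Q₂ k) (f (Q₂ + conf k)))
      = fun k => ∫ q : E d, conj (S.lam q) • μ.fn m (q ::ₘ Q₁) Q₂ k (f (Q₂ + conf k)) := by
    funext k
    exact ContinuousLinearMap.integral_apply (S.integrable_conj_lam_smul μ m Q₁ Q₂ k) _
  rw [h2]
  refine ⟨h1.integral_prod_right, ?_⟩
  rw [← integral_prod_symm _ h1, integral_prod _ h1]
  exact integral_congr_ae (Eventually.of_forall fun q => integral_smul (conj (S.lam q))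
    fun k : Fin m → E d => μ.fn m (q ::ₘ Q₁) Q₂ k (f (Q₂ + conf k)))

theorem integrable_create_apply {n : ℕ} (μ : CoeffSpace S.h n) {f : Conf d → Spin}
    (hf : StronglyMeasurable f) {Q₂ : Conf d} (hg : IsGood S.h f Q₂) (m : ℕ) (Q₁ s : Conf d) :
    Integrable (fun k : Fin m → E d =>
        (s.map fun q => S.lam q • μ.fn m (Q₁.erase q) Q₂ k).sum (f (Q₂ + conf k))) volume ∧
      ∫ k : Fin m → E d,
          (s.map fun q => S.lam q • μ.fn m (Q₁.erase q) Q₂ k).sum (f (Q₂ + conf k))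
        = (s.map fun q => S.lam q • term μ.fn f m (Q₁.erase q) Q₂).sum := by
  simp only [multiset_sum_apply]
  induction s using Multiset.induction with
  | empty => simp
  | cons a s ih =>
    simp only [Multiset.map_cons, Multiset.sum_cons]
    have h1 : Integrable (fun k : Fin m → E d =>
        (S.lam a • μ.fn m (Q₁.erase a) Q₂ k) (f (Q₂ + conf k))) volume :=
      (S.integrable_fn_apply μ hf hg m (Q₁.erase a)).smul (S.lam a)
    refine ⟨h1.add ih.1, ?_⟩
    rw [integral_add h1 ih.1, ih.2]
    congr 1
    exact integral_smul (S.lam a) fun k : Fin m → E d =>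
      μ.fn m (Q₁.erase a) Q₂ k (f (Q₂ + conf k))

/-- The pointwise action of `Γ(z)`: on the vector represented, it is the free resolvent applied to
`σ₁` times the field operator. -/
theorem term_Gam {n : ℕ} (α : ℝ) (z : ℂ) (μ : CoeffSpace S.h n) {f : Conf d → Spin}
    (hf : StronglyMeasurable f) {Q₁ Q₂ : Conf d} (hg : IsGood S.h f Q₂) {m : ℕ}
    (hm : m < Q₁.card ∧ Q₂.card + m = n) :
    term (S.Gam α n z μ.fn) f m Q₁ Q₂ = S.freeRes z (Q₁ + Q₂) ((α : ℂ) • σ₁ (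
      (Q₁.map fun q => S.lam q • term μ.fn f m (Q₁.erase q) Q₂).sum
        + (∫ q : E d, conj (S.lam q) • term μ.fn f m (q ::ₘ Q₁) Q₂)
        + S.lowerRep μ.fn f Q₁ Q₂ m)) := by
  obtain ⟨i1, e1⟩ := S.integrable_create_apply μ hf hg m Q₁ Q₁
  obtain ⟨i2, e2⟩ := S.integrable_annihilate_apply μ hf hg m Q₁
  obtain ⟨i3, e3⟩ := S.integrable_lowerTerm_apply μ hf hg m Q₁
  rw [← e1, ← e2, ← e3]
  set Φ : M2 := (S.freeRes z (Q₁ + Q₂)).comp ((α : ℂ) • σ₁) with hΦ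
  refine Eq.trans ?_ (congrArg Φ ((integral_add (i1.add i2) i3).trans
    (congrArg (· + _) (integral_add i1 i2))))
  refine Eq.trans ?_ (Φ.integral_comp_comm ((i1.add i2).add i3))
  refine integral_congr_ae (Eventually.of_forall fun k => ?_)
  simp only [Gam]
  rw [if_pos hm]
  exact (map_smul (S.freeRes z (Q₁ + Q₂)) (α : ℂ) _).symm

end Model

/-- An added point `q` belongs either to the complement of the distinguished part or to that
part. -/
theorem rep_cons {d : ℕ} (n : ℕ) (μ : Coeff d) (f : Conf d → Spin) (q : E d) (Q : Conf d) :
    rep n μ f (q ::ₘ Q)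
      = ∑ m ∈ Finset.range (n + 1),
          ((Q.powersetCard (n - m)).map fun Q' => term μ f m (q ::ₘ (Q - Q')) Q').sum
        + ∑ m ∈ Finset.range n,
          ((Q.powersetCard (n - (m + 1))).map fun Q' => term μ f m (Q - Q') (q ::ₘ Q')).sum := by
  have h1 : ∀ j m : ℕ, ((Q.powersetCard j).map fun Q' => term μ f m (q ::ₘ Q - Q') Q').sum
      = ((Q.powersetCard j).map fun Q' => term μ f m (q ::ₘ (Q - Q')) Q').sum := by
    intro j m
    refine congrArg _ (Multiset.map_congr rfl fun Q' hQ' => ?_)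
    rw [Multiset.cons_sub_of_le _ (Multiset.mem_powersetCard.1 hQ').1]
  have h2 : ∀ m ∈ Finset.range n,
      (((q ::ₘ Q).powersetCard (n - m)).map fun Q' => term μ f m (q ::ₘ Q - Q') Q').sum
        = ((Q.powersetCard (n - m)).map fun Q' => term μ f m (q ::ₘ (Q - Q')) Q').sum
          + ((Q.powersetCard (n - (m + 1))).map fun Q' => term μ f m (Q - Q') (q ::ₘ Q')).sum := by
    intro m hm
    rw [Finset.mem_range] at hm
    rw [show n - m = n - (m + 1) + 1 by omega, Multiset.powersetCard_cons, Multiset.map_add,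
      Multiset.sum_add, h1, Multiset.map_map]
    congr 1
    refine congrArg _ (Multiset.map_congr rfl fun Q' _ => ?_)
    rw [Function.comp_apply, Multiset.sub_cons, Multiset.erase_cons_head]
  unfold rep
  rw [Finset.sum_range_succ, Finset.sum_range_succ, Finset.sum_congr rfl h2,
    Finset.sum_add_distrib, Nat.sub_self]
  simp only [Multiset.powersetCard_zero_left, Multiset.map_singleton, Multiset.sum_singleton,
    Multiset.sub_zero]
  abel

theorem integrable_smul_multiset_sum {X ι : Type*} [MeasurableSpace X] {ρ : Measure X} (c : X → ℂ)
    (s : Multiset ι) (φ : ι → X → Spin) (hφ : ∀ i ∈ s, Integrable (fun x => c x • φ i x) ρ) :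
    Integrable (fun x => c x • (s.map fun i => φ i x).sum) ρ ∧
      ∫ x, c x • (s.map fun i => φ i x).sum ∂ρ = (s.map fun i => ∫ x, c x • φ i x ∂ρ).sum := by
  induction s using Multiset.induction with
  | empty => simp
  | cons a s ih =>
    obtain ⟨h1, h2⟩ := ih fun i hi => hφ i (Multiset.mem_cons_of_mem hi)
    have h3 := hφ a (Multiset.mem_cons_self a s)
    simp only [Multiset.map_cons, Multiset.sum_cons, smul_add]
    exact ⟨h3.add h1, by rw [integral_add h3 h1, h2]⟩

namespace Model

variable {d : ℕ} (S : Model d)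

theorem integrable_conj_lam_term {n : ℕ} (μ : CoeffSpace S.h n) {f : Conf d → Spin}
    (hf : StronglyMeasurable f) {Q₂ : Conf d} (hg : IsGood S.h f Q₂) (m : ℕ) (Q₁ : Conf d) :
    Integrable (fun q : E d => conj (S.lam q) • term μ.fn f m (q ::ₘ Q₁) Q₂) volume ∧
      Integrable (fun q : E d => conj (S.lam q) • term μ.fn f m Q₁ (q ::ₘ Q₂)) volume := by
  constructor
  · refine (S.integrable_annihilate_prod μ hf hg m Q₁).integral_prod_left.congr
      (Eventually.of_forall fun q => ?_)
    exact integral_smul (conj (S.lam q))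
      fun k : Fin m → E d => μ.fn m (q ::ₘ Q₁) Q₂ k (f (Q₂ + conf k))
  · refine (S.integrable_lower_prod μ hf hg m Q₁).integral_prod_left.congr
      (Eventually.of_forall fun q => ?_)
    exact integral_smul (conj (S.lam q))
      fun k : Fin m → E d => μ.fn m Q₁ (q ::ₘ Q₂) k (f (q ::ₘ Q₂ + conf k))

theorem annihilate_rep {n : ℕ} (μ : CoeffSpace S.h n) {f : Conf d → Spin}
    (hf : StronglyMeasurable f) {Q : Conf d} (hg : ∀ Q' ≤ Q, IsGood S.h f Q') :
    S.annihilate (rep n μ.fn f) Q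
      = ∑ m ∈ Finset.range (n + 1), ((Q.powersetCard (n - m)).map fun Q' =>
          ∫ q : E d, conj (S.lam q) • term μ.fn f m (q ::ₘ (Q - Q')) Q').sum
        + ∑ m ∈ Finset.range (n + 1), ((Q.powersetCard (n - m)).map fun Q' =>
          S.lowerRep μ.fn f (Q - Q') Q' m).sum := by
  have hg' : ∀ j, ∀ Q' ∈ Q.powersetCard j, IsGood S.h f Q' := fun j Q' hQ' =>
    hg Q' (Multiset.mem_powersetCard.1 hQ').1
  have h1 := fun m => integrable_smul_multiset_sum (ρ := volume) (fun q : E d => conj (S.lam q))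
    (Q.powersetCard (n - m)) (fun Q' q => term μ.fn f m (q ::ₘ (Q - Q')) Q')
    fun Q' hQ' => (S.integrable_conj_lam_term μ hf (hg' _ Q' hQ') m _).1
  have h2 := fun m => integrable_smul_multiset_sum (ρ := volume) (fun q : E d => conj (S.lam q))
    (Q.powersetCard (n - (m + 1))) (fun Q' q => term μ.fn f m (Q - Q') (q ::ₘ Q'))
    fun Q' hQ' => (S.integrable_conj_lam_term μ hf (hg' _ Q' hQ') m _).2
  have h3 := integrable_smul_multiset_sum (ρ := volume) (fun q : E d => conj (S.lam q))
    (Finset.range (n + 1)).val (fun m q =>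
      ((Q.powersetCard (n - m)).map fun Q' => term μ.fn f m (q ::ₘ (Q - Q')) Q').sum)
    fun m _ => (h1 m).1
  have h4 := integrable_smul_multiset_sum (ρ := volume) (fun q : E d => conj (S.lam q))
    (Finset.range n).val (fun m q =>
      ((Q.powersetCard (n - (m + 1))).map fun Q' => term μ.fn f m (Q - Q') (q ::ₘ Q')).sum)
    fun m _ => (h2 m).1
  unfold annihilate
  simp only [rep_cons, smul_add]
  refine (integral_add h3.1 h4.1).trans ?_
  congr 1
  · refine h3.2.trans ?_
    exact congrArg _ (Multiset.map_congr rfl fun m _ => (h1 m).2)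
  · refine h4.2.trans ?_
    rw [Finset.sum_range_succ']
    simp only [lowerRep, Multiset.map_const', Multiset.sum_replicate, smul_zero, add_zero]
    exact congrArg _ (Multiset.map_congr rfl fun m _ => (h2 m).2)

theorem create_rep (n : ℕ) (μ : Coeff d) (f : Conf d → Spin) (Q : Conf d) :
    S.create (rep n μ f) Q
      = ∑ m ∈ Finset.range (n + 1), ((Q.powersetCard (n - m)).map fun Q' =>
          ((Q - Q').map fun q => S.lam q • term μ f m ((Q - Q').erase q) Q').sum).sum := by
  have h1 : ∀ m, ((Q.powersetCard (n - m)).map fun Q' =>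
      ((Q - Q').map fun q => S.lam q • term μ f m ((Q - Q').erase q) Q').sum).sum
        = (Q.map fun q => (((Q.erase q).powersetCard (n - m)).map fun Q' =>
          S.lam q • term μ f m (Q.erase q - Q') Q').sum).sum := fun m =>
    (sum_powersetCard_erase Q (n - m) fun q Q₁ Q' => S.lam q • term μ f m Q₁ Q').symm
  simp only [h1]
  refine Eq.trans ?_ (Multiset.sum_map_sum_map Q (Finset.range (n + 1)).val)
  refine congrArg _ (Multiset.map_congr rfl fun q _ => ?_)
  simp only [rep, Finset.smul_sum, Multiset.smul_sum, Multiset.map_map, Function.comp_def]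
  rfl

theorem rep_Gam {n : ℕ} (α : ℝ) (z : ℂ) (μ : CoeffSpace S.h n) {f : Conf d → Spin}
    (hf : StronglyMeasurable f) {Q : Conf d} (hg : ∀ Q' ≤ Q, IsGood S.h f Q') (hQ : n < Q.card) :
    rep n (S.Gam α n z μ.fn) f Q = S.freeRes z Q ((α : ℂ) • σ₁ (
      S.create (rep n μ.fn f) Q + S.annihilate (rep n μ.fn f) Q)) := by
  rw [S.create_rep, S.annihilate_rep μ hf hg, ← add_assoc, ← Finset.sum_add_distrib,
    ← Finset.sum_add_distrib, map_sum, Finset.smul_sum, map_sum]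
  refine Finset.sum_congr rfl fun m hm => ?_
  rw [Finset.mem_range] at hm
  rw [← Multiset.sum_map_add, ← Multiset.sum_map_add, map_multiset_sum, Multiset.smul_sum,
    map_multiset_sum, Multiset.map_map, Multiset.map_map, Multiset.map_map]
  refine congrArg _ (Multiset.map_congr rfl fun Q' hQ' => ?_)
  obtain ⟨hle, hc⟩ := Multiset.mem_powersetCard.1 hQ'
  rw [S.term_Gam α z μ hf (hg Q' hle) (by rw [Multiset.card_sub hle]; omega),
    tsub_add_cancel_of_le hle]
  rfl

theorem term_muHat (α : ℝ) (n : ℕ) (z : ℂ) (f : Conf d → Spin) (m : ℕ) (Q₁ Q₂ : Conf d) :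
    term (S.muHat α n z) f m Q₁ Q₂ = if m = 0 ∧ Q₁.card = 1 ∧ Q₂.card = n then
      S.freeRes z (Q₂ + Q₁) ((α : ℂ) • σ₁ ((Q₁.map S.lam).sum • f Q₂)) else 0 := by
  unfold term muHat
  split_ifs with h
  · obtain ⟨rfl, -⟩ := h
    rw [volume_pi, Measure.pi_of_empty (fun _ : Fin 0 => (volume : Measure (E d))) 0,
      integral_dirac, conf_fin_zero, add_zero, map_smul, map_smul, map_smul]
    rfl
  · simp

theorem rep_muHat (α : ℝ) (n : ℕ) (z : ℂ) (f : Conf d → Spin) {Q : Conf d} (hQ : n < Q.card) :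
    rep n (S.muHat α n z) f Q = S.freeRes z Q
      (if Q.card = n + 1 then (α : ℂ) • σ₁ (S.create f Q) else 0) := by
  unfold rep
  simp only [term_muHat]
  rw [Finset.sum_eq_single 0 (fun m _ hm => by simp [hm]) (fun h => by simp at h)]
  split_ifs with hc
  · have h1 : S.create f Q
        = ((Q.powersetCard n).map fun Q' => ((Q - Q').map S.lam).sum • f Q').sum := by
      have h2 := sum_powersetCard_erase Q n fun q _ Q' => S.lam q • f Q'
      simp only [Multiset.sum_smul, Multiset.map_map, Function.comp_def]
      rw [← h2]
      refine congrArg _ (Multiset.map_congr rfl fun q hq => ?_)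
      have h3 : (Q.erase q).card = n := by
        rw [Multiset.card_erase_of_mem hq, hc]
        rfl
      rw [← h3, Multiset.powersetCard_self]
      simp
    rw [h1, map_multiset_sum, Multiset.smul_sum, map_multiset_sum, Multiset.map_map,
      Multiset.map_map, Multiset.map_map]
    refine congrArg _ (Multiset.map_congr (by simp) fun Q' hQ' => ?_)
    obtain ⟨hle, hc'⟩ := Multiset.mem_powersetCard.1 hQ'
    rw [if_pos ⟨rfl, by rw [Multiset.card_sub hle]; omega, by omega⟩, add_tsub_cancel_of_le hle]
    rfl
  · rw [map_zero]
    refine Multiset.sum_eq_zero fun v hv => ?_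
    obtain ⟨Q', hQ', rfl⟩ := Multiset.mem_map.1 hv
    obtain ⟨hle, hc'⟩ := Multiset.mem_powersetCard.1 hQ'
    rw [if_neg]
    rw [Multiset.card_sub hle]
    omega

end Model

/-! ### The representation of the resolvent -/

/-- Convergence of the iteration `x ↦ a - W x` to its fixed point. -/
theorem tendsto_affine_iteration {V : Type*} [NormedAddCommGroup V] [NormedSpace ℂ V]
    (W : V →L[ℂ] V) (hW : ‖W‖ ≤ 1 / 2) {a X : V} (hX : X + W X = a) (x : ℕ → V)
    (hx : ∀ j, x (j + 1) = a - W (x j)) : Tendsto x atTop (𝓝 X) := by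
  have h1 : ∀ j, ‖x j - X‖ ≤ (1 / 2) ^ j * ‖x 0 - X‖ := by
    intro j
    induction j with
    | zero => simp
    | succ j ih =>
      have h2 : x (j + 1) - X = -W (x j - X) := by
        rw [hx, ← hX, map_sub]
        abel
      rw [h2, norm_neg, pow_succ', mul_assoc]
      exact (W.le_opNorm _).trans (mul_le_mul hW ih (norm_nonneg _) (by norm_num))
  rw [tendsto_iff_norm_sub_tendsto_zero]
  refine squeeze_zero (fun _ => norm_nonneg _) h1 ?_
  have := (tendsto_pow_atTop_nhds_zero_of_lt_one (r := (1 / 2 : ℝ)) (by norm_num)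
    (by norm_num)).mul_const ‖x 0 - X‖
  rwa [zero_mul] at this

namespace Model

variable {d : ℕ} (S : Model d)

/-- Being given by coefficient functions passes to limits in `L²` and in `𝓑_n`. -/
theorem ae_eq_rep_of_tendsto {n : ℕ} (f : HilbEq d n) {x : ℕ → Hilb d} {X : Hilb d}
    {y : ℕ → CoeffSpace S.h n} {μ : CoeffSpace S.h n} (hx : Tendsto x atTop (𝓝 X))
    (hy : Tendsto y atTop (𝓝 μ))
    (hxy : ∀ j, x j =ᵐ[lebesguePoisson d] rep n (y j).fn (f : Hilb d)) :
    X =ᵐ[lebesguePoisson d] rep n μ.fn (f : Hilb d) := by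
  obtain ⟨ns, hns, hlim⟩ := (tendstoInMeasure_of_tendsto_Lp hx).exists_seq_tendsto_ae
  filter_upwards [hlim, ae_all_iff.2 hxy, ae_le (ae_isGood S.h_memLp f)] with Q h1 h2 h3
  obtain ⟨L, hL⟩ := S.exists_rep_clm n (Lp.stronglyMeasurable (f : Hilb d)) h3
  have h4 : Tendsto (fun j => L (y (ns j))) atTop (𝓝 (L μ)) :=
    (L.continuous.tendsto μ).comp (hy.comp hns.tendsto_atTop)
  rw [← hL]
  refine tendsto_nhds_unique h1 (h4.congr fun j => ?_)
  rw [hL, h2]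

/-- The solution of the fixed-point equation represents `(B_n - z)⁻¹ C_n^*`: the iterations for the
vector `F = R T f` and for the coefficient functions correspond to each other. -/
theorem isRepresentedBy_solution {α : ℝ} {n : ℕ} {z : ℂ} {T : HilbEq d n →L[ℂ] HilbGt d n}
    (hT : S.IsCStar α n T) {R : HilbGt d n →L[ℂ] HilbGt d n} {R₀ W : Hilb d →L[ℂ] Hilb d}
    (hW : ‖W‖ ≤ 1 / 2)
    (hR₀ : ∀ F : Hilb d, R₀ F =ᵐ[lebesguePoisson d] fun Q => S.cutRes n z Q (F Q))
    (hWF : ∀ F ∈ HilbGt d n, W F =ᵐ[lebesguePoisson d] fun Q =>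
      S.cutRes n z Q ((α : ℂ) • σ₁ (S.create F Q + S.annihilate F Q)))
    (hR : ∀ G : HilbGt d n, (R G : Hilb d) + W (R G : Hilb d) = R₀ G)
    {G : CoeffSpace S.h n →L[ℂ] CoeffSpace S.h n} {ν μ : CoeffSpace S.h n}
    (hG : ∀ μ, (G μ).fn = S.Gam α n z μ.fn) (hG2 : ‖G‖ ≤ 1 / 2) (hν : ν.fn = S.muHat α n z)
    (hμ : μ + G μ = ν) : IsRepresentedBy (R.comp T) μ := by
  refine isRepresentedBy_of_rep fun f => ?_
  have hf : StronglyMeasurable (f : Hilb d) := Lp.stronglyMeasurable _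
  let x : ℕ → Hilb d := fun j => Nat.rec 0 (fun _ v => R₀ (T f) - W v) j
  let y : ℕ → CoeffSpace S.h n := fun j => Nat.rec 0 (fun _ v => ν - G v) j
  refine S.ae_eq_rep_of_tendsto f (x := x) (y := y)
    (tendsto_affine_iteration W hW (hR (T f)) x fun _ => rfl)
    (tendsto_affine_iteration G hG2 hμ y fun _ => rfl) fun j => ?_
  have hgood := ae_le (ae_isGood S.h_memLp f)
  induction j with
  | zero =>
    filter_upwards [Lp.coeFn_zero Spin 2 (lebesguePoisson d), hgood] with Q h1 h2
    obtain ⟨L, hL⟩ := S.exists_rep_clm n hf h2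
    change (0 : Hilb d) Q = rep n (0 : CoeffSpace S.h n).fn (f : Hilb d) Q
    rw [h1, ← hL, map_zero]
    rfl
  | succ j ih =>
    have hmem : x j ∈ HilbGt d n := by
      have : ∀ᵐ Q ∂lebesguePoisson d, Q.card ∉ Set.Ioi n → x j Q = 0 := by
        filter_upwards [ih] with Q hQ hn
        rw [hQ]
        exact rep_eq_zero _ _ (not_lt.1 hn)
      exact this
    filter_upwards [Lp.coeFn_sub (R₀ (T f)) (W (x j)), hR₀ (T f), hWF _ hmem, hT f,
      S.create_congr_ae ih, S.annihilate_congr_ae ih, hgood] with Q h1 h2 h3 h4 h5 h6 h7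
    change (R₀ (T f) - W (x j) : Hilb d) Q = rep n (ν - G (y j)).fn (f : Hilb d) Q
    obtain ⟨L, hL⟩ := S.exists_rep_clm n hf h7
    by_cases hQ : n < Q.card
    · rw [h1, Pi.sub_apply, h2, h3, h4, h5, h6, ← hL, map_sub, hL, hL, hG, hν,
        S.rep_muHat α n z _ hQ, S.rep_Gam α z (y j) hf h7 hQ, cutRes, if_pos hQ]
    · rw [rep_eq_zero _ _ (not_lt.1 hQ), h1, Pi.sub_apply, h2, h3, cutRes, if_neg hQ]
      simp

end Model

end SpinBoson

theorem mainTheorem2 {d : ℕ} (S : SpinBoson.Model d) (η₀ : ℝ) (hη₀ : 0 < η₀) :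
    ∃ K : ℝ, 0 < K ∧ ∀ η : ℝ, η₀ ≤ η → ∀ n : ℕ,
      CompleteSpace (SpinBoson.CoeffSpace S.h n) ∧
      ∃ α₀ : ℝ, 0 < α₀ ∧ ∀ α : ℝ, 0 ≤ α → α < α₀ →
        ∃ μ : (m : ℕ) → ℂ → SpinBoson.CoeffSpace S.h m,
          (∀ m ≤ n, ∀ z ∈ S.halfPlane m η,
            S.IsSolution α m z (μ m z) ∧
              ∀ ν : SpinBoson.CoeffSpace S.h m, S.IsSolution α m z ν → ν = μ m z) ∧
          AnalyticOnNhd ℂ (μ n) (S.halfPlane n η) ∧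
          (∀ z ∈ S.halfPlane n η, ‖μ n z‖ ≤ K * α / η) ∧
          (∀ z ∈ S.halfPlane n η, ∀ (m : ℕ) (Q₁ Q₂ : SpinBoson.Conf d)
            (k : Fin m → SpinBoson.E d), Q₂.card + m = n →
              z - (S.omegaConf Q₂ : ℂ) ∈ S.halfPlane m η ∧
              (μ n z).fn m Q₁ Q₂ k = (μ m (z - (S.omegaConf Q₂ : ℂ))).fn m Q₁ 0 k) ∧
          (∃ T : SpinBoson.HilbEq d n →L[ℂ] SpinBoson.HilbGt d n, S.IsCStar α n T ∧
            ∀ z ∈ S.halfPlane n η,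
              ∃ R : SpinBoson.HilbGt d n →L[ℂ] SpinBoson.HilbGt d n, S.IsResolvent α n z R ∧
                SpinBoson.IsRepresentedBy (R.comp T) (μ n z)) := by
  obtain ⟨K, hK, hsol⟩ := S.exists_solution hη₀
  refine ⟨K, hK, fun η hη n =>
    ⟨SpinBoson.CoeffSpace.completeSpace S.h_nonneg S.h_le_one, ?_⟩⟩
  have hη0 : 0 < η := hη₀.trans_le hη
  obtain ⟨α₀, hα₀, hsol⟩ := hsol η hη n
  obtain ⟨α₁, hα₁, hres⟩ := S.exists_isResolvent hη0 n
  refine ⟨min α₀ α₁, lt_min hα₀ hα₁, fun α hα0 hα => ?_⟩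
  have hsol := hsol α hα0 (hα.trans_le (min_le_left _ _))
  have hres := hres α hα0 (hα.trans_le (min_le_right _ _))
  choose G ν μ hμan hμ using hsol
  refine ⟨fun m z => if hm : m ≤ n then μ m hm z else 0, fun m hm z hz => ?_, ?_, fun z hz => ?_,
    fun z hz m Q₁ Q₂ k hQ => ?_, ?_⟩
  · obtain ⟨-, -, -, -, h1, h2, -⟩ := hμ m hm z hz
    simp only [dif_pos hm]
    exact ⟨h1, h2⟩
  · simp only [dif_pos le_rfl]
    exact hμan n le_rfl
  · simp only [dif_pos le_rfl]
    exact (hμ n le_rfl z hz).2.2.2.2.2.2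
  · have hm : m ≤ n := by omega
    have hz' := S.sub_omegaConf_mem_halfPlane hz Q₂ hQ
    refine ⟨hz', ?_⟩
    simp only [dif_pos le_rfl, dif_pos hm]
    obtain ⟨ρ, hρ, hρeq⟩ := S.exists_isSolution_freeze (μ n le_rfl z)
      (hμ n le_rfl z hz).2.2.2.2.1 Q₂ hQ
    rw [← (hμ m hm _ hz').2.2.2.2.2.1 ρ hρ, hρeq, zero_add]
  · obtain ⟨T, hT⟩ := S.exists_isCStar α n
    refine ⟨T, hT, fun z hz => ?_⟩
    obtain ⟨R, R₀, W, hR, hW, hR₀, hWF, hRW⟩ := hres z hz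
    obtain ⟨h1, h2, h3, h4, -, -, -⟩ := hμ n le_rfl z hz
    refine ⟨R, hR, ?_⟩
    simp only [dif_pos le_rfl]
    exact S.isRepresentedBy_solution hT hW hR₀ hWF hRW h1 h2 h3 h4
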